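/- Let $M$ be a compact smooth ($C^\infty$, Hausdorff) manifold without boundary of dimension $n\ge 3$, and let $U\subseteq M$ be a nonempty open subset. For a smooth Riemannian metric $g$ on $M$, a \emph{limiting Carleman weight} for $g$ on $U$ is a real-valued smooth function $\varphi$ on $U$ with $d\varphi\neq 0$ everywhere on $U$ such that the Poisson bracket $\{\operatorname{Re}p_\varphi,\operatorname{Im}p_\varphi\}$ on $T^*U$ vanishes at every point of $T^*U$ where $p_\varphi=0$; here $p_\varphi(x,\xi)=|\xi|_g^2-|d\varphi|_g^2+2i\langle\xi,d\varphi\rangle_g$ is the semiclassical principal symbol of the conjugated Laplacian $e^{\varphi/h}(-h^2\Delta_g)e^{-\varphi/h}$. Put $k=3$ if $n=3$ and $k=2$ if $n\ge 4$, and endow the set $\mathcal{M}$ of all smooth Riemannian metrics on $M$ with the $C^k$ topology (uniform convergence on compact subsets of coordinate charts of the metric coefficients and of their partial derivatives of order at most $k$). Then the set of metrics $g\in\mathcal{M}$ for which no limiting Carleman weight exists on $U$ contains a subset that is open and dense in $\mathcal{M}$. -/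

import Mathlib

open scoped Manifold ContDiff Topology UniformConvergence

noncomputable section

namespace CarlemanWeights

/-- The coordinate space `ℝⁿ` with its Euclidean norm. -/
abbrev Coord (n : ℕ) : Type := EuclideanSpace ℝ (Fin n)

/-- The `i`-th partial derivative of `f` at `x`. -/
def partialDeriv {n : ℕ} (i : Fin n) (f : Coord n → ℝ) (x : Coord n) : ℝ :=
  fderiv ℝ f x (EuclideanSpace.single i 1)

/-- The Poisson bracket `∑ i, (∂a/∂ξᵢ ∂b/∂xᵢ - ∂a/∂xᵢ ∂b/∂ξᵢ)` in canonical coordinates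
`(x, ξ)` of a cotangent bundle. -/
def poissonBracket {n : ℕ} (a b : Coord n → Coord n → ℝ) (x ξ : Coord n) : ℝ :=
  ∑ i, (partialDeriv i (fun η => a x η) ξ * partialDeriv i (fun y => b y ξ) x
    - partialDeriv i (fun y => a y ξ) x * partialDeriv i (fun η => b x η) ξ)

section

variable (n : ℕ) (M : Type*) [TopologicalSpace M] [ChartedSpace (Coord n) M]
  [IsManifold (𝓡 n) ∞ M]

/-- Smooth Riemannian metrics on the manifold `M`. -/
abbrev SmoothMetric : Type _ :=
  Bundle.ContMDiffRiemannianMetric (𝓡 n) ∞ (Coord n) (TangentSpace (𝓡 n) : M → Type _)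

variable {n M}

/-- The coordinate vector field `∂ᵢ` of the chart `e`, at the point with coordinates `y`. -/
def coordVector (e : OpenPartialHomeomorph M (Coord n)) (i : Fin n) (y : Coord n) :
    TangentSpace (𝓡 n) (e.symm y) :=
  mfderiv (𝓡 n) (𝓡 n) e.symm y (EuclideanSpace.single i (1 : ℝ) : Coord n)

/-- The matrix `(gᵢⱼ)` of `g` in the chart `e`, as a function of the coordinates. It is meaningful
on `e.target`. -/
def metricMatrix (g : SmoothMetric n M) (e : OpenPartialHomeomorph M (Coord n)) (y : Coord n) :
    Matrix (Fin n) (Fin n) ℝ :=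
  Matrix.of fun i j => g.inner (e.symm y) (coordVector e i y) (coordVector e j y)

variable (n M) in
/-- The `C^k` topology on smooth metrics: uniform convergence, on every compact subset of every
chart of the smooth structure, of the derivatives of order at most `k` of all the coefficients. -/
@[reducible]
def ckTopology (k : ℕ) : TopologicalSpace (SmoothMetric n M) :=
  ⨅ (e : OpenPartialHomeomorph M (Coord n)) (_ : e ∈ IsManifold.maximalAtlas (𝓡 n) ∞ M)
    (i : Fin n) (j : Fin n) (m : ℕ) (_ : m ≤ k),
    TopologicalSpace.induced
      (fun g : SmoothMetric n M =>
        UniformOnFun.ofFun {K : Set (Coord n) | IsCompact K ∧ K ⊆ e.target}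
          (iteratedFDeriv ℝ m fun y => metricMatrix g e y i j))
      inferInstance

/-- In the chart `e`, the semiclassical principal symbol
`|ξ|² - |dφ|² + 2 i ⟨ξ, dφ⟩` of the conjugated Laplacian `e^{φ/h} (-h² Δ_g) e^{-φ/h}`; norms and
products of covectors are taken with the inverse matrix `(gⁱʲ)`. -/
def conjugatedSymbol (g : SmoothMetric n M) (φ : M → ℝ) (e : OpenPartialHomeomorph M (Coord n))
    (x ξ : Coord n) : ℂ :=
  let G := (metricMatrix g e x)⁻¹
  let dφ := fun i => partialDeriv i (fun y => φ (e.symm y)) x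
  ⟨∑ i, ∑ j, G i j * (ξ i * ξ j - dφ i * dφ j), 2 * ∑ i, ∑ j, G i j * (ξ i * dφ j)⟩

/-- `φ` is a limiting Carleman weight on the open set `U` for the metric `g`: it is smooth and
without critical points on `U`, and `{Re p, Im p} = 0` wherever `p = 0` on the cotangent bundle
of `U`, for the symbol `p` of the conjugated Laplacian (equivalently `{p̄, p} = 2i {Re p, Im p}`
vanishes there). The values of `φ` outside `U` play no role. -/
structure IsLimitingCarlemanWeight (g : SmoothMetric n M) (U : Set M) (φ : M → ℝ) : Prop where
  smooth : ContMDiffOn (𝓡 n) 𝓘(ℝ, ℝ) ∞ φ U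
  noncritical : ∀ q ∈ U, mfderiv (𝓡 n) 𝓘(ℝ, ℝ) φ q ≠ 0
  bracket : ∀ e ∈ IsManifold.maximalAtlas (𝓡 n) ∞ M, ∀ q ∈ U ∩ e.source, ∀ ξ : Coord n,
    conjugatedSymbol g φ e (e q) ξ = 0 →
      poissonBracket (fun x η => (conjugatedSymbol g φ e x η).re)
        (fun x η => (conjugatedSymbol g φ e x η).im) (e q) ξ = 0

end

end CarlemanWeights

end

/-!
In a chart around a point `x ∈ U`, the gradient `V` of a limiting Carleman weight is parallel for
the conformal metric which makes it a unit field. Its curvature therefore annihilates `V`, and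
conformal invariance turns this into an equation for the original metric: at `x`, a component of the
Weyl tensor (`n ≥ 4`) or of the Cotton tensor (`n = 3`) vanishes in every orthonormal frame whose
first vector is parallel to `V`. Call an orthonormal frame degenerate if this obstruction vanishes
in all the frames sharing the line of its first vector. Since orthonormal frames form a compact
set, having a degenerate frame at `x` is a closed condition on the `k`-jet of the metric there.

It is also nowhere dense: add to the metric, near `x`, a form whose coefficients are homogeneous
polynomials of degree `k` in the chart. The lower-order jet does not change, and the obstruction in
a given frame moves by a linear functional of the coefficients. The line of the first vector moves
in a space of dimension `n - 1`, while degeneracy imposes `n` independent conditions on the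
coefficients, so that the coefficients producing a degenerate frame form a set of positive
codimension.
-/

noncomputable section

namespace CarlemanWeights

set_option maxSynthPendingDepth 6

/-! ### Tensors in orthogonal frames -/

section FrameChange

open Matrix

variable {R ι κ : Type*} [CommSemiring R] [Fintype ι] [Fintype κ] [DecidableEq κ]

/-- The action of a matrix on covariant tensors: `frameAct Q s` lists the components, in the frame
given by the rows of `Q`, of the tensor with components `s`. The index type `κ` labels the slots. -/
def frameAct (Q : Matrix ι ι R) : ((κ → ι) → R) →ₗ[R] ((κ → ι) → R) where
  toFun s I := ∑ K, s K * ∏ k, Q (I k) (K k)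
  map_add' s t := by
    ext I
    simp [add_mul, Finset.sum_add_distrib]
  map_smul' c s := by
    ext I
    simp [Finset.mul_sum, mul_assoc]

lemma frameAct_apply (Q : Matrix ι ι R) (s : (κ → ι) → R) (I : κ → ι) :
    frameAct Q s I = ∑ K, s K * ∏ k, Q (I k) (K k) := rfl

lemma frameAct_mul (P Q : Matrix ι ι R) (s : (κ → ι) → R) :
    frameAct (P * Q) s = frameAct P (frameAct Q s) := by
  classical
  ext I
  simp only [frameAct_apply, Matrix.mul_apply, Finset.prod_univ_sum, Fintype.piFinset_univ,
    Finset.prod_mul_distrib, Finset.mul_sum, Finset.sum_mul]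
  rw [Finset.sum_comm]
  exact Finset.sum_congr rfl fun K _ => Finset.sum_congr rfl fun J _ => by ring

lemma contDiff_frameAct {G : Type*} [NormedAddCommGroup G] [NormedSpace ℝ G] {k : ℕ∞ω}
    {Q : G → Matrix ι ι ℝ} (hQ : ∀ i j, ContDiff ℝ k fun x => Q x i j) {s : G → (κ → ι) → ℝ}
    (hs : ContDiff ℝ k s) : ContDiff ℝ k fun x => frameAct (Q x) (s x) :=
  contDiff_pi.2 fun _ => ContDiff.sum fun K _ =>
    (contDiff_pi.1 hs K).mul (contDiff_prod fun _ _ => hQ _ _)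

variable [DecidableEq ι]

lemma frameAct_one (s : (κ → ι) → R) : frameAct 1 s = s := by
  ext I
  rw [frameAct_apply, Finset.sum_eq_single I]
  · simp
  · intro K _ hK
    obtain ⟨k, hk⟩ := Function.ne_iff.1 hK
    have hzero : (1 : Matrix ι ι R) (I k) (K k) = 0 := Matrix.one_apply_ne hk.symm
    rw [Finset.prod_eq_zero (Finset.mem_univ k) hzero, mul_zero]
  · simp

lemma frameAct_single (Q : Matrix ι ι R) (K I : κ → ι) :
    frameAct Q (Pi.single K 1) I = ∏ k, Q (I k) (K k) := by
  simp [frameAct_apply, Pi.single_apply]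

end FrameChange

section AxisStabilizer

open Matrix

variable {ι : Type*} [Fintype ι] [DecidableEq ι]

/-- The orthogonal matrices which preserve the axis of index `i₀`. Multiplying a frame by such a
matrix gives the orthonormal frames whose vector of index `i₀` is the same up to sign. -/
def axisStabilizer (i₀ : ι) : Set (Matrix ι ι ℝ) :=
  {A | A * Aᵀ = 1 ∧ ∀ j, j ≠ i₀ → A i₀ j = 0}

lemma mul_mem_axisStabilizer {i₀ : ι} {A B : Matrix ι ι ℝ} (hA : A ∈ axisStabilizer i₀)
    (hB : B ∈ axisStabilizer i₀) : A * B ∈ axisStabilizer i₀ := by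
  refine ⟨?_, fun j hj => ?_⟩
  · rw [transpose_mul, Matrix.mul_assoc, ← Matrix.mul_assoc B, hB.1, Matrix.one_mul, hA.1]
  · rw [mul_apply, Finset.sum_eq_zero]
    intro k _
    obtain rfl | hk := eq_or_ne k i₀
    · rw [hB.2 j hj, mul_zero]
    · rw [hA.2 k hk, zero_mul]

lemma row_dotProduct_row {Q : Matrix ι ι ℝ} (hQ : Q * Qᵀ = 1) (i j : ι) :
    Q i ⬝ᵥ Q j = (1 : Matrix ι ι ℝ) i j := by
  rw [← hQ]
  rfl

end AxisStabilizer

section Reflection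

open Matrix

variable {ι : Type*} [Fintype ι] [DecidableEq ι]

/-- The matrix of the reflection in the hyperplane orthogonal to `w` (the identity if `w = 0`). -/
def reflectionMatrix (w : ι → ℝ) : Matrix ι ι ℝ :=
  1 - (2 / (w ⬝ᵥ w)) • vecMulVec w w

lemma reflectionMatrix_apply (w : ι → ℝ) (i j : ι) :
    reflectionMatrix w i j = (1 : Matrix ι ι ℝ) i j - 2 / (w ⬝ᵥ w) * (w i * w j) := by
  simp [reflectionMatrix, vecMulVec_apply]

lemma reflectionMatrix_smul {t : ℝ} (ht : t ≠ 0) (w : ι → ℝ) :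
    reflectionMatrix (t • w) = reflectionMatrix w := by
  ext i j
  simp only [reflectionMatrix_apply, dotProduct_smul, smul_dotProduct, smul_eq_mul, Pi.smul_apply]
  by_cases h : w ⬝ᵥ w = 0
  · simp [h]
  · field_simp

lemma reflectionMatrix_transpose (w : ι → ℝ) : (reflectionMatrix w)ᵀ = reflectionMatrix w := by
  simp [reflectionMatrix, transpose_vecMulVec]

lemma reflectionMatrix_mul_self (w : ι → ℝ) : reflectionMatrix w * reflectionMatrix w = 1 := by
  have hcoeff : 2 / (w ⬝ᵥ w) * (2 / (w ⬝ᵥ w)) * (w ⬝ᵥ w) = 2 * (2 / (w ⬝ᵥ w)) := by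
    by_cases h : w ⬝ᵥ w = 0
    · simp [h]
    · field_simp
  rw [reflectionMatrix, sub_mul, mul_sub, mul_sub, one_mul, mul_one, one_mul, smul_mul_smul,
    vecMulVec_mul_vecMulVec, vecMulVec_smul, smul_smul, hcoeff]
  module

lemma exists_reflectionMatrix_row (i₀ : ι) (u : ι → ℝ) (hu : u ⬝ᵥ u = 1) :
    ∃ w : ι → ℝ, w ≠ 0 ∧ (reflectionMatrix w i₀ = u ∨ reflectionMatrix w i₀ = -u) := by
  by_cases h : u = Pi.single i₀ 1
  · refine ⟨u, by rintro rfl; simp at hu, Or.inr ?_⟩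
    ext j
    rw [reflectionMatrix_apply, hu, h, Pi.neg_apply, Matrix.one_apply]
    obtain rfl | hj := eq_or_ne i₀ j
    · norm_num
    · simp [hj, hj.symm]
  · refine ⟨Pi.single i₀ 1 - u, fun h0 => h (sub_eq_zero.1 h0).symm, Or.inl ?_⟩
    have hw : (Pi.single i₀ 1 - u) ⬝ᵥ (Pi.single i₀ 1 - u) = 2 * (1 - u i₀) := by
      simp only [sub_dotProduct, dotProduct_sub, hu, single_dotProduct, dotProduct_single,
        Pi.sub_apply, Pi.single_eq_same]
      ring
    have hne : 1 - u i₀ ≠ 0 := fun h0 => by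
      rw [h0, mul_zero, dotProduct_self_eq_zero] at hw
      exact h (sub_eq_zero.1 hw).symm
    ext j
    rw [reflectionMatrix_apply, hw, Matrix.one_apply, Pi.sub_apply, Pi.sub_apply,
      Pi.single_eq_same]
    obtain rfl | hj := eq_or_ne i₀ j
    · rw [if_pos rfl, Pi.single_eq_same]
      field_simp
      ring
    · rw [if_neg hj, Pi.single_eq_of_ne hj.symm]
      field_simp
      ring

lemma exists_reflectionMatrix_mul_transpose_mem_axisStabilizer (i₀ : ι) {Q : Matrix ι ι ℝ}
    (hQ : Q * Qᵀ = 1) :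
    ∃ w : ι → ℝ, w ≠ 0 ∧ reflectionMatrix w * Qᵀ ∈ axisStabilizer i₀ := by
  obtain ⟨w, hw, hrow⟩ := exists_reflectionMatrix_row i₀ (Q i₀) (by simp [row_dotProduct_row hQ])
  refine ⟨w, hw, ?_, fun j hj => ?_⟩
  · rw [transpose_mul, transpose_transpose, reflectionMatrix_transpose, Matrix.mul_assoc,
      ← Matrix.mul_assoc Qᵀ, mul_eq_one_comm.1 hQ, Matrix.one_mul, reflectionMatrix_mul_self]
  · change reflectionMatrix w i₀ ⬝ᵥ Q j = 0
    rcases hrow with h | h <;>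
      simp [h, neg_dotProduct, row_dotProduct_row hQ, Matrix.one_apply_ne hj.symm]

lemma contDiff_reflectionMatrix {G : Type*} [NormedAddCommGroup G] [NormedSpace ℝ G] {k : ℕ∞ω}
    {w : G → ι → ℝ} (hw : ContDiff ℝ k w) (h0 : ∀ x, w x ≠ 0) (i j : ι) :
    ContDiff ℝ k fun x => reflectionMatrix (w x) i j := by
  have hwi := contDiff_pi.1 hw
  simp only [reflectionMatrix_apply]
  refine contDiff_const.sub ((contDiff_const.div ?_ fun x => ?_).mul ((hwi i).mul (hwi j)))
  · exact ContDiff.sum fun k _ => (hwi k).mul (hwi k)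
  · simpa using h0 x

end Reflection

/-! ### Transversality -/

section Transversality

open Matrix

lemma surjective_pi_of_linearIndependent {K V ι : Type*} [Field K] [AddCommGroup V] [Module K V]
    [Finite ι] {f : ι → V →ₗ[K] K} (hf : LinearIndependent K f) :
    Function.Surjective (LinearMap.pi f) := by
  classical
  have := Fintype.ofFinite ι
  rw [← LinearMap.dualMap_injective_iff, injective_iff_map_eq_zero]
  intro θ hθ
  have hsum : ∑ i, θ (Pi.single i 1) • f i = 0 := by
    ext v
    have hv : θ (fun i => f i v) = 0 := LinearMap.congr_fun hθ v
    rw [LinearMap.pi_apply_eq_sum_univ θ] at hv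
    have hsingle (i : ι) : (fun j => if i = j then 1 else 0 : ι → K) = Pi.single i 1 := by
      ext j
      simp [Pi.single_apply, eq_comm]
    simpa [hsingle, mul_comm] using hv
  refine LinearMap.pi_ext' fun i => LinearMap.ext_ring ?_
  exact Fintype.linearIndependent_iff.1 hf _ hsum i

lemma dense_compl_iUnion_range_of_finrank_lt {ι F : Type*} [Countable ι] {E : ι → Type*}
    [∀ i, NormedAddCommGroup (E i)] [∀ i, NormedSpace ℝ (E i)] [∀ i, FiniteDimensional ℝ (E i)]
    [NormedAddCommGroup F] [NormedSpace ℝ F] [FiniteDimensional ℝ F] {Φ : ∀ i, E i → F}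
    (hΦ : ∀ i, ContDiff ℝ 1 (Φ i))
    (hdim : ∀ i, Module.finrank ℝ (E i) < Module.finrank ℝ F) :
    Dense (⋃ i, Set.range (Φ i))ᶜ := by
  obtain hι | ⟨⟨i⟩⟩ := isEmpty_or_nonempty ι
  · simp
  · refine dense_compl_of_dimH_lt_finrank (lt_of_le_of_lt (b := ↑(Module.finrank ℝ F - 1)) ?_ ?_)
    · rw [dimH_iUnion]
      exact iSup_le fun j => (hΦ j).dimH_range_le.trans
        (Nat.cast_le.2 (Nat.le_sub_one_of_lt (hdim j)))
    · have := hdim i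
      exact_mod_cast (by omega : Module.finrank ℝ F - 1 < Module.finrank ℝ F)

lemma finrank_ker_proj_prod_ker_lt {K V ι : Type*} [Field K] [AddCommGroup V] [Module K V]
    [FiniteDimensional K V] [Finite ι] (i : ι) {L : V →ₗ[K] ι → K} (hL : Function.Surjective L) :
    Module.finrank K (LinearMap.ker (LinearMap.proj i : (ι → K) →ₗ[K] K) × LinearMap.ker L)
      < Module.finrank K V := by
  have hrank := (LinearMap.proj i : (ι → K) →ₗ[K] K).finrank_range_add_finrank_ker
  have hrankL := L.finrank_range_add_finrank_ker
  rw [LinearMap.range_eq_top.2 (LinearMap.proj_surjective i), finrank_top,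
    Module.finrank_self] at hrank
  rw [LinearMap.range_eq_top.2 hL, finrank_top] at hrankL
  rw [Module.finrank_prod]
  omega

variable {ι κ : Type*} [Fintype ι] [DecidableEq ι] [Fintype κ] [DecidableEq κ]

/-- A bad tensor is determined by the line of `w`, which moves in dimension `card ι - 1`, and by a
tensor in the common kernel of the `card ι` independent functionals `ℓ p`. -/
theorem dense_setOf_forall_exists_reflection_ne_zero {c : ι → (ι → ι → ℝ) → ℝ}
    (hc : ∀ p, ContDiff ℝ 1 (c p)) {ℓ : ι → ((κ → ι) → ℝ) →ₗ[ℝ] ℝ} (hℓ : LinearIndependent ℝ ℓ) :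
    Dense {s : (κ → ι) → ℝ | ∀ w : ι → ℝ, w ≠ 0 → ∃ p,
      c p (reflectionMatrix w) + ℓ p (frameAct (reflectionMatrix w) s) ≠ 0} := by
  have hL := surjective_pi_of_linearIndependent hℓ
  set L : ((κ → ι) → ℝ) →ₗ[ℝ] (ι → ℝ) := LinearMap.pi ℓ
  obtain ⟨τ, hτ⟩ := L.exists_rightInverse_of_surjective (LinearMap.range_eq_top.2 hL)
  have hLτ (v) : L (τ v) = v := LinearMap.congr_fun hτ v
  let W (i : ι) : Submodule ℝ (ι → ℝ) := LinearMap.ker (LinearMap.proj i : (ι → ℝ) →ₗ[ℝ] ℝ)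
  let w (i : ι) (x : W i × LinearMap.ker L) : ι → ℝ := Pi.single i 1 + (x.1 : ι → ℝ)
  have hw0 (i x) : w i x ≠ 0 := fun h => by
    have hx : (x.1 : ι → ℝ) i = 0 := x.1.2
    simpa [w, hx] using congrFun h i
  let Φ (i : ι) (x : W i × LinearMap.ker L) : (κ → ι) → ℝ :=
    frameAct (reflectionMatrix (w i x))
      ((x.2 : (κ → ι) → ℝ) - τ fun p => c p (reflectionMatrix (w i x)))
  have hΦ (i) : ContDiff ℝ 1 (Φ i) := by
    have hρ := contDiff_reflectionMatrix (k := 1)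
      (contDiff_const.add ((W i).subtypeL.contDiff.comp contDiff_fst)) (hw0 i)
    refine contDiff_frameAct hρ (ContDiff.sub
      ((LinearMap.ker L).subtypeL.contDiff.comp contDiff_snd) ?_)
    exact (LinearMap.toContinuousLinearMap τ).contDiff.comp <| contDiff_pi.2 fun p =>
      (hc p).comp <| contDiff_pi.2 fun a => contDiff_pi.2 fun b => hρ a b
  refine (dense_compl_iUnion_range_of_finrank_lt hΦ fun i =>
    finrank_ker_proj_prod_ker_lt i hL).mono fun s hs w₀ hw₀ => ?_
  by_contra! hzero
  refine hs (Set.mem_iUnion.2 ?_)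
  obtain ⟨i, hi : w₀ i ≠ 0⟩ := Function.ne_iff.1 hw₀
  have hker : frameAct (reflectionMatrix w₀) s + τ (fun p => c p (reflectionMatrix w₀)) ∈
      LinearMap.ker L := by
    rw [LinearMap.mem_ker, map_add, hLτ]
    ext p
    exact (add_comm _ _).trans (hzero p)
  refine ⟨i, ⟨⟨(w₀ i)⁻¹ • w₀ - Pi.single i 1, by simp [W, hi]⟩, ⟨_, hker⟩⟩, ?_⟩
  simp only [Φ, w, add_sub_cancel, reflectionMatrix_smul (inv_ne_zero hi), add_sub_cancel_right]
  rw [← frameAct_mul, reflectionMatrix_mul_self, frameAct_one]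

theorem dense_setOf_forall_exists_axisStabilizer_ne_zero (i₀ : ι) {c : (ι → ι → ℝ) → ℝ}
    (hc : ContDiff ℝ 1 c) {ℓ : ((κ → ι) → ℝ) →ₗ[ℝ] ℝ} {P : ι → Matrix ι ι ℝ}
    (hP : ∀ p, P p ∈ axisStabilizer i₀) (hli : LinearIndependent ℝ fun p => ℓ ∘ₗ frameAct (P p)) :
    Dense {s : (κ → ι) → ℝ | ∀ Q : Matrix ι ι ℝ, Q * Qᵀ = 1 →
      ∃ A ∈ axisStabilizer i₀, c (A * Q) + ℓ (frameAct (A * Q) s) ≠ 0} := by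
  have hcP (p) : ContDiff ℝ 1 fun B : ι → ι → ℝ => c (P p * Matrix.of B) := by
    refine hc.comp (contDiff_pi.2 fun a => contDiff_pi.2 fun b => ContDiff.sum fun k _ => ?_)
    exact contDiff_const.mul (contDiff_pi.1 (contDiff_apply ℝ (ι → ℝ) k) b)
  refine (dense_setOf_forall_exists_reflection_ne_zero hcP hli).mono fun s hs Q hQ => ?_
  obtain ⟨w, hw, hwQ⟩ := exists_reflectionMatrix_mul_transpose_mem_axisStabilizer i₀ hQ
  obtain ⟨p, hp⟩ := hs w hw
  refine ⟨P p * (reflectionMatrix w * Qᵀ), mul_mem_axisStabilizer (hP p) hwQ, ?_⟩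
  rw [Matrix.mul_assoc, Matrix.mul_assoc, mul_eq_one_comm.1 hQ, Matrix.mul_one, frameAct_mul]
  exact hp

end Transversality

/-! ### Levi-Civita connections and curvature -/

section Calculus

variable {E F G H : Type*} [NormedAddCommGroup E] [NormedSpace ℝ E] [NormedAddCommGroup F]
  [NormedSpace ℝ F] [NormedAddCommGroup G] [NormedSpace ℝ G] [NormedAddCommGroup H]
  [NormedSpace ℝ H]

lemma fderiv_clm_apply_apply {f : E → F →L[ℝ] G} {u : E → F} {x : E}
    (hf : DifferentiableAt ℝ f x) (hu : DifferentiableAt ℝ u x) (c : E) :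
    fderiv ℝ (fun y => f y (u y)) x c = fderiv ℝ f x c (u x) + f x (fderiv ℝ u x c) := by
  rw [fderiv_clm_apply hf hu]
  simp [add_comm]

lemma fderiv_clm_apply_const {f : E → F →L[ℝ] G} {x : E}
    (hf : DifferentiableAt ℝ f x) (u : F) (c : E) :
    fderiv ℝ (fun y => f y u) x c = fderiv ℝ f x c u := by
  rw [fderiv_clm_apply_apply hf (differentiableAt_const u)]
  simp

lemma fderiv_clm_apply₂ {f : E → F →L[ℝ] G →L[ℝ] H} {u : E → F} {w : E → G} {x : E}
    (hf : DifferentiableAt ℝ f x) (hu : DifferentiableAt ℝ u x) (hw : DifferentiableAt ℝ w x)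
    (c : E) : fderiv ℝ (fun y => f y (u y) (w y)) x c =
      fderiv ℝ f x c (u x) (w x) + f x (fderiv ℝ u x c) (w x) + f x (u x) (fderiv ℝ w x c) := by
  rw [fderiv_clm_apply_apply (hf.clm_apply hu) hw, fderiv_clm_apply_apply hf hu]
  simp

lemma differentiableAt_of_contDiffOn {f : E → F} {Ω : Set E} (hf : ContDiffOn ℝ ∞ f Ω)
    (hΩ : IsOpen Ω) {x : E} (hx : x ∈ Ω) : DifferentiableAt ℝ f x :=
  (hf.contDiffAt (hΩ.mem_nhds hx)).differentiableAt (by simp)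

lemma contDiffOn_fderiv {f : E → F} {Ω : Set E} (hf : ContDiffOn ℝ ∞ f Ω) (hΩ : IsOpen Ω) :
    ContDiffOn ℝ ∞ (fderiv ℝ f) Ω :=
  hf.fderiv_of_isOpen hΩ (by simp)

lemma fderiv_fderiv_comm {f : E → F} {Ω : Set E} (hf : ContDiffOn ℝ ∞ f Ω) (hΩ : IsOpen Ω)
    {x : E} (hx : x ∈ Ω) (a b : E) :
    fderiv ℝ (fderiv ℝ f) x a b = fderiv ℝ (fderiv ℝ f) x b a :=
  ((hf.contDiffAt (hΩ.mem_nhds hx)).isSymmSndFDerivAt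
    (by simp only [minSmoothness_of_isRCLikeNormedField]; exact ENat.LEInfty.out)) a b

lemma fderiv_congr_of_isOpen {f₁ f₂ : E → F} {Ω : Set E} (hΩ : IsOpen Ω) {x : E} (hx : x ∈ Ω)
    (h : ∀ y ∈ Ω, f₁ y = f₂ y) : fderiv ℝ f₁ x = fderiv ℝ f₂ x :=
  Filter.EventuallyEq.fderiv_eq (Filter.eventually_of_mem (hΩ.mem_nhds hx) h)

end Calculus

section LeviCivita

variable {E : Type*} [NormedAddCommGroup E] [NormedSpace ℝ E]

/-- The Christoffel symbols of the first kind `⟨Γ(a, b), c⟩`, in terms of the first derivative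
`g₁` of a metric. -/
def christoffel (g₁ : E →L[ℝ] E →L[ℝ] E →L[ℝ] ℝ) (a b c : E) : ℝ :=
  (g₁ a b c + g₁ b a c - g₁ c a b) / 2

lemma fderiv_christoffel {F : Type*} [NormedAddCommGroup F] [NormedSpace ℝ F]
    {T : F → E →L[ℝ] E →L[ℝ] E →L[ℝ] ℝ} {x : F} (hT : DifferentiableAt ℝ T x) (u : F)
    (a b c : E) :
    fderiv ℝ (fun y => christoffel (T y) a b c) x u = christoffel (fderiv ℝ T x u) a b c := by
  have hval (a b c : E) : fderiv ℝ (fun y => T y a b c) x u = fderiv ℝ T x u a b c := by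
    rw [fderiv_clm_apply_const (by fun_prop), fderiv_clm_apply_const (by fun_prop),
      fderiv_clm_apply_const hT]
  simp only [christoffel, div_eq_mul_inv]
  rw [fderiv_mul_const (by fun_prop), fderiv_fun_sub (by fun_prop) (by fun_prop),
    fderiv_fun_add (by fun_prop) (by fun_prop)]
  simp only [smul_apply, sub_apply, add_apply, smul_eq_mul, hval]
  ring

lemma differentiableAt_christoffel {F : Type*} [NormedAddCommGroup F] [NormedSpace ℝ F]
    {T : F → E →L[ℝ] E →L[ℝ] E →L[ℝ] ℝ} {x : F} (hT : DifferentiableAt ℝ T x) (a b c : E) :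
    DifferentiableAt ℝ (fun y => christoffel (T y) a b c) x := by
  simp only [christoffel]
  fun_prop

/-- `Γ` is the Levi-Civita connection of the (possibly indefinite) metric `g`, both smooth on the
open set `Ω`. -/
structure IsLeviCivitaOn (Ω : Set E) (g : E → E →L[ℝ] E →L[ℝ] ℝ) (Γ : E → E →L[ℝ] E →L[ℝ] E) :
    Prop where
  isOpen : IsOpen Ω
  metric_smooth : ContDiffOn ℝ ∞ g Ω
  smooth : ContDiffOn ℝ ∞ Γ Ω
  metric_symm : ∀ x ∈ Ω, ∀ a b, g x a b = g x b a
  nondegenerate : ∀ x ∈ Ω, ∀ a, (∀ b, g x a b = 0) → a = 0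
  metric_apply : ∀ x ∈ Ω, ∀ a b c, g x (Γ x a b) c = christoffel (fderiv ℝ g x) a b c

/-- The curvature operator `R(c, a)` of the connection with Christoffel symbols `Γ`. -/
def curvature (Γ : E → E →L[ℝ] E →L[ℝ] E) (x c a : E) : E →L[ℝ] E :=
  fderiv ℝ Γ x c a - fderiv ℝ Γ x a c + (Γ x c).comp (Γ x a) - (Γ x a).comp (Γ x c)

/-- The covariant derivative `(∇_y R)(c, a) z` of the curvature operator. -/
def covCurvature (Γ : E → E →L[ℝ] E →L[ℝ] E) (x y c a z : E) : E :=
  fderiv ℝ (fun x' => curvature Γ x' c a) x y z + Γ x y (curvature Γ x c a z)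
    - curvature Γ x (Γ x y c) a z - curvature Γ x c (Γ x y a) z - curvature Γ x c a (Γ x y z)

lemma curvature_apply (Γ : E → E →L[ℝ] E →L[ℝ] E) (x c a z : E) :
    curvature Γ x c a z = fderiv ℝ Γ x c a z - fderiv ℝ Γ x a c z + Γ x c (Γ x a z)
      - Γ x a (Γ x c z) := rfl

lemma curvature_swap (Γ : E → E →L[ℝ] E →L[ℝ] E) (x c a z : E) :
    curvature Γ x c a z = - curvature Γ x a c z := by
  simp only [curvature_apply]
  abel

lemma curvature_smul_left (Γ : E → E →L[ℝ] E →L[ℝ] E) (x : E) (t : ℝ) (c a : E) :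
    curvature Γ x (t • c) a = t • curvature Γ x c a := by
  ext z
  simp only [curvature_apply, smul_apply, map_smul]
  module

lemma curvature_smul_right (Γ : E → E →L[ℝ] E →L[ℝ] E) (x : E) (t : ℝ) (c a : E) :
    curvature Γ x c (t • a) = t • curvature Γ x c a := by
  ext z
  simp only [curvature_apply, smul_apply, map_smul]
  module

namespace IsLeviCivitaOn

variable {Ω : Set E} {g : E → E →L[ℝ] E →L[ℝ] ℝ} {Γ : E → E →L[ℝ] E →L[ℝ] E}

lemma differentiableAt_metric (h : IsLeviCivitaOn Ω g Γ) {x : E} (hx : x ∈ Ω) :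
    DifferentiableAt ℝ g x :=
  differentiableAt_of_contDiffOn h.metric_smooth h.isOpen hx

lemma differentiableAt (h : IsLeviCivitaOn Ω g Γ) {x : E} (hx : x ∈ Ω) : DifferentiableAt ℝ Γ x :=
  differentiableAt_of_contDiffOn h.smooth h.isOpen hx

lemma contDiffOn_fderiv_metric (h : IsLeviCivitaOn Ω g Γ) : ContDiffOn ℝ ∞ (fderiv ℝ g) Ω :=
  contDiffOn_fderiv h.metric_smooth h.isOpen

lemma differentiableAt_fderiv_metric (h : IsLeviCivitaOn Ω g Γ) {x : E} (hx : x ∈ Ω) :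
    DifferentiableAt ℝ (fderiv ℝ g) x :=
  differentiableAt_of_contDiffOn h.contDiffOn_fderiv_metric h.isOpen hx

lemma differentiableAt_fderiv_fderiv_metric (h : IsLeviCivitaOn Ω g Γ) {x : E} (hx : x ∈ Ω) :
    DifferentiableAt ℝ (fderiv ℝ (fderiv ℝ g)) x :=
  differentiableAt_of_contDiffOn (contDiffOn_fderiv h.contDiffOn_fderiv_metric h.isOpen)
    h.isOpen hx

lemma metric_ext (h : IsLeviCivitaOn Ω g Γ) {x : E} (hx : x ∈ Ω) {a b : E}
    (hab : ∀ c, g x a c = g x b c) : a = b := by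
  rw [← sub_eq_zero]
  refine h.nondegenerate x hx _ fun c => ?_
  rw [map_sub, sub_apply, hab, sub_self]

lemma fderiv_metric_symm (h : IsLeviCivitaOn Ω g Γ) {x : E} (hx : x ∈ Ω) (u a b : E) :
    fderiv ℝ g x u a b = fderiv ℝ g x u b a := by
  have hd := h.differentiableAt_metric hx
  rw [← fderiv_clm_apply_const hd, ← fderiv_clm_apply_const hd,
    ← fderiv_clm_apply_const (hd.clm_apply (differentiableAt_const _)),
    ← fderiv_clm_apply_const (hd.clm_apply (differentiableAt_const _))]
  exact DFunLike.congr_fun (fderiv_congr_of_isOpen h.isOpen hx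
    fun y hy => h.metric_symm y hy _ _) _

lemma symm (h : IsLeviCivitaOn Ω g Γ) {x : E} (hx : x ∈ Ω) (a b : E) : Γ x a b = Γ x b a := by
  refine h.metric_ext hx fun c => ?_
  rw [h.metric_apply x hx, h.metric_apply x hx, christoffel, christoffel,
    h.fderiv_metric_symm hx c a b]
  ring

lemma fderiv_metric (h : IsLeviCivitaOn Ω g Γ) {x : E} (hx : x ∈ Ω) (u a b : E) :
    fderiv ℝ g x u a b = g x (Γ x u a) b + g x a (Γ x u b) := by
  rw [h.metric_symm x hx a, h.metric_apply x hx, h.metric_apply x hx, christoffel, christoffel,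
    h.fderiv_metric_symm hx u b a, h.fderiv_metric_symm hx a u b, h.fderiv_metric_symm hx b u a]
  ring

lemma fderiv_fderiv_metric_symm (h : IsLeviCivitaOn Ω g Γ) {x : E} (hx : x ∈ Ω) (u w a b : E) :
    fderiv ℝ (fderiv ℝ g) x u w a b = fderiv ℝ (fderiv ℝ g) x u w b a := by
  have hd := h.differentiableAt_fderiv_metric hx
  have hd1 := hd.clm_apply (differentiableAt_const w)
  rw [← fderiv_clm_apply_const hd, ← fderiv_clm_apply_const hd1, ← fderiv_clm_apply_const hd1,
    ← fderiv_clm_apply_const (hd1.clm_apply (differentiableAt_const _)),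
    ← fderiv_clm_apply_const (hd1.clm_apply (differentiableAt_const _))]
  exact DFunLike.congr_fun (fderiv_congr_of_isOpen h.isOpen hx
    fun y hy => h.fderiv_metric_symm hy _ _ _) _

lemma fderiv_fderiv_metric_comm (h : IsLeviCivitaOn Ω g Γ) {x : E} (hx : x ∈ Ω) (u w a b : E) :
    fderiv ℝ (fderiv ℝ g) x u w a b = fderiv ℝ (fderiv ℝ g) x w u a b :=
  DFunLike.congr_fun (DFunLike.congr_fun (fderiv_fderiv_comm h.metric_smooth h.isOpen hx u w) a) b

lemma metric_fderiv_apply (h : IsLeviCivitaOn Ω g Γ) {x : E} (hx : x ∈ Ω) (u a b c : E) :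
    g x (fderiv ℝ Γ x u a b) c = christoffel (fderiv ℝ (fderiv ℝ g) x u) a b c
      - fderiv ℝ g x u (Γ x a b) c := by
  have hg := h.differentiableAt_metric hx
  have hΓ := h.differentiableAt hx
  have h1 := DFunLike.congr_fun (fderiv_congr_of_isOpen h.isOpen hx
    fun y hy => h.metric_apply y hy a b c) u
  rw [fderiv_christoffel (h.differentiableAt_fderiv_metric hx),
    fderiv_clm_apply₂ hg (by fun_prop) (by fun_prop),
    fderiv_clm_apply_const (by fun_prop), fderiv_clm_apply_const hΓ] at h1
  simp only [fderiv_fun_const, Pi.zero_apply, zero_apply, map_zero, add_zero] at h1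
  linarith

lemma metric_curvature (h : IsLeviCivitaOn Ω g Γ) {x : E} (hx : x ∈ Ω) (c a z t : E) :
    g x (curvature Γ x c a z) t = christoffel (fderiv ℝ (fderiv ℝ g) x c) a z t
      - christoffel (fderiv ℝ (fderiv ℝ g) x a) c z t
      - g x (Γ x a z) (Γ x c t) + g x (Γ x c z) (Γ x a t) := by
  rw [curvature_apply]
  simp only [map_sub, map_add, sub_apply, add_apply, h.metric_fderiv_apply hx,
    h.fderiv_metric hx]
  ring

lemma metric_curvature_antisymm (h : IsLeviCivitaOn Ω g Γ) {x : E} (hx : x ∈ Ω) (c a z t : E) :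
    g x (curvature Γ x c a z) t = - g x (curvature Γ x c a t) z := by
  rw [h.metric_curvature hx, h.metric_curvature hx]
  have e1 := h.fderiv_fderiv_metric_symm hx
  have e2 := h.fderiv_fderiv_metric_comm hx
  rw [h.metric_symm x hx (Γ x a z), h.metric_symm x hx (Γ x a t)]
  simp only [christoffel]
  rw [e2 c a z t, e2 c a t z, e1 a c z t, e1 a z c t, e1 a t c z, e1 c z a t, e1 c t a z]
  ring

lemma metric_curvature_self (h : IsLeviCivitaOn Ω g Γ) {x : E} (hx : x ∈ Ω) (c a z : E) :
    g x (curvature Γ x c a z) z = 0 := by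
  have := h.metric_curvature_antisymm hx c a z z
  linarith

lemma metric_curvature_pair (h : IsLeviCivitaOn Ω g Γ) {x : E} (hx : x ∈ Ω) (c a z t : E) :
    g x (curvature Γ x c a z) t = g x (curvature Γ x z t c) a := by
  rw [h.metric_curvature hx, h.metric_curvature hx]
  have e1 := h.fderiv_fderiv_metric_symm hx
  have e2 := h.fderiv_fderiv_metric_comm hx
  rw [h.symm hx t c, h.symm hx z a, h.symm hx z c, h.symm hx t a,
    h.metric_symm x hx (Γ x c t)]
  simp only [christoffel]
  rw [e2 z t c a, e2 z c t a, e2 z a t c, e2 t c z a, e2 t a z c, e2 a c z t,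
    e1 c z t a, e1 a z t c, e1 c t z a, e1 a t z c]
  ring

lemma contDiffOn_curvature (h : IsLeviCivitaOn Ω g Γ) (c a : E) :
    ContDiffOn ℝ ∞ (fun x => curvature Γ x c a) Ω := by
  have h1 := contDiffOn_fderiv h.smooth h.isOpen
  have h2 := h.smooth
  unfold curvature
  fun_prop

lemma differentiableAt_curvature (h : IsLeviCivitaOn Ω g Γ) {x : E} (hx : x ∈ Ω) (c a : E) :
    DifferentiableAt ℝ (fun y => curvature Γ y c a) x :=
  differentiableAt_of_contDiffOn (h.contDiffOn_curvature c a) h.isOpen hx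

lemma covCurvature_smul (h : IsLeviCivitaOn Ω g Γ) {x : E} (hx : x ∈ Ω) (r s t : ℝ)
    (y c a z : E) :
    covCurvature Γ x (r • y) (s • c) a (t • z) = (r * s * t) • covCurvature Γ x y c a z := by
  have hd : fderiv ℝ (fun x' => curvature Γ x' (s • c) a) x
      = s • fderiv ℝ (fun x' => curvature Γ x' c a) x := by
    rw [← fderiv_fun_const_smul (h.differentiableAt_curvature hx c a)]
    simp only [curvature_smul_left]
  rw [covCurvature, hd]
  simp only [covCurvature, smul_apply, map_smul, curvature_smul_left, curvature_smul_right]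
  module

lemma fderiv_metric_apply_apply (h : IsLeviCivitaOn Ω g Γ) {x : E} (hx : x ∈ Ω)
    (y a b c d : E) :
    fderiv ℝ (fun x => g x (Γ x a b) (Γ x c d)) x y =
      christoffel (fderiv ℝ (fderiv ℝ g) x y) a b (Γ x c d)
      + christoffel (fderiv ℝ (fderiv ℝ g) x y) c d (Γ x a b)
      - fderiv ℝ g x y (Γ x a b) (Γ x c d) := by
  have hg := h.differentiableAt_metric hx
  have hΓ := h.differentiableAt hx
  rw [fderiv_clm_apply₂ hg (by fun_prop) (by fun_prop),
    fderiv_clm_apply_const (by fun_prop), fderiv_clm_apply_const hΓ,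
    fderiv_clm_apply_const (by fun_prop), fderiv_clm_apply_const hΓ,
    h.metric_symm x hx (Γ x a b) (fderiv ℝ Γ x y c d),
    h.metric_fderiv_apply hx, h.metric_fderiv_apply hx, h.fderiv_metric_symm hx y (Γ x c d)]
  ring

lemma fderiv_metric_curvature (h : IsLeviCivitaOn Ω g Γ) {x : E} (hx : x ∈ Ω) (y c a z t : E) :
    fderiv ℝ (fun x => g x (curvature Γ x c a z) t) x y =
      christoffel (fderiv ℝ (fderiv ℝ (fderiv ℝ g)) x y c) a z t
      - christoffel (fderiv ℝ (fderiv ℝ (fderiv ℝ g)) x y a) c z t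
      - (christoffel (fderiv ℝ (fderiv ℝ g) x y) a z (Γ x c t)
        + christoffel (fderiv ℝ (fderiv ℝ g) x y) c t (Γ x a z)
        - fderiv ℝ g x y (Γ x a z) (Γ x c t))
      + (christoffel (fderiv ℝ (fderiv ℝ g) x y) c z (Γ x a t)
        + christoffel (fderiv ℝ (fderiv ℝ g) x y) a t (Γ x c z)
        - fderiv ℝ g x y (Γ x c z) (Γ x a t)) := by
  have hg := h.differentiableAt_metric hx
  have hg₂ := h.differentiableAt_fderiv_fderiv_metric hx
  have hΓ := h.differentiableAt hx
  have hchr (c a z t : E) : DifferentiableAt ℝ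
      (fun x => christoffel (fderiv ℝ (fderiv ℝ g) x c) a z t) x :=
    differentiableAt_christoffel (by fun_prop) a z t
  rw [fderiv_congr_of_isOpen h.isOpen hx fun y hy => h.metric_curvature hy c a z t,
    fderiv_fun_add (by fun_prop) (by fun_prop), fderiv_fun_sub (by fun_prop) (by fun_prop),
    fderiv_fun_sub (by fun_prop) (by fun_prop)]
  simp only [add_apply, sub_apply, h.fderiv_metric_apply_apply hx]
  rw [fderiv_christoffel (by fun_prop), fderiv_christoffel (by fun_prop),
    fderiv_clm_apply_const hg₂, fderiv_clm_apply_const hg₂]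

lemma metric_covCurvature (h : IsLeviCivitaOn Ω g Γ) {x : E} (hx : x ∈ Ω) (y c a z t : E) :
    g x (covCurvature Γ x y c a z) t =
      christoffel (fderiv ℝ (fderiv ℝ (fderiv ℝ g)) x y c) a z t
      - christoffel (fderiv ℝ (fderiv ℝ (fderiv ℝ g)) x y a) c z t
      - (christoffel (fderiv ℝ (fderiv ℝ g) x y) a z (Γ x c t)
        + christoffel (fderiv ℝ (fderiv ℝ g) x y) c t (Γ x a z)
        - fderiv ℝ g x y (Γ x a z) (Γ x c t))
      + (christoffel (fderiv ℝ (fderiv ℝ g) x y) c z (Γ x a t)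
        + christoffel (fderiv ℝ (fderiv ℝ g) x y) a t (Γ x c z)
        - fderiv ℝ g x y (Γ x c z) (Γ x a t))
      - g x (curvature Γ x (Γ x y c) a z) t - g x (curvature Γ x c (Γ x y a) z) t
      - g x (curvature Γ x c a (Γ x y z)) t - g x (curvature Γ x c a z) (Γ x y t) := by
  have h1 := fderiv_clm_apply₂ (h.differentiableAt_metric hx)
    ((h.differentiableAt_curvature hx c a).clm_apply (differentiableAt_const z))
    (differentiableAt_const t) y
  rw [h.fderiv_metric_curvature hx, fderiv_clm_apply_const (h.differentiableAt_curvature hx c a),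
    h.fderiv_metric hx y (curvature Γ x c a z) t] at h1
  simp only [fderiv_fun_const, Pi.zero_apply, zero_apply, map_zero, add_zero] at h1
  simp only [covCurvature, map_sub, map_add, sub_apply, add_apply]
  linarith

end IsLeviCivitaOn

end LeviCivita

/-! ### Carleman fields -/

section CarlemanField

variable {E : Type*} [NormedAddCommGroup E] [NormedSpace ℝ E]

/-- The equations satisfied by the gradient `V` of a limiting Carleman weight and the gradient `A`
of the logarithm of its length, for a suitable function `μ`: `V` is parallel for the conformal
metric which makes it a unit field. -/
structure IsCarlemanField (Ω : Set E) (g : E → E →L[ℝ] E →L[ℝ] ℝ) (Γ : E → E →L[ℝ] E →L[ℝ] E)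
    (V A : E → E) (μ : E → ℝ) : Prop extends IsLeviCivitaOn Ω g Γ where
  field_smooth : ContDiffOn ℝ ∞ V Ω
  log_smooth : ContDiffOn ℝ ∞ A Ω
  scalar_smooth : ContDiffOn ℝ ∞ μ Ω
  fderiv_field : ∀ x ∈ Ω, ∀ a, fderiv ℝ V x a =
    - Γ x a (V x) + μ x • a + g x (A x) a • V x + g x (V x) a • A x
  field_closed : ∀ x ∈ Ω, ∀ a c, fderiv ℝ (fun y => g y (V y) a) x c
    = fderiv ℝ (fun y => g y (V y) c) x a
  log_closed : ∀ x ∈ Ω, ∀ a c, fderiv ℝ (fun y => g y (A y) a) x c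
    = fderiv ℝ (fun y => g y (A y) c) x a
  metric_log_field : ∀ x ∈ Ω, g x (A x) (V x) = - μ x

/-- The endomorphism `∇A - A ⊗ A`; when `A` is the gradient of the logarithm of a conformal factor,
it is the part of the change of curvature which involves second derivatives. -/
def logHessian (g : E → E →L[ℝ] E →L[ℝ] ℝ) (Γ : E → E →L[ℝ] E →L[ℝ] E) (A : E → E)
    (x c : E) : E :=
  fderiv ℝ A x c + Γ x c (A x) - g x (A x) c • A x

/-- The covariant derivative `∇_y (∇A - A ⊗ A)` of `logHessian`, applied to `c`. -/
def covLogHessian (g : E → E →L[ℝ] E →L[ℝ] ℝ) (Γ : E → E →L[ℝ] E →L[ℝ] E) (A : E → E)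
    (x y c : E) : E :=
  fderiv ℝ (fun x' => logHessian g Γ A x' c) x y + Γ x y (logHessian g Γ A x c)
    - logHessian g Γ A x (Γ x y c)

/-- The covariant derivative `∇_y V` of a Carleman field, as prescribed by
`IsCarlemanField.fderiv_field`. -/
def covField (g : E → E →L[ℝ] E →L[ℝ] ℝ) (V A : E → E) (μ : E → ℝ) (x y : E) : E :=
  μ x • y + g x (A x) y • V x + g x (V x) y • A x

namespace IsCarlemanField

variable {Ω : Set E} {g : E → E →L[ℝ] E →L[ℝ] ℝ} {Γ : E → E →L[ℝ] E →L[ℝ] E} {V A : E → E}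
  {μ : E → ℝ}

lemma differentiableAt_field (h : IsCarlemanField Ω g Γ V A μ) {x : E} (hx : x ∈ Ω) :
    DifferentiableAt ℝ V x :=
  differentiableAt_of_contDiffOn h.field_smooth h.isOpen hx

lemma differentiableAt_log (h : IsCarlemanField Ω g Γ V A μ) {x : E} (hx : x ∈ Ω) :
    DifferentiableAt ℝ A x :=
  differentiableAt_of_contDiffOn h.log_smooth h.isOpen hx

lemma fderiv_metric_log (h : IsCarlemanField Ω g Γ V A μ) {x : E} (hx : x ∈ Ω) (a c : E) :
    fderiv ℝ (fun y => g y (A y) a) x c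
      = g x (logHessian g Γ A x c) a + g x (A x) c * g x (A x) a + g x (A x) (Γ x c a) := by
  have hg := h.differentiableAt_metric hx
  have hA := h.differentiableAt_log hx
  rw [fderiv_clm_apply₂ hg hA (differentiableAt_const a), h.fderiv_metric hx]
  simp only [fderiv_fun_const, Pi.zero_apply, zero_apply, map_zero, add_zero, logHessian, map_add,
    map_sub, add_apply, sub_apply, map_smul, smul_apply, smul_eq_mul]
  ring

lemma logHessian_symm (h : IsCarlemanField Ω g Γ V A μ) {x : E} (hx : x ∈ Ω) (a c : E) :
    g x (logHessian g Γ A x c) a = g x (logHessian g Γ A x a) c := by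
  have h1 := h.log_closed x hx a c
  rw [h.fderiv_metric_log hx, h.fderiv_metric_log hx, h.symm hx c a] at h1
  linarith

lemma fderiv_scalar (h : IsCarlemanField Ω g Γ V A μ) {x : E} (hx : x ∈ Ω) (c : E) :
    fderiv ℝ μ x c = - g x (logHessian g Γ A x c) (V x) + μ x * g x (A x) c
      - g x (A x) (A x) * g x (V x) c := by
  have hg := h.differentiableAt_metric hx
  have hA := h.differentiableAt_log hx
  have hV := h.differentiableAt_field hx
  have h1 : fderiv ℝ (fun y => - g y (A y) (V y)) x = fderiv ℝ μ x :=
    fderiv_congr_of_isOpen h.isOpen hx fun y hy => by rw [h.metric_log_field y hy, neg_neg]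
  rw [← h1, fderiv_fun_neg, neg_apply, fderiv_clm_apply₂ hg hA hV, h.fderiv_metric hx,
    h.fderiv_field x hx]
  simp only [logHessian, map_add, map_neg, map_sub, add_apply, sub_apply, map_smul, smul_apply,
    smul_eq_mul, h.metric_log_field x hx]
  ring

lemma fderiv_fderiv_field (h : IsCarlemanField Ω g Γ V A μ) {x : E} (hx : x ∈ Ω) (c a : E) :
    fderiv ℝ (fderiv ℝ V) x c a = - (fderiv ℝ Γ x c a (V x) + Γ x a (fderiv ℝ V x c))
      + fderiv ℝ μ x c • a
      + (g x (A x) a • fderiv ℝ V x c + fderiv ℝ (fun y => g y (A y) a) x c • V x)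
      + (g x (V x) a • fderiv ℝ A x c + fderiv ℝ (fun y => g y (V y) a) x c • A x) := by
  have hg := h.differentiableAt_metric hx
  have hA := h.differentiableAt_log hx
  have hV := h.differentiableAt_field hx
  have hV1 :=
    differentiableAt_of_contDiffOn (contDiffOn_fderiv h.field_smooth h.isOpen) h.isOpen hx
  have hμ := differentiableAt_of_contDiffOn h.scalar_smooth h.isOpen hx
  have hΓ := h.differentiableAt hx
  have h1 := DFunLike.congr_fun (fderiv_congr_of_isOpen h.isOpen hx
    fun y hy => h.fderiv_field y hy a) c
  rw [fderiv_clm_apply_const hV1, fderiv_fun_add (by fun_prop) (by fun_prop),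
    fderiv_fun_add (by fun_prop) (by fun_prop), fderiv_fun_add (by fun_prop) (by fun_prop),
    fderiv_fun_neg, fderiv_fun_smul (by fun_prop) (by fun_prop),
    fderiv_fun_smul (by fun_prop) (by fun_prop),
    fderiv_fun_smul (by fun_prop) (by fun_prop)] at h1
  simp only [add_apply, neg_apply, smul_apply, fderiv_fun_const, Pi.zero_apply,
    smul_zero, zero_add, ContinuousLinearMap.smulRight_apply] at h1
  rw [h1, fderiv_clm_apply_apply (by fun_prop) hV, fderiv_clm_apply_const hΓ]

lemma curvature_field (h : IsCarlemanField Ω g Γ V A μ) {x : E} (hx : x ∈ Ω) (c a : E) :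
    curvature Γ x c a (V x) =
      - (g x (logHessian g Γ A x c) (V x) + g x (A x) (A x) * g x (V x) c) • a
      + (g x (logHessian g Γ A x a) (V x) + g x (A x) (A x) * g x (V x) a) • c
      + g x (V x) a • logHessian g Γ A x c - g x (V x) c • logHessian g Γ A x a := by
  have h2 := fderiv_fderiv_comm h.field_smooth h.isOpen hx c a
  rw [h.fderiv_fderiv_field hx c a, h.fderiv_fderiv_field hx a c, h.log_closed x hx a c,
    h.field_closed x hx a c] at h2
  simp only [h.fderiv_field x hx, h.fderiv_scalar hx] at h2
  rw [curvature_apply]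
  simp only [map_add, map_neg, map_smul, h.symm hx a c] at h2
  simp only [logHessian] at h2 ⊢
  linear_combination (norm := skip) -h2
  module

lemma metric_curvature_field_eq_zero (h : IsCarlemanField Ω g Γ V A μ) {x : E} (hx : x ∈ Ω)
    {a b c : E} (ha : g x (V x) a = 0) (hb : g x (V x) b = 0) (hac : g x a c = 0)
    (hbc : g x b c = 0) : g x (curvature Γ x a b (V x)) c = 0 := by
  rw [h.curvature_field hx, ha, hb]
  simp [hac, hbc]

lemma contDiffOn_logHessian (h : IsCarlemanField Ω g Γ V A μ) (c : E) :
    ContDiffOn ℝ ∞ (fun x => logHessian g Γ A x c) Ω := by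
  have h1 := contDiffOn_fderiv h.log_smooth h.isOpen
  have h2 := h.smooth
  have h3 := h.metric_smooth
  have h4 := h.log_smooth
  exact ((h1.clm_apply contDiffOn_const).add ((h2.clm_apply contDiffOn_const).clm_apply h4)).sub
    (((h3.clm_apply h4).clm_apply contDiffOn_const).smul h4)

lemma differentiableAt_logHessian (h : IsCarlemanField Ω g Γ V A μ) {x : E} (hx : x ∈ Ω)
    (c : E) : DifferentiableAt ℝ (fun y => logHessian g Γ A y c) x :=
  differentiableAt_of_contDiffOn (h.contDiffOn_logHessian c) h.isOpen hx

lemma covLogHessian_symm (h : IsCarlemanField Ω g Γ V A μ) {x : E} (hx : x ∈ Ω) (y a c : E) :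
    g x (covLogHessian g Γ A x y c) a = g x (covLogHessian g Γ A x y a) c := by
  have hg := h.differentiableAt_metric hx
  have hB := h.differentiableAt_logHessian hx
  have h1 := DFunLike.congr_fun (fderiv_congr_of_isOpen h.isOpen hx
    fun y hy => h.logHessian_symm hy a c) y
  rw [fderiv_clm_apply₂ hg (hB c) (differentiableAt_const a),
    fderiv_clm_apply₂ hg (hB a) (differentiableAt_const c), h.fderiv_metric hx,
    h.fderiv_metric hx] at h1
  simp only [fderiv_fun_const, Pi.zero_apply, zero_apply, map_zero, add_zero] at h1
  simp only [covLogHessian, map_add, map_sub, add_apply, sub_apply]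
  rw [h.logHessian_symm hx a (Γ x y c), h.logHessian_symm hx c (Γ x y a)]
  linarith

lemma fderiv_field_eq_covField (h : IsCarlemanField Ω g Γ V A μ) {x : E} (hx : x ∈ Ω) (y : E) :
    fderiv ℝ V x y = covField g V A μ x y - Γ x y (V x) := by
  rw [h.fderiv_field x hx, covField]
  abel

lemma fderiv_metric_field (h : IsCarlemanField Ω g Γ V A μ) {x : E} (hx : x ∈ Ω) (y c : E) :
    fderiv ℝ (fun x => g x (V x) c) x y
      = g x (covField g V A μ x y) c + g x (V x) (Γ x y c) := by
  rw [fderiv_clm_apply₂ (h.differentiableAt_metric hx) (h.differentiableAt_field hx)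
    (differentiableAt_const c), h.fderiv_metric hx, h.fderiv_field_eq_covField hx]
  simp only [fderiv_fun_const, Pi.zero_apply, zero_apply, map_zero, add_zero, map_sub, sub_apply]
  ring

lemma fderiv_metric_logHessian_field (h : IsCarlemanField Ω g Γ V A μ) {x : E} (hx : x ∈ Ω)
    (y c : E) : fderiv ℝ (fun x => g x (logHessian g Γ A x c) (V x)) x y
      = g x (covLogHessian g Γ A x y c) (V x) + g x (logHessian g Γ A x (Γ x y c)) (V x)
        + g x (logHessian g Γ A x c) (covField g V A μ x y) := by
  rw [fderiv_clm_apply₂ (h.differentiableAt_metric hx) (h.differentiableAt_logHessian hx c)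
    (h.differentiableAt_field hx), h.fderiv_metric hx, h.fderiv_field_eq_covField hx]
  simp only [covLogHessian, map_add, map_sub, add_apply, sub_apply]
  ring

lemma fderiv_metric_log_log (h : IsCarlemanField Ω g Γ V A μ) {x : E} (hx : x ∈ Ω) (y : E) :
    fderiv ℝ (fun x => g x (A x) (A x)) x y
      = 2 * g x (fderiv ℝ A x y + Γ x y (A x)) (A x) := by
  have hA := h.differentiableAt_log hx
  rw [fderiv_clm_apply₂ (h.differentiableAt_metric hx) hA hA, h.fderiv_metric hx,
    h.metric_symm x hx (A x) (fderiv ℝ A x y), h.metric_symm x hx (A x) (Γ x y (A x))]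
  simp only [map_add, add_apply]
  ring

lemma covCurvature_field (h : IsCarlemanField Ω g Γ V A μ) {x : E} (hx : x ∈ Ω) (y c a : E) :
    covCurvature Γ x y c a (V x) = - curvature Γ x c a (covField g V A μ x y)
      - (g x (covLogHessian g Γ A x y c) (V x)
        + g x (logHessian g Γ A x c) (covField g V A μ x y)
        + 2 * g x (fderiv ℝ A x y + Γ x y (A x)) (A x) * g x (V x) c
        + g x (A x) (A x) * g x (covField g V A μ x y) c) • a
      + (g x (covLogHessian g Γ A x y a) (V x)
        + g x (logHessian g Γ A x a) (covField g V A μ x y)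
        + 2 * g x (fderiv ℝ A x y + Γ x y (A x)) (A x) * g x (V x) a
        + g x (A x) (A x) * g x (covField g V A μ x y) a) • c
      + g x (covField g V A μ x y) a • logHessian g Γ A x c
      + g x (V x) a • covLogHessian g Γ A x y c
      - g x (covField g V A μ x y) c • logHessian g Γ A x a
      - g x (V x) c • covLogHessian g Γ A x y a := by
  have hg := h.differentiableAt_metric hx
  have hA := h.differentiableAt_log hx
  have hV := h.differentiableAt_field hx
  have hB := h.differentiableAt_logHessian hx
  have h1 := DFunLike.congr_fun (fderiv_congr_of_isOpen h.isOpen hx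
    fun y hy => h.curvature_field hy c a) y
  rw [fderiv_clm_apply_apply (h.differentiableAt_curvature hx c a) hV,
    fderiv_fun_sub (by fun_prop) (by fun_prop),
    fderiv_fun_add (by fun_prop) (by fun_prop), fderiv_fun_add (by fun_prop) (by fun_prop),
    fderiv_fun_smul (by fun_prop) (by fun_prop), fderiv_fun_smul (by fun_prop) (by fun_prop),
    fderiv_fun_smul (by fun_prop) (by fun_prop), fderiv_fun_smul (by fun_prop) (by fun_prop),
    fderiv_fun_neg, fderiv_fun_add (by fun_prop) (by fun_prop),
    fderiv_fun_add (by fun_prop) (by fun_prop), fderiv_fun_mul (by fun_prop) (by fun_prop),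
    fderiv_fun_mul (by fun_prop) (by fun_prop)] at h1
  simp only [add_apply, sub_apply, neg_apply, smul_apply, fderiv_fun_const, Pi.zero_apply,
    smul_zero, zero_add, ContinuousLinearMap.smulRight_apply, smul_eq_mul,
    h.fderiv_metric_field hx, h.fderiv_metric_logHessian_field hx, h.fderiv_metric_log_log hx,
    h.fderiv_field_eq_covField hx] at h1
  have hD (c : E) : fderiv ℝ (fun x' => logHessian g Γ A x' c) x y
      = covLogHessian g Γ A x y c - Γ x y (logHessian g Γ A x c)
        + logHessian g Γ A x (Γ x y c) := by
    rw [covLogHessian]; abel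
  rw [hD, hD, map_sub] at h1
  have h2 := h.curvature_field hx (Γ x y c) a
  have h3 := h.curvature_field hx c (Γ x y a)
  have h4 := congrArg (Γ x y) (h.curvature_field hx c a)
  simp only [map_add, map_sub, map_smul] at h4
  rw [covCurvature]
  linear_combination (norm := skip) h1 - h2 - h3 + h4
  module

lemma covLogHessian_curl (h : IsCarlemanField Ω g Γ V A μ) {x : E} (hx : x ∈ Ω) (b v : E) :
    covLogHessian g Γ A x b v - covLogHessian g Γ A x v b = curvature Γ x b v (A x)
      - g x (A x) v • (fderiv ℝ A x b + Γ x b (A x))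
      + g x (A x) b • (fderiv ℝ A x v + Γ x v (A x)) := by
  have hg := h.differentiableAt_metric hx
  have hA := h.differentiableAt_log hx
  have hA1 :=
    differentiableAt_of_contDiffOn (contDiffOn_fderiv h.log_smooth h.isOpen) h.isOpen hx
  have hΓ := h.differentiableAt hx
  have key : ∀ b v, fderiv ℝ (fun x' => logHessian g Γ A x' v) x b
      = fderiv ℝ (fderiv ℝ A) x b v + (fderiv ℝ Γ x b v (A x) + Γ x v (fderiv ℝ A x b))
        - (g x (A x) v • fderiv ℝ A x b + fderiv ℝ (fun x => g x (A x) v) x b • A x) := by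
    intro b v
    simp only [logHessian]
    rw [fderiv_fun_sub (by fun_prop) (by fun_prop), fderiv_fun_add (by fun_prop) (by fun_prop),
      fderiv_fun_smul (by fun_prop) (by fun_prop)]
    simp only [add_apply, sub_apply, smul_apply, ContinuousLinearMap.smulRight_apply]
    rw [fderiv_clm_apply_const hA1, fderiv_clm_apply_apply (by fun_prop) hA,
      fderiv_clm_apply_const hΓ]
  simp only [covLogHessian]
  rw [key b v, key v b, h.log_closed x hx v b, fderiv_fderiv_comm h.log_smooth h.isOpen hx b v,
    curvature_apply, h.symm hx b v]
  simp only [logHessian, map_add, map_sub, map_smul]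
  module

lemma fderiv_log_add (g : E → E →L[ℝ] E →L[ℝ] ℝ) (Γ : E → E →L[ℝ] E →L[ℝ] E) (A : E → E)
    (x c : E) :
    fderiv ℝ A x c + Γ x c (A x) = logHessian g Γ A x c + g x (A x) c • A x := by
  rw [logHessian]
  abel

lemma metric_covLogHessian_rotate (h : IsCarlemanField Ω g Γ V A μ) {x : E} (hx : x ∈ Ω)
    (v a b : E) :
    g x (covLogHessian g Γ A x v b) a = g x (covLogHessian g Γ A x b a) v
      + g x (curvature Γ x v b (A x)) a + g x (A x) v * g x (logHessian g Γ A x b) a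
      - g x (A x) b * g x (logHessian g Γ A x v) a := by
  have hcurl := congrArg (fun X => g x X a) (h.covLogHessian_curl hx b v)
  rw [fderiv_log_add g, fderiv_log_add g, curvature_swap] at hcurl
  simp only [map_add, map_sub, map_neg, map_smul, add_apply, sub_apply, neg_apply, smul_apply,
    smul_eq_mul] at hcurl
  rw [h.covLogHessian_symm hx b a v] at hcurl
  linarith

/-- The two sides are components of the covariant derivative of the curvature which, in dimension
three, differ by a component of the Cotton tensor. -/
lemma cotton_eq_zero (h : IsCarlemanField Ω g Γ V A μ) {x : E} (hx : x ∈ Ω) {a b : E}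
    (ha : g x (V x) a = 0) (hb : g x (V x) b = 0) (hab : g x a b = 0)
    (hspan : ∃ r s t : ℝ, A x = r • V x + s • a + t • b) :
    g x b b * g x (covCurvature Γ x (V x) (V x) b (V x)) a
      = g x (V x) (V x) * g x (covCurvature Γ x b a b (V x)) b := by
  obtain ⟨r, s, t, hA⟩ := hspan
  have hE1 := congrArg (fun X => g x X a) (h.covCurvature_field hx (V x) (V x) b)
  have hE2 := congrArg (fun X => g x X b) (h.covCurvature_field hx b a b)
  have hT1 := congrArg (fun X => g x X a) (h.curvature_field hx (V x) b)
  have hT2 := congrArg (fun X => g x X b) (h.curvature_field hx b a)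
  have hT3 := congrArg (fun X => g x X b) (h.curvature_field hx a b)
  have hrot := h.metric_covLogHessian_rotate hx (V x) a b
  have hpair := h.metric_curvature_pair hx (V x) b b a
  have hμ := h.metric_log_field x hx
  set v := V x with hv
  have hav : g x a v = 0 := by rw [h.metric_symm x hx, ha]
  have hbv : g x b v = 0 := by rw [h.metric_symm x hx, hb]
  have hba : g x b a = 0 := by rw [h.metric_symm x hx, hab]
  have hAv : g x (A x) v = r * g x v v := by rw [hA]; simp [hav, hbv]
  have hAb : g x (A x) b = t * g x b b := by rw [hA]; simp [hab, hb]
  have hμ' : μ x = - (r * g x v v) := by linarith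
  have hRA : g x (curvature Γ x v b (A x)) a
      = r * g x (curvature Γ x v b v) a + t * g x (curvature Γ x v b b) a := by
    rw [hA]
    simp [h.metric_curvature_self hx]
  simp only [covField, ← hv, map_add, map_sub, map_neg, map_smul, add_apply, sub_apply, neg_apply,
    smul_apply, smul_eq_mul, ha, hb, hab, hba, h.metric_curvature_self hx, mul_zero, add_zero,
    zero_add, sub_zero, zero_smul] at hE1 hE2 hT1 hT2 hT3
  rw [hE1, hE2, hrot, hRA, hT1, hpair, hT2, hT3, h.logHessian_symm hx a v,
    h.logHessian_symm hx a b, hAv, hAb, hμ']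
  ring

end IsCarlemanField

end CarlemanField

/-! ### Orthonormal frames and curvature jets -/

section Frames

variable {E : Type*} [NormedAddCommGroup E] [NormedSpace ℝ E] {n : ℕ}

/-- The frame with components `P` in the frame `F`. -/
def frameMul (P : Matrix (Fin n) (Fin n) ℝ) (F : Fin n → E) (i : Fin n) : E := ∑ j, P i j • F j

/-- The family `F` is orthonormal for the bilinear form `B`. -/
def IsOrthoFrame (B : E →L[ℝ] E →L[ℝ] ℝ) (F : Fin n → E) : Prop :=
  ∀ i j, B (F i) (F j) = if i = j then 1 else 0

lemma frameMul_mul (P Q : Matrix (Fin n) (Fin n) ℝ) (F : Fin n → E) :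
    frameMul (P * Q) F = frameMul P (frameMul Q F) := by
  ext i
  simp only [frameMul, Matrix.mul_apply, Finset.sum_smul, Finset.smul_sum, smul_smul]
  rw [Finset.sum_comm]

lemma IsOrthoFrame.frameMul {B : E →L[ℝ] E →L[ℝ] ℝ} {F : Fin n → E} (hF : IsOrthoFrame B F)
    {P : Matrix (Fin n) (Fin n) ℝ} (hP : P * P.transpose = 1) : IsOrthoFrame B (frameMul P F) := by
  intro i j
  rw [← Matrix.one_apply, ← row_dotProduct_row hP]
  simp only [CarlemanWeights.frameMul, map_sum, map_smul, sum_apply, smul_apply, hF _ _,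
    smul_eq_mul, mul_ite, mul_one, mul_zero, Finset.sum_ite_eq',
    Finset.mem_univ, if_true, dotProduct]
  exact Finset.sum_congr rfl fun k _ => mul_comm _ _

lemma IsOrthoFrame.apply_eq_zero {B : E →L[ℝ] E →L[ℝ] ℝ} {F : Fin n → E}
    (hF : IsOrthoFrame B F) {i j : Fin n} (hij : i ≠ j) {t : ℝ} {v : E} (hv : F i = t • v) :
    B v (F j) = 0 := by
  have hii := hF i i
  have hji := hF i j
  rw [hv, map_smul, smul_eq_mul, if_pos rfl] at hii
  rw [hv, map_smul, smul_apply, smul_eq_mul, if_neg hij] at hji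
  exact (mul_eq_zero.1 hji).resolve_left (left_ne_zero_of_mul_eq_one hii)

lemma continuous_frameMul (P : Matrix (Fin n) (Fin n) ℝ) :
    Continuous fun F : Fin n → E => frameMul P F := by
  unfold frameMul
  fun_prop

lemma IsOrthoFrame.linearIndependent {B : E →L[ℝ] E →L[ℝ] ℝ} {F : Fin n → E}
    (hF : IsOrthoFrame B F) : LinearIndependent ℝ F := by
  rw [Fintype.linearIndependent_iff]
  intro c hc i
  have h := congrArg (fun X => B X (F i)) hc
  simpa [hF _ _] using h

lemma IsOrthoFrame.sum_smul [FiniteDimensional ℝ E] {B : E →L[ℝ] E →L[ℝ] ℝ} {F : Fin n → E}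
    (hF : IsOrthoFrame B F) (hn : Module.finrank ℝ E = n) (X : E) :
    ∑ i, B X (F i) • F i = X := by
  have hspan : ⊤ ≤ Submodule.span ℝ (Set.range F) :=
    (hF.linearIndependent.span_eq_top_of_card_eq_finrank' (by simp [hn])).ge
  obtain ⟨c, rfl⟩ :=
    (Submodule.mem_span_range_iff_exists_fun ℝ).1 (hspan (Submodule.mem_top (x := X)))
  simp [hF _ _]

lemma exists_isOrthoFrame [FiniteDimensional ℝ E] {B : E →L[ℝ] E →L[ℝ] ℝ}
    (hB : ∀ a b, B a b = B b a) (hpos : ∀ a, a ≠ 0 → 0 < B a a)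
    (hn : Module.finrank ℝ E = n) : ∃ F : Fin n → E, IsOrthoFrame B F := by
  subst hn
  let B' : LinearMap.BilinForm ℝ E := LinearMap.mk₂ ℝ (fun a b => B a b) (by simp) (by simp)
    (by simp) (by simp)
  obtain ⟨v, hv⟩ := LinearMap.BilinForm.exists_orthogonal_basis (B := B') ⟨fun a b => hB a b⟩
  refine ⟨fun i => (√(B (v i) (v i)))⁻¹ • v i, fun i j => ?_⟩
  have hp := hpos (v i) (v.ne_zero i)
  have hs : √(B (v i) (v i)) ≠ 0 := (Real.sqrt_pos.2 hp).ne'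
  by_cases hij : i = j
  · subst hij
    simp only [map_smul, smul_apply, smul_eq_mul, if_true]
    field_simp
    rw [Real.sq_sqrt hp.le]
  · have h0 : B (v i) (v j) = 0 := hv hij
    simp [h0, hij]

lemma exists_pos_mul_norm_sq_le [FiniteDimensional ℝ E] {B : E →L[ℝ] E →L[ℝ] ℝ}
    (hpos : ∀ a, a ≠ 0 → 0 < B a a) : ∃ c > 0, ∀ a, c * ‖a‖ ^ 2 ≤ B a a := by
  have hK : IsCompact (Metric.sphere (0 : E) 1) := isCompact_sphere 0 1
  have hcont : Continuous fun a => B a a := by fun_prop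
  have key : ∃ c > 0, ∀ a ∈ Metric.sphere (0 : E) 1, c ≤ B a a := by
    rcases (Metric.sphere (0 : E) 1).eq_empty_or_nonempty with h | h
    · exact ⟨1, one_pos, by simp [h]⟩
    · obtain ⟨a, ha, hmin⟩ := hK.exists_isMinOn h hcont.continuousOn
      exact ⟨B a a, hpos a (by rintro rfl; simp at ha), fun b hb => hmin hb⟩
  obtain ⟨c, hc, h⟩ := key
  refine ⟨c, hc, fun a => ?_⟩
  by_cases ha : a = 0
  · simp [ha]
  have hn : ‖a‖ ≠ 0 := norm_ne_zero_iff.2 ha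
  have h1 := h (‖a‖⁻¹ • a) (by simp [norm_smul, hn])
  simp only [map_smul, smul_apply, smul_eq_mul] at h1
  calc c * ‖a‖ ^ 2 ≤ ‖a‖⁻¹ * (‖a‖⁻¹ * B a a) * ‖a‖ ^ 2 := by gcongr
    _ = B a a := by field_simp

/-- For some orthonormal frame `F`, the function `f` vanishes at every orthonormal frame whose
vector of index `i₀` is parallel to that of `F`. -/
def HasDegenerateFrame (B : E →L[ℝ] E →L[ℝ] ℝ) (f : (Fin n → E) → ℝ) (i₀ : Fin n) : Prop :=
  ∃ F : Fin n → E, IsOrthoFrame B F ∧ ∀ P ∈ axisStabilizer i₀, f (frameMul P F) = 0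

section Parameters

variable {T : Type*} [TopologicalSpace T] {B : T → E →L[ℝ] E →L[ℝ] ℝ}

lemma exists_eventually_mul_norm_sq_le [FiniteDimensional ℝ E] {t₀ : T}
    (hB : ContinuousAt B t₀) (hpos : ∀ a, a ≠ 0 → 0 < B t₀ a a) :
    ∃ c > 0, ∀ᶠ t in 𝓝 t₀, ∀ a, c * ‖a‖ ^ 2 ≤ B t a a := by
  obtain ⟨c, hc, hle⟩ := exists_pos_mul_norm_sq_le hpos
  have hnear : ∀ᶠ t in 𝓝 t₀, ‖B t - B t₀‖ < c / 2 := by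
    have h := (hB.sub_const (B t₀)).norm
    simp only [sub_self, norm_zero] at h
    exact h.eventually (gt_mem_nhds (by positivity))
  refine ⟨c / 2, by positivity, hnear.mono fun t ht a => ?_⟩
  have hdiff : |(B t - B t₀) a a| ≤ c / 2 * ‖a‖ * ‖a‖ :=
    ((B t - B t₀).le_opNorm₂ a a).trans (by gcongr)
  simp only [sub_apply] at hdiff
  nlinarith [(abs_le.1 hdiff).1, hle a]

lemma exists_eventually_norm_le_of_isOrthoFrame [FiniteDimensional ℝ E] {t₀ : T}
    (hB : ContinuousAt B t₀) (hpos : ∀ a, a ≠ 0 → 0 < B t₀ a a) :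
    ∃ r : ℝ, ∀ᶠ t in 𝓝 t₀, ∀ F : Fin n → E, IsOrthoFrame (B t) F → ‖F‖ ≤ r := by
  obtain ⟨c, hc, hle⟩ := exists_eventually_mul_norm_sq_le hB hpos
  refine ⟨√(1 / c), hle.mono fun t ht F hF => ?_⟩
  rw [pi_norm_le_iff_of_nonneg (Real.sqrt_nonneg _)]
  intro i
  apply Real.le_sqrt_of_sq_le
  have hone : B t (F i) (F i) = 1 := by rw [hF, if_pos rfl]
  rw [le_div_iff₀ hc, mul_comm, ← hone]
  exact ht (F i)

lemma exists_eventually_abs_le_mul [FiniteDimensional ℝ E] {C : T → E →L[ℝ] E →L[ℝ] ℝ} {t₀ : T}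
    (hB : ContinuousAt B t₀) (hpos : ∀ a, a ≠ 0 → 0 < B t₀ a a) (hC : ContinuousAt C t₀) :
    ∃ r : ℝ, ∀ᶠ t in 𝓝 t₀, ∀ a, |C t a a| ≤ r * B t a a := by
  obtain ⟨c, hc, hle⟩ := exists_eventually_mul_norm_sq_le hB hpos
  have hbound : ∀ᶠ t in 𝓝 t₀, ‖C t‖ < ‖C t₀‖ + 1 := hC.norm.eventually (gt_mem_nhds (by simp))
  refine ⟨(‖C t₀‖ + 1) / c, ?_⟩
  filter_upwards [hle, hbound] with t hlower hupper a
  calc |C t a a| ≤ ‖C t‖ * ‖a‖ * ‖a‖ := (C t).le_opNorm₂ a a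
    _ ≤ (‖C t₀‖ + 1) * ‖a‖ * ‖a‖ := by gcongr
    _ = (‖C t₀‖ + 1) / c * (c * ‖a‖ ^ 2) := by field_simp
    _ ≤ (‖C t₀‖ + 1) / c * B t a a := by gcongr; exact hlower a

lemma isClosed_setOf_isOrthoFrame_and_forall_eq_zero (hB : Continuous B)
    {f : T → (Fin n → E) → ℝ} (hf : Continuous fun p : T × (Fin n → E) => f p.1 p.2)
    (i₀ : Fin n) : IsClosed {p : T × (Fin n → E) |
      IsOrthoFrame (B p.1) p.2 ∧ ∀ P ∈ axisStabilizer i₀, f p.1 (frameMul P p.2) = 0} := by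
  have _hB : Continuous fun p : T × (Fin n → E) => B p.1 := hB.comp continuous_fst
  simp only [IsOrthoFrame, Set.ofPred_and, Set.ofPred_forall]
  refine .inter (isClosed_iInter fun i => isClosed_iInter fun j =>
    isClosed_eq (by fun_prop) continuous_const) (isClosed_iInter fun P => isClosed_iInter fun _ =>
    isClosed_eq ?_ continuous_const)
  exact hf.comp (continuous_fst.prodMk ((continuous_frameMul P).comp continuous_snd))

lemma isOpen_not_hasDegenerateFrame [FiniteDimensional ℝ E] (hB : Continuous B)
    (hpos : ∀ t a, a ≠ 0 → 0 < B t a a)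
    {f : T → (Fin n → E) → ℝ} (hf : Continuous fun p : T × (Fin n → E) => f p.1 p.2)
    (i₀ : Fin n) : IsOpen {t | ¬ HasDegenerateFrame (B t) (f t) i₀} := by
  rw [isOpen_iff_mem_nhds]
  intro t₀ ht₀
  obtain ⟨r, hr⟩ := exists_eventually_norm_le_of_isOrthoFrame (n := n) hB.continuousAt (hpos t₀)
  have hopen := (isClosed_setOf_isOrthoFrame_and_forall_eq_zero hB hf i₀).isOpen_compl
  have hcomp : ∀ᶠ t in 𝓝 t₀, ∀ F ∈ Metric.closedBall (0 : Fin n → E) r,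
      ¬(IsOrthoFrame (B t) F ∧ ∀ P ∈ axisStabilizer i₀, f t (frameMul P F) = 0) :=
    (isCompact_closedBall _ r).eventually_forall_of_forall_eventually fun F _ =>
      hopen.mem_nhds (x := (t₀, F)) fun hF => ht₀ ⟨F, hF⟩
  filter_upwards [hr, hcomp] with t hbound hnot
  rintro ⟨F, hF, hP⟩
  exact hnot F (mem_closedBall_zero_iff.2 (hbound F hF)) ⟨hF, hP⟩

end Parameters

lemma exists_isOrthoFrame_smul_eq [FiniteDimensional ℝ E] {B : E →L[ℝ] E →L[ℝ] ℝ}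
    (hB : ∀ a b, B a b = B b a) (hpos : ∀ a, a ≠ 0 → 0 < B a a)
    (hn : Module.finrank ℝ E = n) (i₀ : Fin n) {v : E} (hv : v ≠ 0) :
    ∃ F : Fin n → E, IsOrthoFrame B F ∧ ∃ t : ℝ, F i₀ = t • v := by
  obtain ⟨e, he⟩ := exists_isOrthoFrame hB hpos hn
  have hp := hpos v hv
  have hexp := he.sum_smul hn v
  set u : Fin n → ℝ := fun i => (√(B v v))⁻¹ * B v (e i) with hu
  have hsum : ∑ i, B v (e i) * B v (e i) = B v v := by
    have h := congrArg (B v) hexp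
    simpa only [map_sum, map_smul, smul_eq_mul] using h
  have huu : u ⬝ᵥ u = 1 := by
    simp only [dotProduct, hu, mul_mul_mul_comm _ (B v _), ← Finset.mul_sum, hsum]
    rw [← mul_inv, Real.mul_self_sqrt hp.le, inv_mul_cancel₀ hp.ne']
  have hue : ∑ j, u j • e j = (√(B v v))⁻¹ • v := by
    simp only [hu, mul_smul, ← Finset.smul_sum, hexp]
  obtain ⟨w, -, hrow⟩ := exists_reflectionMatrix_row i₀ u huu
  refine ⟨frameMul (reflectionMatrix w) e, he.frameMul ?_, ?_⟩
  · rw [reflectionMatrix_transpose, reflectionMatrix_mul_self]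
  · rcases hrow with h | h
    · exact ⟨(√(B v v))⁻¹, by rw [frameMul, h, hue]⟩
    · refine ⟨-(√(B v v))⁻¹, ?_⟩
      simp only [frameMul, h, Pi.neg_apply, neg_smul, Finset.sum_neg_distrib, hue]

lemma exists_frameMul_eq [FiniteDimensional ℝ E] {B : E →L[ℝ] E →L[ℝ] ℝ} {F F₀ : Fin n → E}
    (hF : IsOrthoFrame B F) (hF₀ : IsOrthoFrame B F₀) (hn : Module.finrank ℝ E = n) :
    ∃ Q : Matrix (Fin n) (Fin n) ℝ, Q * Q.transpose = 1 ∧ frameMul Q F₀ = F := by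
  have hmul : frameMul (Matrix.of fun i j => B (F i) (F₀ j)) F₀ = F :=
    funext fun i => hF₀.sum_smul hn (F i)
  refine ⟨Matrix.of fun i j => B (F i) (F₀ j), ?_, hmul⟩
  ext i k
  rw [Matrix.mul_apply, Matrix.one_apply, ← hF i k]
  conv_rhs => rw [← hF₀.sum_smul hn (F k)]
  simp only [map_sum, map_smul, smul_eq_mul, Matrix.transpose_apply, Matrix.of_apply]
  exact Finset.sum_congr rfl fun j _ => mul_comm _ _

lemma IsOrthoFrame.apply_frameMul {B : E →L[ℝ] E →L[ℝ] ℝ} {F₀ : Fin n → E}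
    (hF₀ : IsOrthoFrame B F₀) (Q : Matrix (Fin n) (Fin n) ℝ) (i k : Fin n) :
    B (F₀ k) (CarlemanWeights.frameMul Q F₀ i) = Q i k := by
  simp [CarlemanWeights.frameMul, hF₀ _ _]

end Frames

section Jets

variable {E : Type*} [NormedAddCommGroup E] [NormedSpace ℝ E] {n : ℕ}

/-- The Christoffel symbols of the second kind `Γ(a, b)`, computed from the first derivative `g₁` of
the metric and the orthonormal frame `F`. -/
def jetGamma (g₁ : E →L[ℝ] E →L[ℝ] E →L[ℝ] ℝ) (F : Fin n → E) (a b : E) : E :=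
  ∑ i, christoffel g₁ a b (F i) • F i

/-- The curvature tensor `⟨R(c, a) z, t⟩`, computed from the first two derivatives of the metric and
the orthonormal frame `F`. -/
def jetCurvature (g₁ : E →L[ℝ] E →L[ℝ] E →L[ℝ] ℝ) (g₂ : E →L[ℝ] E →L[ℝ] E →L[ℝ] E →L[ℝ] ℝ)
    (F : Fin n → E) (c a z t : E) : ℝ :=
  christoffel (g₂ c) a z t - christoffel (g₂ a) c z t
    - christoffel g₁ a z (jetGamma g₁ F c t) + christoffel g₁ c z (jetGamma g₁ F a t)

/-- The covariant derivative `⟨(∇_y R)(c, a) z, t⟩` of the curvature tensor, computed from the first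
three derivatives of the metric and the orthonormal frame `F`. -/
def jetCovCurvature (g₁ : E →L[ℝ] E →L[ℝ] E →L[ℝ] ℝ) (g₂ : E →L[ℝ] E →L[ℝ] E →L[ℝ] E →L[ℝ] ℝ)
    (g₃ : E →L[ℝ] E →L[ℝ] E →L[ℝ] E →L[ℝ] E →L[ℝ] ℝ) (F : Fin n → E) (y c a z t : E) : ℝ :=
  christoffel (g₃ y c) a z t - christoffel (g₃ y a) c z t
    - (christoffel (g₂ y) a z (jetGamma g₁ F c t) + christoffel (g₂ y) c t (jetGamma g₁ F a z)
      - g₁ y (jetGamma g₁ F a z) (jetGamma g₁ F c t))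
    + (christoffel (g₂ y) c z (jetGamma g₁ F a t) + christoffel (g₂ y) a t (jetGamma g₁ F c z)
      - g₁ y (jetGamma g₁ F c z) (jetGamma g₁ F a t))
    - jetCurvature g₁ g₂ F (jetGamma g₁ F y c) a z t
    - jetCurvature g₁ g₂ F c (jetGamma g₁ F y a) z t
    - jetCurvature g₁ g₂ F c a (jetGamma g₁ F y z) t
    - jetCurvature g₁ g₂ F c a z (jetGamma g₁ F y t)

/-- The component `R(F₁, F₂, F₀, F₃)` of the curvature tensor, which vanishes on the orthonormal
frames whose vector `F₀` is parallel to the gradient of a limiting Carleman weight. The frame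
vectors being orthonormal, it is also a component of the Weyl tensor. -/
def weylObstruction {m : ℕ} (g₁ : E →L[ℝ] E →L[ℝ] E →L[ℝ] ℝ)
    (g₂ : E →L[ℝ] E →L[ℝ] E →L[ℝ] E →L[ℝ] ℝ) (F : Fin (m + 4) → E) : ℝ :=
  jetCurvature g₁ g₂ F (F 1) (F 2) (F 0) (F 3)

/-- The three-dimensional analogue of `weylObstruction`: the difference of two components of the
covariant derivative of the curvature, which is a component of the Cotton tensor. -/
def cottonObstruction (g₁ : E →L[ℝ] E →L[ℝ] E →L[ℝ] ℝ)
    (g₂ : E →L[ℝ] E →L[ℝ] E →L[ℝ] E →L[ℝ] ℝ) (g₃ : E →L[ℝ] E →L[ℝ] E →L[ℝ] E →L[ℝ] E →L[ℝ] ℝ)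
    (F : Fin 3 → E) : ℝ :=
  jetCovCurvature g₁ g₂ g₃ F (F 0) (F 0) (F 2) (F 0) (F 1)
    - jetCovCurvature g₁ g₂ g₃ F (F 2) (F 1) (F 2) (F 0) (F 2)

section Continuous

variable {X : Type*} [TopologicalSpace X]
  {g₁ : X → E →L[ℝ] E →L[ℝ] E →L[ℝ] ℝ} {g₂ : X → E →L[ℝ] E →L[ℝ] E →L[ℝ] E →L[ℝ] ℝ}
  {g₃ : X → E →L[ℝ] E →L[ℝ] E →L[ℝ] E →L[ℝ] E →L[ℝ] ℝ} {F : X → Fin n → E}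
  {y c a z t : X → E}

@[fun_prop]
lemma continuous_christoffel (h₁ : Continuous g₁) (hc : Continuous c) (ha : Continuous a)
    (hz : Continuous z) : Continuous fun x => christoffel (g₁ x) (c x) (a x) (z x) := by
  unfold christoffel
  fun_prop

@[fun_prop]
lemma continuous_jetGamma (h₁ : Continuous g₁) (hF : Continuous F) (hc : Continuous c)
    (ha : Continuous a) : Continuous fun x => jetGamma (g₁ x) (F x) (c x) (a x) := by
  unfold jetGamma
  fun_prop

@[fun_prop]
lemma continuous_jetCurvature (h₁ : Continuous g₁) (h₂ : Continuous g₂) (hF : Continuous F)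
    (hc : Continuous c) (ha : Continuous a) (hz : Continuous z) (ht : Continuous t) :
    Continuous fun x => jetCurvature (g₁ x) (g₂ x) (F x) (c x) (a x) (z x) (t x) := by
  unfold jetCurvature
  fun_prop

@[fun_prop]
lemma continuous_jetCovCurvature (h₁ : Continuous g₁) (h₂ : Continuous g₂)
    (h₃ : Continuous g₃) (hF : Continuous F) (hy : Continuous y) (hc : Continuous c)
    (ha : Continuous a) (hz : Continuous z) (ht : Continuous t) :
    Continuous fun x =>
      jetCovCurvature (g₁ x) (g₂ x) (g₃ x) (F x) (y x) (c x) (a x) (z x) (t x) := by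
  unfold jetCovCurvature
  fun_prop

lemma continuous_weylObstruction {m : ℕ} {F : X → Fin (m + 4) → E}
    (h₁ : Continuous g₁) (h₂ : Continuous g₂) (hF : Continuous F) :
    Continuous fun x => weylObstruction (g₁ x) (g₂ x) (F x) := by
  unfold weylObstruction
  fun_prop

lemma continuous_cottonObstruction {F : X → Fin 3 → E}
    (h₁ : Continuous g₁) (h₂ : Continuous g₂) (h₃ : Continuous g₃) (hF : Continuous F) :
    Continuous fun x => cottonObstruction (g₁ x) (g₂ x) (g₃ x) (F x) := by
  unfold cottonObstruction
  fun_prop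

end Continuous

section ContDiff

variable {X : Type*} [NormedAddCommGroup X] [NormedSpace ℝ X] {k : ℕ∞ω}
  {g₁ : X → E →L[ℝ] E →L[ℝ] E →L[ℝ] ℝ} {g₂ : X → E →L[ℝ] E →L[ℝ] E →L[ℝ] E →L[ℝ] ℝ}
  {g₃ : X → E →L[ℝ] E →L[ℝ] E →L[ℝ] E →L[ℝ] E →L[ℝ] ℝ} {F : X → Fin n → E}
  {y c a z t : X → E}

@[fun_prop]
lemma contDiff_christoffel (h₁ : ContDiff ℝ k g₁) (hc : ContDiff ℝ k c) (ha : ContDiff ℝ k a)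
    (hz : ContDiff ℝ k z) : ContDiff ℝ k fun x => christoffel (g₁ x) (c x) (a x) (z x) := by
  unfold christoffel
  fun_prop

@[fun_prop]
lemma contDiff_jetGamma (h₁ : ContDiff ℝ k g₁) (hF : ContDiff ℝ k F) (hc : ContDiff ℝ k c)
    (ha : ContDiff ℝ k a) : ContDiff ℝ k fun x => jetGamma (g₁ x) (F x) (c x) (a x) := by
  unfold jetGamma
  fun_prop

@[fun_prop]
lemma contDiff_jetCurvature (h₁ : ContDiff ℝ k g₁) (h₂ : ContDiff ℝ k g₂) (hF : ContDiff ℝ k F)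
    (hc : ContDiff ℝ k c) (ha : ContDiff ℝ k a) (hz : ContDiff ℝ k z) (ht : ContDiff ℝ k t) :
    ContDiff ℝ k fun x => jetCurvature (g₁ x) (g₂ x) (F x) (c x) (a x) (z x) (t x) := by
  unfold jetCurvature
  fun_prop

@[fun_prop]
lemma contDiff_jetCovCurvature (h₁ : ContDiff ℝ k g₁) (h₂ : ContDiff ℝ k g₂)
    (h₃ : ContDiff ℝ k g₃) (hF : ContDiff ℝ k F) (hy : ContDiff ℝ k y) (hc : ContDiff ℝ k c)
    (ha : ContDiff ℝ k a) (hz : ContDiff ℝ k z) (ht : ContDiff ℝ k t) :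
    ContDiff ℝ k fun x =>
      jetCovCurvature (g₁ x) (g₂ x) (g₃ x) (F x) (y x) (c x) (a x) (z x) (t x) := by
  unfold jetCovCurvature
  fun_prop

lemma contDiff_weylObstruction {m : ℕ} {F : X → Fin (m + 4) → E}
    (h₁ : ContDiff ℝ k g₁) (h₂ : ContDiff ℝ k g₂) (hF : ContDiff ℝ k F) :
    ContDiff ℝ k fun x => weylObstruction (g₁ x) (g₂ x) (F x) := by
  unfold weylObstruction
  fun_prop

lemma contDiff_cottonObstruction {F : X → Fin 3 → E}
    (h₁ : ContDiff ℝ k g₁) (h₂ : ContDiff ℝ k g₂) (h₃ : ContDiff ℝ k g₃) (hF : ContDiff ℝ k F) :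
    ContDiff ℝ k fun x => cottonObstruction (g₁ x) (g₂ x) (g₃ x) (F x) := by
  unfold cottonObstruction
  fun_prop

end ContDiff

variable {Ω : Set E} {g : E → E →L[ℝ] E →L[ℝ] ℝ} {Γ : E → E →L[ℝ] E →L[ℝ] E}

lemma IsLeviCivitaOn.jetGamma_eq [FiniteDimensional ℝ E] (h : IsLeviCivitaOn Ω g Γ) {x : E}
    (hx : x ∈ Ω) {F : Fin n → E} (hF : IsOrthoFrame (g x) F) (hn : Module.finrank ℝ E = n)
    (a b : E) : jetGamma (fderiv ℝ g x) F a b = Γ x a b := by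
  simp only [jetGamma, ← h.metric_apply x hx]
  exact hF.sum_smul hn _

lemma IsLeviCivitaOn.jetCurvature_eq [FiniteDimensional ℝ E] (h : IsLeviCivitaOn Ω g Γ) {x : E}
    (hx : x ∈ Ω) {F : Fin n → E} (hF : IsOrthoFrame (g x) F) (hn : Module.finrank ℝ E = n)
    (c a z t : E) : jetCurvature (fderiv ℝ g x) (fderiv ℝ (fderiv ℝ g) x) F c a z t
      = g x (curvature Γ x c a z) t := by
  rw [h.metric_curvature hx, jetCurvature, h.jetGamma_eq hx hF hn, h.jetGamma_eq hx hF hn,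
    ← h.metric_apply x hx, ← h.metric_apply x hx]

lemma IsLeviCivitaOn.jetCovCurvature_eq [FiniteDimensional ℝ E] (h : IsLeviCivitaOn Ω g Γ)
    {x : E} (hx : x ∈ Ω) {F : Fin n → E} (hF : IsOrthoFrame (g x) F)
    (hn : Module.finrank ℝ E = n) (y c a z t : E) :
    jetCovCurvature (fderiv ℝ g x) (fderiv ℝ (fderiv ℝ g) x)
      (fderiv ℝ (fderiv ℝ (fderiv ℝ g)) x) F y c a z t = g x (covCurvature Γ x y c a z) t := by
  rw [h.metric_covCurvature hx, jetCovCurvature]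
  simp only [h.jetGamma_eq hx hF hn, h.jetCurvature_eq hx hF hn]

variable {V A : E → E} {μ : E → ℝ}

lemma IsCarlemanField.weylObstruction_eq_zero [FiniteDimensional ℝ E] {m : ℕ}
    (h : IsCarlemanField Ω g Γ V A μ) {x : E} (hx : x ∈ Ω) {F : Fin (m + 4) → E}
    (hF : IsOrthoFrame (g x) F) (hn : Module.finrank ℝ E = m + 4) {t : ℝ} (hV : F 0 = t • V x) :
    weylObstruction (fderiv ℝ g x) (fderiv ℝ (fderiv ℝ g) x) F = 0 := by
  have h01 : (0 : Fin (m + 4)) ≠ 1 := by simp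
  have h02 : (0 : Fin (m + 4)) ≠ 2 := by simp [Fin.ext_iff, Nat.mod_eq_of_lt]
  have h13 : (1 : Fin (m + 4)) ≠ 3 := by simp [Fin.ext_iff, Nat.mod_eq_of_lt]
  have h23 : (2 : Fin (m + 4)) ≠ 3 := by simp [Fin.ext_iff, Nat.mod_eq_of_lt]
  rw [weylObstruction, h.jetCurvature_eq hx hF hn, hV, map_smul, map_smul, smul_apply,
    h.metric_curvature_field_eq_zero hx (hF.apply_eq_zero h01 hV) (hF.apply_eq_zero h02 hV)
      (by rw [hF, if_neg h13]) (by rw [hF, if_neg h23]), smul_zero]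

lemma IsCarlemanField.cottonObstruction_eq_zero [FiniteDimensional ℝ E]
    (h : IsCarlemanField Ω g Γ V A μ) {x : E} (hx : x ∈ Ω) {F : Fin 3 → E}
    (hF : IsOrthoFrame (g x) F) (hn : Module.finrank ℝ E = 3) {t : ℝ} (hV : F 0 = t • V x) :
    cottonObstruction (fderiv ℝ g x) (fderiv ℝ (fderiv ℝ g) x)
      (fderiv ℝ (fderiv ℝ (fderiv ℝ g)) x) F = 0 := by
  have hone : t * (t * g x (V x) (V x)) = 1 := by
    have := hF 0 0
    rwa [hV, if_pos rfl, map_smul, map_smul, smul_apply, smul_eq_mul, smul_eq_mul] at this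
  have hspan : ∃ r s t : ℝ, A x = r • V x + s • F 1 + t • F 2 :=
    ⟨g x (A x) (F 0) * t, g x (A x) (F 1), g x (A x) (F 2), by
      conv_lhs => rw [← hF.sum_smul hn (A x)]
      rw [Fin.sum_univ_three, mul_smul, ← hV]⟩
  have hcot := h.cotton_eq_zero hx (hF.apply_eq_zero (by decide) hV)
    (hF.apply_eq_zero (by decide) hV) (by rw [hF, if_neg (by decide)]) hspan
  rw [hF 2 2, if_pos rfl, one_mul] at hcot
  have hcov := h.covCurvature_smul hx 1 1 t (F 2) (F 1) (F 2) (V x)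
  rw [one_smul, one_smul, one_mul, one_mul] at hcov
  rw [cottonObstruction, h.jetCovCurvature_eq hx hF hn, h.jetCovCurvature_eq hx hF hn, hV, hcov,
    h.covCurvature_smul hx]
  simp only [map_smul, smul_apply, smul_eq_mul, hcot]
  linear_combination (t * g x (covCurvature Γ x (F 2) (F 1) (F 2) (V x)) (F 2)) * hone

end Jets

/-! ### Metrics in coordinates -/

section Algebra

variable {E : Type*} [NormedAddCommGroup E] [NormedSpace ℝ E] {B H : E →L[ℝ] E →L[ℝ] ℝ} {V : E}

lemma apply_self_eq_of_orthogonal (hpos : ∀ a, a ≠ 0 → 0 < B a a) (hV : V ≠ 0)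
    (h : ∀ X, B V X = 0 → B X X = B V V → H X X + H V V = 0) {X : E} (hX : B V X = 0) :
    H X X = -(H V V / B V V) * B X X := by
  rcases eq_or_ne X 0 with rfl | h0
  · simp
  have hN := hpos V hV
  have hXX := hpos X h0
  have hss : √(B V V / B X X) * √(B V V / B X X) = B V V / B X X :=
    Real.mul_self_sqrt (by positivity)
  have h1 := h (√(B V V / B X X) • X) (by simp [hX]) (by
    rw [map_smul, map_smul, smul_apply, smul_eq_mul, smul_eq_mul, ← mul_assoc, hss]
    field_simp)
  rw [map_smul, map_smul, smul_apply, smul_eq_mul, smul_eq_mul, ← mul_assoc, hss] at h1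
  field_simp at h1 ⊢
  linarith

lemma apply_eq_of_orthogonal (hB : ∀ a b, B a b = B b a) (hH : ∀ a b, H a b = H b a)
    (hpos : ∀ a, a ≠ 0 → 0 < B a a) (hV : V ≠ 0)
    (h : ∀ X, B V X = 0 → B X X = B V V → H X X + H V V = 0) {X Y : E} (hX : B V X = 0)
    (hY : B V Y = 0) : H X Y = -(H V V / B V V) * B X Y := by
  have hadd := apply_self_eq_of_orthogonal hpos hV h
    (X := X + Y) (by rw [map_add, hX, hY, add_zero])
  have hXX := apply_self_eq_of_orthogonal hpos hV h hX
  have hYY := apply_self_eq_of_orthogonal hpos hV h hY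
  simp only [map_add, add_apply, hH Y X, hB Y X] at hadd
  linarith

lemma bilinear_eq_of_orthogonal (hB : ∀ a b, B a b = B b a) (hH : ∀ a b, H a b = H b a)
    (hpos : ∀ a, a ≠ 0 → 0 < B a a) (hV : V ≠ 0)
    (h : ∀ X, B V X = 0 → B X X = B V V → H X X + H V V = 0) (a b : E) :
    H a b = -(H V V / B V V) * B a b + H a V / B V V * B V b + B V a * (H b V / B V V) := by
  have hN := (hpos V hV).ne'
  have hproj : ∀ X, B V (X - (B V X / B V V) • V) = 0 := fun X => by
    rw [map_sub, map_smul, smul_eq_mul, div_mul_cancel₀ _ hN, sub_self]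
  have h1 := apply_eq_of_orthogonal hB hH hpos hV h (hproj a) (hproj b)
  simp only [map_sub, sub_apply, map_smul, smul_apply, smul_eq_mul, hH V b, hB a V] at h1
  field_simp at h1 ⊢
  exact mul_left_cancel₀ hN (by linear_combination h1)

end Algebra

section Coordinates

variable {n : ℕ}

/-- The bilinear form on the coordinate space with matrix `m`. -/
def coordBil (m : Matrix (Fin n) (Fin n) ℝ) : Coord n →L[ℝ] Coord n →L[ℝ] ℝ :=
  ∑ i, ∑ j, m i j • (EuclideanSpace.proj i : Coord n →L[ℝ] ℝ).smulRight
    (EuclideanSpace.proj j : Coord n →L[ℝ] ℝ)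

lemma coordBil_apply (m : Matrix (Fin n) (Fin n) ℝ) (a b : Coord n) :
    coordBil m a b = ∑ i, ∑ j, m i j * (a i * b j) := by
  simp [coordBil, sum_apply]

/-- The linear map from covectors to vectors with matrix `m`. -/
def coordSharp (m : Matrix (Fin n) (Fin n) ℝ) : (Coord n →L[ℝ] ℝ) →L[ℝ] Coord n :=
  ∑ i, ∑ j, m i j • (ContinuousLinearMap.apply ℝ ℝ (EuclideanSpace.single j (1 : ℝ))).smulRight
    (EuclideanSpace.single i (1 : ℝ) : Coord n)

lemma coordSharp_apply (m : Matrix (Fin n) (Fin n) ℝ) (θ : Coord n →L[ℝ] ℝ) :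
    coordSharp m θ = ∑ i, ∑ j, (m i j * θ (EuclideanSpace.single j (1 : ℝ))) •
      (EuclideanSpace.single i (1 : ℝ) : Coord n) := by
  simp [coordSharp, sum_apply, smul_smul]

lemma coordSharp_coord (m : Matrix (Fin n) (Fin n) ℝ) (θ : Coord n →L[ℝ] ℝ) (k : Fin n) :
    coordSharp m θ k = ∑ j, m k j * θ (EuclideanSpace.single j (1 : ℝ)) := by
  simp [coordSharp_apply, Pi.single_apply]

lemma eq_sum_smul_single (a : Coord n) :
    a = ∑ i, a i • (EuclideanSpace.single i (1 : ℝ) : Coord n) := by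
  ext k
  simp [Pi.single_apply]

lemma clm_apply_eq_sum (θ : Coord n →L[ℝ] ℝ) (a : Coord n) :
    θ a = ∑ i, a i * θ (EuclideanSpace.single i (1 : ℝ)) := by
  conv_lhs => rw [eq_sum_smul_single a]
  simp

lemma apply_coordSharp (m : Matrix (Fin n) (Fin n) ℝ) (θ η : Coord n →L[ℝ] ℝ) :
    η (coordSharp m θ) = ∑ i, ∑ j, m i j *
      (η (EuclideanSpace.single i (1 : ℝ)) * θ (EuclideanSpace.single j (1 : ℝ))) := by
  rw [clm_apply_eq_sum]
  simp only [coordSharp_coord, Finset.sum_mul]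
  exact Finset.sum_congr rfl fun i _ => Finset.sum_congr rfl fun j _ => by ring

lemma coordBil_single (m : Matrix (Fin n) (Fin n) ℝ) (a : Coord n) (k : Fin n) :
    coordBil m a (EuclideanSpace.single k (1 : ℝ)) = ∑ i, m i k * a i := by
  simp [coordBil_apply]

lemma coordBil_symm {m : Matrix (Fin n) (Fin n) ℝ} (hm : m.IsSymm) (a b : Coord n) :
    coordBil m a b = coordBil m b a := by
  rw [coordBil_apply, coordBil_apply, Finset.sum_comm]
  refine Finset.sum_congr rfl fun i _ => Finset.sum_congr rfl fun j _ => ?_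
  rw [hm.apply i j]
  ring

lemma coordBil_coordSharp {m : Matrix (Fin n) (Fin n) ℝ} (hm : m.IsSymm) (hdet : m.det ≠ 0)
    (θ : Coord n →L[ℝ] ℝ) (b : Coord n) : coordBil m (coordSharp m⁻¹ θ) b = θ b := by
  rw [clm_apply_eq_sum (coordBil m _) b, clm_apply_eq_sum θ b]
  refine Finset.sum_congr rfl fun k _ => ?_
  congr 1
  rw [coordBil_single]
  simp only [coordSharp_coord, Finset.mul_sum]
  rw [Finset.sum_comm]
  have hinv : m * m⁻¹ = 1 := Matrix.mul_nonsing_inv m (Ne.isUnit hdet)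
  have hsum : ∀ j, ∑ i, m i k * (m⁻¹ i j * θ (EuclideanSpace.single j (1 : ℝ)))
      = (1 : Matrix (Fin n) (Fin n) ℝ) k j * θ (EuclideanSpace.single j (1 : ℝ)) := by
    intro j
    rw [← hinv, Matrix.mul_apply, Finset.sum_mul]
    refine Finset.sum_congr rfl fun i _ => ?_
    rw [hm.apply i k]
    ring
  simp [hsum, Matrix.one_apply]

lemma det_ne_zero_of_pos {m : Matrix (Fin n) (Fin n) ℝ}
    (hpos : ∀ a, a ≠ 0 → 0 < coordBil m a a) : m.det ≠ 0 := by
  intro h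
  obtain ⟨v, hv, hmv⟩ := Matrix.exists_mulVec_eq_zero_iff.2 h
  have h1 := hpos (WithLp.toLp 2 v) (by simpa using hv)
  have h2 : coordBil m (WithLp.toLp 2 v) (WithLp.toLp 2 v) = ∑ i, v i * m.mulVec v i := by
    simp only [coordBil_apply, Matrix.mulVec, dotProduct, Finset.mul_sum]
    exact Finset.sum_congr rfl fun i _ => Finset.sum_congr rfl fun j _ => by ring
  rw [h2, hmv] at h1
  simp at h1

/-- A smooth family of symmetric positive definite matrices on an open set. -/
structure IsMetricOn (Ω : Set (Coord n)) (m : Coord n → Matrix (Fin n) (Fin n) ℝ) : Prop where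
  isOpen : IsOpen Ω
  smooth : ∀ i j, ContDiffOn ℝ ∞ (fun x => m x i j) Ω
  symm : ∀ x ∈ Ω, (m x).IsSymm
  pos : ∀ x ∈ Ω, ∀ a, a ≠ 0 → 0 < coordBil (m x) a a

variable {Ω : Set (Coord n)} {m : Coord n → Matrix (Fin n) (Fin n) ℝ}

lemma contDiffOn_det {E ι : Type*} [NormedAddCommGroup E] [NormedSpace ℝ E] [Fintype ι]
    [DecidableEq ι] {k : ℕ∞ω} {s : Set E} {p : E → Matrix ι ι ℝ}
    (hp : ∀ i j, ContDiffOn ℝ k (fun x => p x i j) s) :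
    ContDiffOn ℝ k (fun x => (p x).det) s := by
  simp only [Matrix.det_apply]
  exact ContDiffOn.sum fun σ _ => (contDiffOn_prod fun i _ => hp _ _).const_smul _

namespace IsMetricOn

lemma det_ne_zero (h : IsMetricOn Ω m) {x : Coord n} (hx : x ∈ Ω) : (m x).det ≠ 0 :=
  det_ne_zero_of_pos (h.pos x hx)

lemma smooth_inv (h : IsMetricOn Ω m) (i j : Fin n) :
    ContDiffOn ℝ ∞ (fun x => (m x)⁻¹ i j) Ω := by
  have hdet := contDiffOn_det h.smooth
  have hadj : ContDiffOn ℝ ∞ (fun x => (m x).adjugate i j) Ω := by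
    simp only [Matrix.adjugate_apply]
    refine contDiffOn_det fun k l => ?_
    simp only [Matrix.updateRow_apply]
    split_ifs
    · exact contDiffOn_const
    · exact h.smooth k l
  refine ((hdet.inv fun x hx => h.det_ne_zero hx).mul hadj).congr fun x _ => ?_
  simp [Matrix.inv_def, Ring.inverse_eq_inv']

lemma smooth_coordBil (h : IsMetricOn Ω m) : ContDiffOn ℝ ∞ (fun x => coordBil (m x)) Ω :=
  ContDiffOn.sum fun i _ => ContDiffOn.sum fun j _ => (h.smooth i j).smul contDiffOn_const

lemma smooth_coordSharp (h : IsMetricOn Ω m) : ContDiffOn ℝ ∞ (fun x => coordSharp (m x)⁻¹) Ω :=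
  ContDiffOn.sum fun i _ => ContDiffOn.sum fun j _ => (h.smooth_inv i j).smul contDiffOn_const

lemma coordBil_coordSharp (h : IsMetricOn Ω m) {x : Coord n} (hx : x ∈ Ω) (θ : Coord n →L[ℝ] ℝ)
    (b : Coord n) : coordBil (m x) (coordSharp (m x)⁻¹ θ) b = θ b :=
  CarlemanWeights.coordBil_coordSharp (h.symm x hx) (h.det_ne_zero hx) θ b

end IsMetricOn

/-- The Christoffel symbols of the first kind as a continuous trilinear map. -/
def christoffelL {E : Type*} [NormedAddCommGroup E] [NormedSpace ℝ E]
    (g₁ : E →L[ℝ] E →L[ℝ] E →L[ℝ] ℝ) : E →L[ℝ] E →L[ℝ] E →L[ℝ] ℝ :=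
  (1 / 2 : ℝ) • (g₁ + g₁.flip
    - (ContinuousLinearMap.flipₗᵢ ℝ E E ℝ).toContinuousLinearEquiv.toContinuousLinearMap.comp
      g₁.flip)

lemma christoffelL_apply {E : Type*} [NormedAddCommGroup E] [NormedSpace ℝ E]
    (g₁ : E →L[ℝ] E →L[ℝ] E →L[ℝ] ℝ) (a b c : E) :
    christoffelL g₁ a b c = christoffel g₁ a b c := by
  simp [christoffelL, christoffel]
  ring

/-- The Christoffel symbols of the second kind of the metric with matrix `m`. -/
def coordGamma (m : Coord n → Matrix (Fin n) (Fin n) ℝ) (x : Coord n) :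
    Coord n →L[ℝ] Coord n →L[ℝ] Coord n :=
  (ContinuousLinearMap.compL ℝ (Coord n) (Coord n →L[ℝ] ℝ) (Coord n) (coordSharp (m x)⁻¹)).comp
    (christoffelL (fderiv ℝ (fun y => coordBil (m y)) x))

lemma coordGamma_apply (x a b : Coord n) : coordGamma m x a b
    = coordSharp (m x)⁻¹ (christoffelL (fderiv ℝ (fun y => coordBil (m y)) x) a b) := rfl

lemma IsMetricOn.isLeviCivitaOn (h : IsMetricOn Ω m) :
    IsLeviCivitaOn Ω (fun x => coordBil (m x)) (coordGamma m) where
  isOpen := h.isOpen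
  metric_smooth := h.smooth_coordBil
  smooth := by
    rw [contDiffOn_clm_apply]
    intro a
    rw [contDiffOn_clm_apply]
    intro b
    simp only [coordGamma_apply]
    refine h.smooth_coordSharp.clm_apply ?_
    rw [contDiffOn_clm_apply]
    intro c
    simp only [christoffelL_apply, christoffel]
    have h1 := contDiffOn_fderiv h.smooth_coordBil h.isOpen
    fun_prop
  metric_symm x hx a b := coordBil_symm (h.symm x hx) a b
  nondegenerate x hx a ha := by
    by_contra h0
    exact (h.pos x hx a h0).ne' (ha a)
  metric_apply x hx a b c := by
    rw [coordGamma_apply, h.coordBil_coordSharp hx, christoffelL_apply]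

end Coordinates

/-! ### The bracket condition -/

section Bracket

variable {n : ℕ}

/-- The real part of the conjugated symbol for the metric with matrix `m`. -/
def localRe (m : Coord n → Matrix (Fin n) (Fin n) ℝ) (φ : Coord n → ℝ) (x ξ : Coord n) : ℝ :=
  ∑ i, ∑ j, (m x)⁻¹ i j * (ξ i * ξ j - partialDeriv i φ x * partialDeriv j φ x)

/-- The imaginary part of the conjugated symbol for the metric with matrix `m`. -/
def localIm (m : Coord n → Matrix (Fin n) (Fin n) ℝ) (φ : Coord n → ℝ) (x ξ : Coord n) : ℝ :=
  2 * ∑ i, ∑ j, (m x)⁻¹ i j * (ξ i * partialDeriv j φ x)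

/-- The gradient of `φ` for the metric with matrix `m`. -/
def metricGradient (m : Coord n → Matrix (Fin n) (Fin n) ℝ) (φ : Coord n → ℝ) (x : Coord n) :
    Coord n :=
  coordSharp (m x)⁻¹ (fderiv ℝ φ x)

/-- The squared length of the gradient of `φ` for the metric with matrix `m`. -/
def gradNormSq (m : Coord n → Matrix (Fin n) (Fin n) ℝ) (φ : Coord n → ℝ) (x : Coord n) : ℝ :=
  coordBil (m x) (metricGradient m φ x) (metricGradient m φ x)

/-- The Hessian of `φ` for the metric with matrix `m`, as a bilinear form. -/
def hessian (m : Coord n → Matrix (Fin n) (Fin n) ℝ) (φ : Coord n → ℝ) (x : Coord n) :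
    Coord n →L[ℝ] Coord n →L[ℝ] ℝ :=
  fderiv ℝ (fderiv ℝ φ) x
    - (ContinuousLinearMap.compL ℝ (Coord n) (Coord n) ℝ (fderiv ℝ φ x)).comp (coordGamma m x)

variable {Ω : Set (Coord n)} {m : Coord n → Matrix (Fin n) (Fin n) ℝ} {φ : Coord n → ℝ}

lemma hessian_apply (x a b : Coord n) : hessian m φ x a b =
    fderiv ℝ (fderiv ℝ φ) x a b - fderiv ℝ φ x (coordGamma m x a b) := rfl

lemma innerSL_single_right (ξ : Coord n) (i : Fin n) :
    innerSL ℝ ξ (EuclideanSpace.single i (1 : ℝ)) = ξ i := by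
  simp [EuclideanSpace.inner_single_right]

lemma innerSL_single_left (i : Fin n) (v : Coord n) :
    innerSL ℝ (EuclideanSpace.single i (1 : ℝ)) v = v i := by
  simp [EuclideanSpace.inner_single_left]

lemma localRe_eq (x ξ : Coord n) : localRe m φ x ξ =
    innerSL ℝ ξ (coordSharp (m x)⁻¹ (innerSL ℝ ξ)) - fderiv ℝ φ x (metricGradient m φ x) := by
  simp only [metricGradient, apply_coordSharp, innerSL_single_right, localRe, mul_sub,
    Finset.sum_sub_distrib, partialDeriv]

lemma localIm_eq (x ξ : Coord n) :
    localIm m φ x ξ = 2 * innerSL ℝ ξ (metricGradient m φ x) := by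
  simp only [metricGradient, apply_coordSharp, innerSL_single_right, localIm, partialDeriv]

lemma partialDeriv_localIm (x ξ : Coord n) (i : Fin n) :
    partialDeriv i (fun η => localIm m φ x η) ξ = 2 * metricGradient m φ x i := by
  have hI : HasFDerivAt (fun η : Coord n => innerSL ℝ η) (innerSL ℝ) ξ :=
    (innerSL ℝ : Coord n →L[ℝ] Coord n →L[ℝ] ℝ).hasFDerivAt
  simp only [partialDeriv, localIm_eq]
  rw [fderiv_const_mul (hI.differentiableAt.clm_apply (differentiableAt_const _)), smul_apply,
    smul_eq_mul, fderiv_clm_apply_const hI.differentiableAt, hI.fderiv, innerSL_single_left]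

namespace IsMetricOn

lemma apply_coordSharp_comm (h : IsMetricOn Ω m) {x : Coord n} (hx : x ∈ Ω)
    (θ η : Coord n →L[ℝ] ℝ) : η (coordSharp (m x)⁻¹ θ) = θ (coordSharp (m x)⁻¹ η) := by
  rw [← h.coordBil_coordSharp hx η, ← h.coordBil_coordSharp hx θ, coordBil_symm (h.symm x hx)]

lemma apply_fderiv_coordSharp (h : IsMetricOn Ω m) {x : Coord n} (hx : x ∈ Ω) (u : Coord n)
    (θ η : Coord n →L[ℝ] ℝ) :
    η (fderiv ℝ (fun y => coordSharp (m y)⁻¹) x u θ)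
      = - fderiv ℝ (fun y => coordBil (m y)) x u (coordSharp (m x)⁻¹ θ)
        (coordSharp (m x)⁻¹ η) := by
  have hg := differentiableAt_of_contDiffOn h.smooth_coordBil h.isOpen hx
  have hS := differentiableAt_of_contDiffOn h.smooth_coordSharp h.isOpen hx
  have h1 := DFunLike.congr_fun (fderiv_congr_of_isOpen h.isOpen hx
    fun y hy => h.coordBil_coordSharp hy θ (coordSharp (m x)⁻¹ η)) u
  rw [fderiv_clm_apply₂ hg (by fun_prop) (by fun_prop), fderiv_clm_apply_const hS] at h1
  simp only [fderiv_fun_const, Pi.zero_apply, zero_apply, map_zero, add_zero] at h1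
  rw [coordBil_symm (h.symm x hx) (fderiv ℝ (fun y => coordSharp (m y)⁻¹) x u θ),
    h.coordBil_coordSharp hx] at h1
  linarith

lemma partialDeriv_localRe (h : IsMetricOn Ω m) {x : Coord n} (hx : x ∈ Ω) (ξ : Coord n)
    (i : Fin n) :
    partialDeriv i (fun η => localRe m φ x η) ξ = 2 * coordSharp (m x)⁻¹ (innerSL ℝ ξ) i := by
  have hI : HasFDerivAt (fun η : Coord n => innerSL ℝ η) (innerSL ℝ) ξ :=
    (innerSL ℝ : Coord n →L[ℝ] Coord n →L[ℝ] ℝ).hasFDerivAt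
  have hS : HasFDerivAt (fun η : Coord n => coordSharp (m x)⁻¹ (innerSL ℝ η))
      ((coordSharp (m x)⁻¹).comp (innerSL ℝ)) ξ :=
    ((coordSharp (m x)⁻¹).comp (innerSL ℝ : Coord n →L[ℝ] Coord n →L[ℝ] ℝ)).hasFDerivAt
  simp only [partialDeriv, localRe_eq]
  rw [fderiv_sub_const, fderiv_clm_apply_apply hI.differentiableAt hS.differentiableAt, hI.fderiv,
    hS.fderiv, ContinuousLinearMap.comp_apply, h.apply_coordSharp_comm hx _ (innerSL ℝ ξ),
    innerSL_single_left]
  ring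

lemma poissonBracket_eq (h : IsMetricOn Ω m) {x : Coord n} (hx : x ∈ Ω) (ξ : Coord n) :
    poissonBracket (localRe m φ) (localIm m φ) x ξ =
      2 * fderiv ℝ (fun y => localIm m φ y ξ) x (coordSharp (m x)⁻¹ (innerSL ℝ ξ))
        - 2 * fderiv ℝ (fun y => localRe m φ y ξ) x (metricGradient m φ x) := by
  rw [poissonBracket, Finset.sum_sub_distrib, clm_apply_eq_sum (fderiv ℝ _ x),
    clm_apply_eq_sum (fderiv ℝ (fun y => localRe m φ y ξ) x), Finset.mul_sum, Finset.mul_sum]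
  congr 1 <;> refine Finset.sum_congr rfl fun i _ => ?_
  · rw [h.partialDeriv_localRe hx, mul_assoc, partialDeriv]
  · rw [partialDeriv_localIm, mul_comm, mul_assoc, partialDeriv]

lemma coordBil_metricGradient (h : IsMetricOn Ω m) {x : Coord n} (hx : x ∈ Ω) (a : Coord n) :
    coordBil (m x) (metricGradient m φ x) a = fderiv ℝ φ x a :=
  h.coordBil_coordSharp hx _ a

lemma smooth_metricGradient (h : IsMetricOn Ω m) (hφ : ContDiffOn ℝ ∞ φ Ω) :
    ContDiffOn ℝ ∞ (metricGradient m φ) Ω :=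
  h.smooth_coordSharp.clm_apply (contDiffOn_fderiv hφ h.isOpen)

lemma metricGradient_ne_zero (h : IsMetricOn Ω m) {x : Coord n} (hx : x ∈ Ω)
    (hφ : fderiv ℝ φ x ≠ 0) : metricGradient m φ x ≠ 0 := by
  refine fun h0 => hφ (ContinuousLinearMap.ext fun a => ?_)
  rw [← h.coordBil_metricGradient hx, h0, map_zero]

lemma gradNormSq_pos (h : IsMetricOn Ω m) {x : Coord n} (hx : x ∈ Ω) (hφ : fderiv ℝ φ x ≠ 0) :
    0 < gradNormSq m φ x :=
  h.pos x hx _ (h.metricGradient_ne_zero hx hφ)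

lemma smooth_gradNormSq (h : IsMetricOn Ω m) (hφ : ContDiffOn ℝ ∞ φ Ω) :
    ContDiffOn ℝ ∞ (gradNormSq m φ) Ω :=
  (h.smooth_coordBil.clm_apply (h.smooth_metricGradient hφ)).clm_apply
    (h.smooth_metricGradient hφ)

lemma fderiv_coordBil_metricGradient_comm (h : IsMetricOn Ω m) (hφ : ContDiffOn ℝ ∞ φ Ω)
    {x : Coord n} (hx : x ∈ Ω) (a c : Coord n) :
    fderiv ℝ (fun y => coordBil (m y) (metricGradient m φ y) a) x c
      = fderiv ℝ (fun y => coordBil (m y) (metricGradient m φ y) c) x a := by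
  have hd := differentiableAt_of_contDiffOn (contDiffOn_fderiv hφ h.isOpen) h.isOpen hx
  rw [fderiv_congr_of_isOpen h.isOpen hx fun y hy => h.coordBil_metricGradient hy a,
    fderiv_congr_of_isOpen h.isOpen hx fun y hy => h.coordBil_metricGradient hy c,
    fderiv_clm_apply_const hd, fderiv_clm_apply_const hd, fderiv_fderiv_comm hφ h.isOpen hx]

lemma hessian_symm (h : IsMetricOn Ω m) (hφ : ContDiffOn ℝ ∞ φ Ω) {x : Coord n} (hx : x ∈ Ω)
    (a b : Coord n) : hessian m φ x a b = hessian m φ x b a := by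
  rw [hessian_apply, hessian_apply, fderiv_fderiv_comm hφ h.isOpen hx, h.isLeviCivitaOn.symm hx]

lemma coordBil_covDeriv_metricGradient (h : IsMetricOn Ω m) (hφ : ContDiffOn ℝ ∞ φ Ω)
    {x : Coord n} (hx : x ∈ Ω) (a b : Coord n) :
    coordBil (m x) (fderiv ℝ (metricGradient m φ) x a + coordGamma m x a (metricGradient m φ x)) b
      = hessian m φ x a b := by
  have hg := differentiableAt_of_contDiffOn h.smooth_coordBil h.isOpen hx
  have hV := differentiableAt_of_contDiffOn (h.smooth_metricGradient hφ) h.isOpen hx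
  have hdφ := differentiableAt_of_contDiffOn (contDiffOn_fderiv hφ h.isOpen) h.isOpen hx
  have h1 := DFunLike.congr_fun (fderiv_congr_of_isOpen h.isOpen hx
    fun y hy => h.coordBil_metricGradient (φ := φ) hy b) a
  rw [fderiv_clm_apply₂ hg hV (by fun_prop), fderiv_clm_apply_const hdφ,
    h.isLeviCivitaOn.fderiv_metric hx] at h1
  simp only [fderiv_fun_const, Pi.zero_apply, zero_apply, map_zero, add_zero] at h1
  rw [h.coordBil_metricGradient hx] at h1
  rw [map_add, add_apply, hessian_apply]
  linarith

lemma fderiv_gradNormSq (h : IsMetricOn Ω m) (hφ : ContDiffOn ℝ ∞ φ Ω) {x : Coord n}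
    (hx : x ∈ Ω) (a : Coord n) :
    fderiv ℝ (gradNormSq m φ) x a = 2 * hessian m φ x a (metricGradient m φ x) := by
  have hg := differentiableAt_of_contDiffOn h.smooth_coordBil h.isOpen hx
  have hV := differentiableAt_of_contDiffOn (h.smooth_metricGradient hφ) h.isOpen hx
  have hsymm := h.isLeviCivitaOn.metric_symm x hx (metricGradient m φ x)
  unfold gradNormSq
  rw [fderiv_clm_apply₂ hg hV hV, h.isLeviCivitaOn.fderiv_metric hx,
    ← h.coordBil_covDeriv_metricGradient hφ hx, hsymm (fderiv ℝ _ x a), hsymm (coordGamma m x a _)]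
  simp only [map_add, add_apply]
  ring

lemma fderiv_log_gradNormSq (h : IsMetricOn Ω m) (hφ : ContDiffOn ℝ ∞ φ Ω) {x : Coord n}
    (hx : x ∈ Ω) (hcrit : fderiv ℝ φ x ≠ 0) (a : Coord n) :
    fderiv ℝ (fun y => Real.log (gradNormSq m φ y) / 2) x a
      = hessian m φ x a (metricGradient m φ x) / gradNormSq m φ x := by
  have hN := differentiableAt_of_contDiffOn (h.smooth_gradNormSq hφ) h.isOpen hx
  have hlog := (hN.hasFDerivAt.log (h.gradNormSq_pos hx hcrit).ne').mul_const (2 : ℝ)⁻¹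
  simp only [div_eq_mul_inv]
  rw [hlog.fderiv, smul_apply, smul_apply, h.fderiv_gradNormSq hφ hx, smul_eq_mul, smul_eq_mul]
  ring

lemma apply_coordGamma (h : IsMetricOn Ω m) {x : Coord n} (hx : x ∈ Ω) (a b : Coord n) :
    fderiv ℝ φ x (coordGamma m x a b)
      = christoffel (fderiv ℝ (fun y => coordBil (m y)) x) a b (metricGradient m φ x) := by
  rw [← h.isLeviCivitaOn.metric_apply x hx, h.isLeviCivitaOn.metric_symm x hx,
    h.coordBil_metricGradient hx]

lemma fderiv_localIm (h : IsMetricOn Ω m) (hφ : ContDiffOn ℝ ∞ φ Ω) {x : Coord n} (hx : x ∈ Ω)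
    (ξ u : Coord n) :
    fderiv ℝ (fun y => localIm m φ y ξ) x u =
      2 * (fderiv ℝ (fderiv ℝ φ) x u (coordSharp (m x)⁻¹ (innerSL ℝ ξ))
        - fderiv ℝ (fun y => coordBil (m y)) x u (metricGradient m φ x)
          (coordSharp (m x)⁻¹ (innerSL ℝ ξ))) := by
  have hS := differentiableAt_of_contDiffOn h.smooth_coordSharp h.isOpen hx
  have hdφ := differentiableAt_of_contDiffOn (contDiffOn_fderiv hφ h.isOpen) h.isOpen hx
  simp only [localIm_eq, metricGradient]
  rw [fderiv_const_mul (by fun_prop), smul_apply, smul_eq_mul,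
    fderiv_clm_apply_apply (by fun_prop) (by fun_prop), fderiv_clm_apply_apply hS hdφ,
    fderiv_fun_const, Pi.zero_apply, zero_apply, zero_apply, zero_add, map_add,
    h.apply_fderiv_coordSharp hx, h.apply_coordSharp_comm hx _ (innerSL ℝ ξ)]
  ring

lemma fderiv_localRe (h : IsMetricOn Ω m) (hφ : ContDiffOn ℝ ∞ φ Ω) {x : Coord n} (hx : x ∈ Ω)
    (ξ u : Coord n) :
    fderiv ℝ (fun y => localRe m φ y ξ) x u =
      fderiv ℝ (fun y => coordBil (m y)) x u (metricGradient m φ x) (metricGradient m φ x)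
        - fderiv ℝ (fun y => coordBil (m y)) x u (coordSharp (m x)⁻¹ (innerSL ℝ ξ))
          (coordSharp (m x)⁻¹ (innerSL ℝ ξ))
        - 2 * fderiv ℝ (fderiv ℝ φ) x u (metricGradient m φ x) := by
  have hS := differentiableAt_of_contDiffOn h.smooth_coordSharp h.isOpen hx
  have hdφ := differentiableAt_of_contDiffOn (contDiffOn_fderiv hφ h.isOpen) h.isOpen hx
  simp only [localRe_eq, metricGradient]
  rw [fderiv_fun_sub (by fun_prop) (by fun_prop), sub_apply,
    fderiv_clm_apply_apply (by fun_prop) (by fun_prop), fderiv_clm_apply_const hS,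
    fderiv_fun_const, Pi.zero_apply, zero_apply, zero_apply, zero_add,
    fderiv_clm_apply_apply hdφ (by fun_prop), fderiv_clm_apply_apply hS hdφ, map_add,
    h.apply_fderiv_coordSharp hx, h.apply_fderiv_coordSharp hx,
    h.apply_coordSharp_comm hx _ (fderiv ℝ φ x)]
  ring

lemma poissonBracket_eq_hessian (h : IsMetricOn Ω m) (hφ : ContDiffOn ℝ ∞ φ Ω) {x : Coord n}
    (hx : x ∈ Ω) (ξ : Coord n) :
    poissonBracket (localRe m φ) (localIm m φ) x ξ =
      4 * (hessian m φ x (coordSharp (m x)⁻¹ (innerSL ℝ ξ)) (coordSharp (m x)⁻¹ (innerSL ℝ ξ))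
        + hessian m φ x (metricGradient m φ x) (metricGradient m φ x)) := by
  have hsymm := h.isLeviCivitaOn.fderiv_metric_symm hx (coordSharp (m x)⁻¹ (innerSL ℝ ξ))
    (coordSharp (m x)⁻¹ (innerSL ℝ ξ)) (metricGradient m φ x)
  rw [h.poissonBracket_eq hx, h.fderiv_localIm hφ hx, h.fderiv_localRe hφ hx, hessian_apply,
    hessian_apply, h.apply_coordGamma hx, h.apply_coordGamma hx, christoffel, christoffel, hsymm]
  ring

lemma exists_coordSharp_innerSL_eq (h : IsMetricOn Ω m) {x : Coord n} (hx : x ∈ Ω)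
    (X : Coord n) : ∃ ξ : Coord n, innerSL ℝ ξ = coordBil (m x) X ∧
      coordSharp (m x)⁻¹ (innerSL ℝ ξ) = X := by
  have hξ : innerSL ℝ ((InnerProductSpace.toDual ℝ (Coord n)).symm (coordBil (m x) X))
      = coordBil (m x) X := by
    ext b
    simp
  refine ⟨_, hξ, h.isLeviCivitaOn.metric_ext hx fun c => ?_⟩
  rw [h.coordBil_coordSharp hx, hξ]

lemma hessian_eq_of_poissonBracket_eq_zero (h : IsMetricOn Ω m) (hφ : ContDiffOn ℝ ∞ φ Ω)
    {x : Coord n} (hx : x ∈ Ω) (hcrit : fderiv ℝ φ x ≠ 0)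
    (hbr : ∀ ξ, localRe m φ x ξ = 0 → localIm m φ x ξ = 0 →
      poissonBracket (localRe m φ) (localIm m φ) x ξ = 0) (a b : Coord n) :
    hessian m φ x a b =
      -(hessian m φ x (metricGradient m φ x) (metricGradient m φ x) / gradNormSq m φ x)
          * coordBil (m x) a b
        + hessian m φ x a (metricGradient m φ x) / gradNormSq m φ x
          * coordBil (m x) (metricGradient m φ x) b
        + coordBil (m x) (metricGradient m φ x) a
          * (hessian m φ x b (metricGradient m φ x) / gradNormSq m φ x) := by
  have hsymm := h.isLeviCivitaOn.metric_symm x hx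
  refine bilinear_eq_of_orthogonal hsymm (h.hessian_symm hφ hx) (h.pos x hx)
    (h.metricGradient_ne_zero hx hcrit) (fun X horth hnorm => ?_) a b
  obtain ⟨ξ, hξ, hX⟩ := h.exists_coordSharp_innerSL_eq hx X
  have hRe : localRe m φ x ξ = 0 := by
    rw [localRe_eq, hX, hξ, hnorm, h.coordBil_metricGradient hx, sub_self]
  have hIm : localIm m φ x ξ = 0 := by
    rw [localIm_eq, hξ, hsymm, horth, mul_zero]
  have h1 := hbr ξ hRe hIm
  rw [h.poissonBracket_eq_hessian hφ hx, hX] at h1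
  linarith

theorem isCarlemanField_metricGradient (h : IsMetricOn Ω m) (hφ : ContDiffOn ℝ ∞ φ Ω)
    (hcrit : ∀ x ∈ Ω, fderiv ℝ φ x ≠ 0)
    (hbr : ∀ x ∈ Ω, ∀ ξ, localRe m φ x ξ = 0 → localIm m φ x ξ = 0 →
      poissonBracket (localRe m φ) (localIm m φ) x ξ = 0) :
    IsCarlemanField Ω (fun x => coordBil (m x)) (coordGamma m) (metricGradient m φ)
      (metricGradient m fun x => Real.log (gradNormSq m φ x) / 2)
      (fun x => -(hessian m φ x (metricGradient m φ x) (metricGradient m φ x)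
        / gradNormSq m φ x)) := by
  have hL := h.isLeviCivitaOn
  have hf : ContDiffOn ℝ ∞ (fun x => Real.log (gradNormSq m φ x) / 2) Ω :=
    ((h.smooth_gradNormSq hφ).log fun x hx => (h.gradNormSq_pos hx (hcrit x hx)).ne').div_const 2
  have hdf {x} (hx : x ∈ Ω) := h.fderiv_log_gradNormSq hφ hx (hcrit x hx)
  refine ⟨hL, h.smooth_metricGradient hφ, h.smooth_metricGradient hf, ?_, fun x hx a => ?_,
    fun x hx => h.fderiv_coordBil_metricGradient_comm hφ hx,
    fun x hx => h.fderiv_coordBil_metricGradient_comm hf hx, fun x hx => ?_⟩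
  · refine ContDiffOn.congr ((contDiffOn_fderiv hf h.isOpen).clm_apply
      (h.smooth_metricGradient hφ)).neg fun x hx => ?_
    rw [hdf hx]
  · refine hL.metric_ext hx fun b => ?_
    have hcov := h.coordBil_covDeriv_metricGradient hφ hx a b
    rw [h.hessian_eq_of_poissonBracket_eq_zero hφ hx (hcrit x hx) (hbr x hx)] at hcov
    simp only [map_add, add_apply, map_neg, neg_apply, map_smul, smul_apply, smul_eq_mul,
      h.coordBil_metricGradient hx (φ := fun x => Real.log (gradNormSq m φ x) / 2), hdf hx]
      at hcov ⊢
    linarith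
  · rw [h.coordBil_metricGradient hx, hdf hx, neg_neg]

end IsMetricOn

end Bracket

/-! ### Obstruction functionals -/

section Functionals

open Matrix

section AxisStabilizer

variable {ι : Type*} [Fintype ι] [DecidableEq ι] {i₀ : ι}

lemma one_mem_axisStabilizer : (1 : Matrix ι ι ℝ) ∈ axisStabilizer i₀ :=
  ⟨by simp, fun _ hj => one_apply_ne hj.symm⟩

lemma submatrix_mem_axisStabilizer {A : Matrix ι ι ℝ} (hA : A ∈ axisStabilizer i₀)
    {σ τ : Equiv.Perm ι} (hσ : σ i₀ = i₀) (hτ : τ i₀ = i₀) :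
    A.submatrix σ τ ∈ axisStabilizer i₀ := by
  refine ⟨?_, fun j hj => ?_⟩
  · rw [transpose_submatrix, submatrix_mul_equiv, hA.1, submatrix_one_equiv]
  · rw [submatrix_apply, hσ]
    exact hA.2 _ fun h => hj (τ.injective (h.trans hτ.symm))

lemma reflectionMatrix_mem_axisStabilizer {w : ι → ℝ} (hw : w i₀ = 0) :
    reflectionMatrix w ∈ axisStabilizer i₀ := by
  refine ⟨by rw [reflectionMatrix_transpose, reflectionMatrix_mul_self], fun j hj => ?_⟩
  simp [reflectionMatrix_apply, hw, hj.symm]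

lemma apply_eq_zero_of_mem_axisStabilizer {A : Matrix ι ι ℝ} (hA : A ∈ axisStabilizer i₀) {i : ι}
    (hi : i ≠ i₀) : A i i₀ = 0 := by
  have hprod (k : ι) : (A * Aᵀ) k i₀ = A k i₀ * A i₀ i₀ := by
    rw [mul_apply, Finset.sum_eq_single i₀ (fun j _ hj => by rw [transpose_apply, hA.2 j hj,
      mul_zero]) (by simp), transpose_apply]
  have h0 := hprod i
  have h1 := hprod i₀
  rw [hA.1, one_apply_ne hi] at h0
  rw [hA.1, one_apply_eq] at h1
  exact (mul_eq_zero.1 h0.symm).resolve_right fun h => by simp [h] at h1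

end AxisStabilizer

/-- The second derivative of the polynomial symmetric form with coefficients `s`. -/
def secondJet {n : ℕ} (s : (Fin 4 → Fin n) → ℝ) (c a z t : Fin n) : ℝ :=
  s ![c, a, z, t] + s ![a, c, z, t] + (s ![c, a, t, z] + s ![a, c, t, z])

/-- The contribution of `secondJet s` to the obstruction in dimension at least four. -/
def weylFunctional (m : ℕ) : ((Fin 4 → Fin (m + 4)) → ℝ) →ₗ[ℝ] ℝ where
  toFun s := (secondJet s 1 0 2 3 - secondJet s 1 3 2 0 - secondJet s 2 0 1 3
    + secondJet s 2 3 1 0) / 2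
  map_add' s t := by
    simp only [secondJet, Pi.add_apply]
    ring
  map_smul' c s := by
    simp only [secondJet, Pi.smul_apply, smul_eq_mul, RingHom.id_apply]
    ring

lemma weylFunctional_frameAct_single {m : ℕ} {P : Matrix (Fin (m + 4)) (Fin (m + 4)) ℝ}
    (hP : P ∈ axisStabilizer 0) (h00 : P 0 0 = 1) {a c d : Fin (m + 4)} (ha : a ≠ 0) (hc : c ≠ 0)
    (hd : d ≠ 0) :
    weylFunctional m (frameAct P (Pi.single ![a, 0, c, d] 1)) =
      (P 1 a * (P 2 c * P 3 d + P 3 c * P 2 d)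
        - P 2 a * (P 1 c * P 3 d + P 3 c * P 1 d)) / 2 := by
  have hcol {i : Fin (m + 4)} (hi : i ≠ 0) := apply_eq_zero_of_mem_axisStabilizer hP hi
  have h1 : P 1 0 = 0 := hcol (by simp)
  have h2 : P 2 0 = 0 := hcol (by simp [Fin.ext_iff, Nat.mod_eq_of_lt])
  have h3 : P 3 0 = 0 := hcol (by simp [Fin.ext_iff, Nat.mod_eq_of_lt])
  simp only [weylFunctional, LinearMap.coe_mk, AddHom.coe_mk, secondJet, frameAct_single,
    Fin.prod_univ_four, cons_val_zero, cons_val_one, cons_val, h00, hP.2 a ha, hP.2 c hc,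
    hP.2 d hd, h1, h2, h3]
  ring

/-- A family of orthogonal matrices which separates the values of `weylFunctional`: a cyclic
permutation of the coordinates `1, 2, 3`, the identity, and the reflection in the coordinates
`1, 3` along `(1, 2)`, followed by the exchange of the coordinate `2` with another one. -/
def weylFrame (m : ℕ) (p : Fin (m + 4)) : Matrix (Fin (m + 4)) (Fin (m + 4)) ℝ :=
  if p = 0 then (1 : Matrix _ _ ℝ).submatrix (Equiv.swap 1 2 * Equiv.swap 2 3 : Equiv.Perm _)
    (Equiv.refl _)
  else if p = 1 then 1
  else (reflectionMatrix (Pi.single 1 1 + Pi.single 3 2)).submatrix (Equiv.refl _)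
    (Equiv.swap 2 p)

section WeylFrame

variable {m : ℕ}

lemma weylIndex_ne : (0 : Fin (m + 4)) ≠ 1 ∧ (0 : Fin (m + 4)) ≠ 2 ∧ (0 : Fin (m + 4)) ≠ 3 ∧
    (1 : Fin (m + 4)) ≠ 2 ∧ (1 : Fin (m + 4)) ≠ 3 ∧ (2 : Fin (m + 4)) ≠ 3 := by
  simp [Fin.ext_iff, Nat.mod_eq_of_lt]

lemma weylFrame_mem_axisStabilizer (p : Fin (m + 4)) : weylFrame m p ∈ axisStabilizer 0 := by
  obtain ⟨h01, h02, h03, -⟩ := weylIndex_ne (m := m)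
  unfold weylFrame
  split_ifs with hp0 hp1
  · refine submatrix_mem_axisStabilizer one_mem_axisStabilizer ?_ rfl
    rw [Equiv.Perm.mul_apply, Equiv.swap_apply_of_ne_of_ne h02 h03,
      Equiv.swap_apply_of_ne_of_ne h01 h02]
  · exact one_mem_axisStabilizer
  · exact submatrix_mem_axisStabilizer (reflectionMatrix_mem_axisStabilizer (by simp [h01, h03]))
      rfl (Equiv.swap_apply_of_ne_of_ne h02 (Ne.symm hp0))

lemma weylFrame_zero_apply (j : Fin (m + 4)) :
    weylFrame m 0 1 j = (if 2 = j then 1 else 0) ∧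
      weylFrame m 0 2 j = (if 3 = j then 1 else 0) ∧
      weylFrame m 0 3 j = (if 1 = j then 1 else 0) := by
  obtain ⟨-, -, -, -, h13, h23⟩ := weylIndex_ne (m := m)
  simp [weylFrame, one_apply, Equiv.swap_apply_of_ne_of_ne, h13, h13.symm, h23.symm,
    weylIndex_ne.2.2.2.1]

lemma weylFrame_one : weylFrame m 1 = 1 := by
  simp [weylFrame]

lemma weylFrame_apply {p : Fin (m + 4)} (hp0 : p ≠ 0) (hp1 : p ≠ 1) (i j : Fin (m + 4)) :
    weylFrame m p i j =
      reflectionMatrix (Pi.single 1 1 + Pi.single 3 2) i (Equiv.swap 2 p j) := by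
  simp [weylFrame, hp0, hp1]

lemma weylFrame_apply_two {p : Fin (m + 4)} (hp0 : p ≠ 0) (hp1 : p ≠ 1) (j : Fin (m + 4)) :
    weylFrame m p 2 j = if p = j then 1 else 0 := by
  obtain ⟨-, -, -, h12, -, h23⟩ := weylIndex_ne (m := m)
  have hj : 2 = Equiv.swap 2 p j ↔ p = j := by
    rw [eq_comm, Equiv.swap_apply_eq_iff, Equiv.swap_apply_left, eq_comm]
  simp [weylFrame_apply hp0 hp1, reflectionMatrix_apply, h12, h23, one_apply, hj]

lemma weylFrame_apply_one {p : Fin (m + 4)} (hp0 : p ≠ 0) (hp1 : p ≠ 1) :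
    weylFrame m p 1 1 = 3 / 5 ∧ weylFrame m p 3 1 = -(4 / 5) := by
  obtain ⟨-, -, -, h12, h13, -⟩ := weylIndex_ne (m := m)
  have hw : (Pi.single 1 1 + Pi.single 3 2 : Fin (m + 4) → ℝ) ⬝ᵥ (Pi.single 1 1 + Pi.single 3 2)
      = 5 := by
    norm_num [dotProduct_add, h13, h13.symm]
  constructor <;>
    norm_num [weylFrame_apply hp0 hp1, Equiv.swap_apply_of_ne_of_ne h12 hp1.symm,
      reflectionMatrix_apply, hw, h13, h13.symm]

lemma weylFrame_zero_zero (p : Fin (m + 4)) : weylFrame m p 0 0 = 1 := by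
  obtain ⟨h01, h02, h03, -⟩ := weylIndex_ne (m := m)
  unfold weylFrame
  split_ifs with hp0 hp1
  · rw [submatrix_apply, Equiv.Perm.mul_apply, Equiv.swap_apply_of_ne_of_ne h02 h03,
      Equiv.swap_apply_of_ne_of_ne h01 h02]
    exact one_apply_eq 0
  · exact one_apply_eq 0
  · simp [Equiv.swap_apply_of_ne_of_ne h02 (Ne.symm hp0), reflectionMatrix_apply, h01, h03]

theorem linearIndependent_weylFunctional_comp_frameAct :
    LinearIndependent ℝ fun p => weylFunctional m ∘ₗ frameAct (weylFrame m p) := by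
  obtain ⟨h01, h02, h03, h12, h13, h23⟩ := weylIndex_ne (m := m)
  rw [Fintype.linearIndependent_iff]
  intro x hx
  have htest {a c d : Fin (m + 4)} (ha : a ≠ 0) (hc : c ≠ 0) (hd : d ≠ 0) : ∑ p, x p *
      ((weylFrame m p 1 a * (weylFrame m p 2 c * weylFrame m p 3 d
            + weylFrame m p 3 c * weylFrame m p 2 d)
        - weylFrame m p 2 a * (weylFrame m p 1 c * weylFrame m p 3 d
            + weylFrame m p 3 c * weylFrame m p 1 d)) / 2) = 0 := by
    have h := LinearMap.congr_fun hx (Pi.single ![a, 0, c, d] 1)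
    simpa only [LinearMap.sum_apply, LinearMap.smul_apply, LinearMap.comp_apply,
      LinearMap.zero_apply, smul_eq_mul, weylFunctional_frameAct_single
        (weylFrame_mem_axisStabilizer _) (weylFrame_zero_zero _) ha hc hd] using h
  have hreflection (q : Fin (m + 4)) (hq0 : q ≠ 0) (hq1 : q ≠ 1) : x q = 0 := by
    have h := htest h01.symm hq0 h01.symm
    rw [Finset.sum_eq_single q (fun p _ hpq => ?_) (by simp)] at h
    · simpa [weylFrame_apply_two hq0 hq1, weylFrame_apply_one hq0 hq1, hq1] using h
    obtain rfl | hp0 := eq_or_ne p 0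
    · simp [weylFrame_zero_apply, h12.symm, h13.symm]
    obtain rfl | hp1 := eq_or_ne p 1
    · simp [weylFrame_one, one_apply, h12.symm, h13.symm]
    simp [weylFrame_apply_two hp0 hp1, hp1, hpq]
  have hsum {f : Fin (m + 4) → ℝ} (h : ∑ p, x p * f p = 0) : x 0 * f 0 + x 1 * f 1 = 0 := by
    rwa [Finset.sum_eq_add 0 1 h01 (fun p _ hp => by rw [hreflection p hp.1 hp.2, zero_mul])
      (by simp) (by simp)] at h
  have hcyclic : x 0 = 0 := by
    simpa [weylFrame_zero_apply, weylFrame_one, one_apply, h12, h13, h23, h12.symm, h13.symm,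
      h23.symm] using hsum (htest h03.symm h01.symm h02.symm)
  have hidentity : x 1 = 0 := by
    simpa [hcyclic, weylFrame_one, one_apply, h12, h13, h23, h12.symm, h13.symm, h23.symm]
      using hsum (htest h01.symm h02.symm h03.symm)
  intro q
  obtain rfl | hq0 := eq_or_ne q 0
  · exact hcyclic
  obtain rfl | hq1 := eq_or_ne q 1
  · exact hidentity
  exact hreflection q hq0 hq1

end WeylFrame

/-- The third derivative of the polynomial symmetric form with coefficients `s`. -/
def thirdJet {n : ℕ} (s : (Fin 5 → Fin n) → ℝ) (y c a z t : Fin n) : ℝ :=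
  (s ![y, c, a, z, t] + s ![y, a, c, z, t] + s ![c, y, a, z, t] + s ![c, a, y, z, t]
    + s ![a, y, c, z, t] + s ![a, c, y, z, t])
  + (s ![y, c, a, t, z] + s ![y, a, c, t, z] + s ![c, y, a, t, z] + s ![c, a, y, t, z]
    + s ![a, y, c, t, z] + s ![a, c, y, t, z])

/-- The contribution of `thirdJet s` to the derivative of the curvature. -/
def thirdJetCurvature {n : ℕ} (s : (Fin 5 → Fin n) → ℝ) (y c a z t : Fin n) : ℝ :=
  (thirdJet s y c z a t - thirdJet s y c t a z - thirdJet s y a z c t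
    + thirdJet s y a t c z) / 2

/-- The contribution of `thirdJet s` to the obstruction in dimension three. -/
def cottonFunctional : ((Fin 5 → Fin 3) → ℝ) →ₗ[ℝ] ℝ where
  toFun s := thirdJetCurvature s 0 0 2 0 1 - thirdJetCurvature s 2 1 2 0 2
  map_add' s t := by
    simp only [thirdJetCurvature, thirdJet, Pi.add_apply]
    ring
  map_smul' c s := by
    simp only [thirdJetCurvature, thirdJet, Pi.smul_apply, smul_eq_mul, RingHom.id_apply]
    ring

/-- Three orthogonal matrices which separate the values of `cottonFunctional`. -/
def cottonFrame : Fin 3 → Matrix (Fin 3) (Fin 3) ℝ :=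
  ![1, !![1, 0, 0; 0, 0, 1; 0, 1, 0], !![1, 0, 0; 0, 3 / 5, 4 / 5; 0, 4 / 5, -3 / 5]]

lemma cottonFrame_mem_axisStabilizer (p : Fin 3) : cottonFrame p ∈ axisStabilizer 0 := by
  constructor
  · ext i j
    fin_cases p <;> fin_cases i <;> fin_cases j <;>
      simp [cottonFrame, mul_apply, Fin.sum_univ_three] <;> norm_num
  · intro j hj
    fin_cases p <;> fin_cases j <;> simp [cottonFrame] at hj ⊢

theorem linearIndependent_cottonFunctional_comp_frameAct :
    LinearIndependent ℝ fun p => cottonFunctional ∘ₗ frameAct (cottonFrame p) := by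
  rw [Fintype.linearIndependent_iff]
  intro x hx
  have htest (K : Fin 5 → Fin 3) :
      x 0 * cottonFunctional (frameAct (cottonFrame 0) (Pi.single K 1))
        + x 1 * cottonFunctional (frameAct (cottonFrame 1) (Pi.single K 1))
        + x 2 * cottonFunctional (frameAct (cottonFrame 2) (Pi.single K 1)) = 0 := by
    simpa [Fin.sum_univ_three] using LinearMap.congr_fun hx (Pi.single K 1)
  have h1 := htest ![0, 0, 0, 1, 1]
  have h2 := htest ![2, 2, 2, 1, 0]
  have h3 := htest ![0, 0, 0, 2, 1]
  simp only [cottonFunctional, thirdJetCurvature, thirdJet, frameAct_single, Fin.prod_univ_five,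
    LinearMap.coe_mk, AddHom.coe_mk, cons_val_zero, cons_val_one, cons_val, of_apply, cottonFrame,
    one_fin_three] at h1 h2 h3
  intro q
  fin_cases q <;> simp only [Fin.zero_eta, Fin.mk_one, Fin.reduceFinMk] <;> linarith

section Bridge

variable {E : Type*} [NormedAddCommGroup E] [NormedSpace ℝ E]

lemma weylObstruction_add {m : ℕ} {g₁ : E →L[ℝ] E →L[ℝ] E →L[ℝ] ℝ}
    {g₂ h : E →L[ℝ] E →L[ℝ] E →L[ℝ] E →L[ℝ] ℝ} {F : Fin (m + 4) → E}
    {s : (Fin 4 → Fin (m + 4)) → ℝ}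
    (hs : ∀ c a z t, h (F c) (F a) (F z) (F t) = secondJet s c a z t) :
    weylObstruction g₁ (g₂ + h) F = weylObstruction g₁ g₂ F + weylFunctional m s := by
  simp only [weylObstruction, jetCurvature, christoffel, _root_.add_apply, hs, weylFunctional,
    LinearMap.coe_mk, AddHom.coe_mk, secondJet]
  ring

lemma cottonObstruction_add {g₁ : E →L[ℝ] E →L[ℝ] E →L[ℝ] ℝ}
    {g₂ : E →L[ℝ] E →L[ℝ] E →L[ℝ] E →L[ℝ] ℝ} {g₃ h : E →L[ℝ] E →L[ℝ] E →L[ℝ] E →L[ℝ] E →L[ℝ] ℝ}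
    {F : Fin 3 → E} {s : (Fin 5 → Fin 3) → ℝ}
    (hs : ∀ y c a z t, h (F y) (F c) (F a) (F z) (F t) = thirdJet s y c a z t) :
    cottonObstruction g₁ g₂ (g₃ + h) F = cottonObstruction g₁ g₂ g₃ F + cottonFunctional s := by
  simp only [cottonObstruction, jetCovCurvature, christoffel, _root_.add_apply, hs,
    cottonFunctional, LinearMap.coe_mk, AddHom.coe_mk, thirdJet, thirdJetCurvature]
  ring

end Bridge

end Functionals

/-! ### Metrics on manifolds -/

section Tensors

open Bundle

variable {n : ℕ} {M : Type*} [TopologicalSpace M] [ChartedSpace (Coord n) M]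

variable (n M) in
/-- Covariant tensor fields of order two on `M`. -/
abbrev TensorField : Type _ :=
  ∀ x : M, TangentSpace (𝓡 n) x →L[ℝ] TangentSpace (𝓡 n) x →L[ℝ] ℝ

/-- The matrix of a tensor field in the chart `e`. -/
def tensorMatrix (B : TensorField n M) (e : OpenPartialHomeomorph M (Coord n)) (y : Coord n) :
    Matrix (Fin n) (Fin n) ℝ :=
  Matrix.of fun i j => B (e.symm y) (coordVector e i y) (coordVector e j y)

lemma coordBil_tensorMatrix (B : TensorField n M) (e : OpenPartialHomeomorph M (Coord n))
    (y a b : Coord n) : coordBil (tensorMatrix B e y) a b =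
      B (e.symm y) (mfderiv (𝓡 n) (𝓡 n) e.symm y a) (mfderiv (𝓡 n) (𝓡 n) e.symm y b) := by
  let L : Coord n →L[ℝ] TangentSpace (𝓡 n) (e.symm y) := mfderiv (𝓡 n) (𝓡 n) e.symm y
  have hL (a : Coord n) : L a = ∑ i, a i • coordVector e i y := by
    conv_lhs => rw [eq_sum_smul_single a, map_sum]
    exact Finset.sum_congr rfl fun i _ => map_smul L _ _
  change _ = B (e.symm y) (L a) (L b)
  rw [coordBil_apply, hL a, hL b]
  simp only [map_sum, map_smul, sum_apply, smul_apply, smul_eq_mul, tensorMatrix, Matrix.of_apply,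
    Finset.mul_sum]
  rw [Finset.sum_comm]
  exact Finset.sum_congr rfl fun i _ => Finset.sum_congr rfl fun j _ => by ring

variable [IsManifold (𝓡 n) ∞ M]

/-- Smoothness of a tensor field. -/
def IsSmoothTensor (B : TensorField n M) : Prop :=
  ContMDiff (𝓡 n) ((𝓡 n).prod 𝓘(ℝ, Coord n →L[ℝ] Coord n →L[ℝ] ℝ)) ∞
    (fun b ↦ TotalSpace.mk' (Coord n →L[ℝ] Coord n →L[ℝ] ℝ)
      (E := fun x : M => TangentSpace (𝓡 n) x →L[ℝ] TangentSpace (𝓡 n) x →L[ℝ] ℝ) b (B b))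

variable {e : OpenPartialHomeomorph M (Coord n)}

lemma contMDiffAt_coordVector (he : e ∈ IsManifold.maximalAtlas (𝓡 n) ∞ M) {y : Coord n}
    (hy : y ∈ e.target) (v : Coord n) :
    ContMDiffAt (𝓡 n) ((𝓡 n).prod 𝓘(ℝ, Coord n)) ∞
      (fun z ↦ TotalSpace.mk' (Coord n) (E := fun x : M => TangentSpace (𝓡 n) x) (e.symm z)
        (mfderiv (𝓡 n) (𝓡 n) e.symm z v)) y := by
  have hs : ContMDiffAt (𝓡 n) (𝓡 n) ∞ e.symm y := contMDiffAt_symm_of_mem_maximalAtlas he hy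
  have hv : ContMDiffAt (𝓡 n) ((𝓡 n).prod 𝓘(ℝ, Coord n)) ∞
      (fun z : Coord n ↦ TotalSpace.mk' (Coord n) (E := fun x : Coord n => TangentSpace (𝓡 n) x) z
        v) y :=
    contMDiffAt_vectorSpace_iff_contDiffAt.2 contDiffAt_const
  exact ContMDiffAt.clm_apply_of_inCoordinates (F₁ := Coord n) (F₂ := Coord n) (IM := 𝓡 n)
    (IB₁ := 𝓡 n) (IB₂ := 𝓡 n) (E₁ := fun x : Coord n => TangentSpace (𝓡 n) x)
    (E₂ := fun x : M => TangentSpace (𝓡 n) x) (b₁ := id) (b₂ := e.symm) (v := fun _ => v)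
    (ϕ := fun z => mfderiv (𝓡 n) (𝓡 n) e.symm z)
    (hs.mfderiv_const (m := ∞) (by simp)) hv hs

lemma IsSmoothTensor.contDiffOn {B : TensorField n M} (hB : IsSmoothTensor B)
    (he : e ∈ IsManifold.maximalAtlas (𝓡 n) ∞ M) (i j : Fin n) :
    ContDiffOn ℝ ∞ (fun y => tensorMatrix B e y i j) e.target := by
  intro y hy
  refine ContDiffAt.contDiffWithinAt ?_
  rw [← contMDiffAt_iff_contDiffAt]
  have hs : ContMDiffAt (𝓡 n) (𝓡 n) ∞ e.symm y := contMDiffAt_symm_of_mem_maximalAtlas he hy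
  have : ContMDiffAt (𝓡 n) ((𝓡 n).prod 𝓘(ℝ)) ∞
      (fun m ↦ TotalSpace.mk' ℝ (E := Bundle.Trivial M ℝ) (e.symm m)
        (B (e.symm m) (coordVector e i m) (coordVector e j m))) y := by
    apply ContMDiffAt.clm_bundle_apply₂ (F₁ := Coord n) (F₂ := Coord n)
    · exact ContMDiffAt.comp y hB.contMDiffAt hs
    · exact contMDiffAt_coordVector he hy _
    · exact contMDiffAt_coordVector he hy _
  simp only [contMDiffAt_totalSpace] at this
  exact this.2

lemma mdifferentiable_of_mem_maximalAtlas (he : e ∈ IsManifold.maximalAtlas (𝓡 n) ∞ M) :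
    e.MDifferentiable (𝓡 n) (𝓡 n) := by
  have : IsManifold (𝓡 n) 1 M := IsManifold.of_le (n := ∞) (by simp)
  have he1 : e ∈ IsManifold.maximalAtlas (𝓡 n) 1 M :=
    IsManifold.maximalAtlas_subset_of_le (by simp) he
  exact ⟨fun x hx => (mdifferentiableAt_of_mem_maximalAtlas he1 hx).mdifferentiableWithinAt,
    fun x hx => (mdifferentiableAt_symm_of_mem_maximalAtlas he1 hx).mdifferentiableWithinAt⟩

lemma isMetricOn_metricMatrix (g : SmoothMetric n M)
    (he : e ∈ IsManifold.maximalAtlas (𝓡 n) ∞ M) : IsMetricOn e.target (metricMatrix g e) where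
  isOpen := e.open_target
  smooth := IsSmoothTensor.contDiffOn (B := g.inner) g.contMDiff he
  symm y _ := by
    ext i j
    exact g.symm _ _ _
  pos y hy a ha := by
    change 0 < coordBil (tensorMatrix g.inner e y) a a
    rw [coordBil_tensorMatrix]
    refine g.pos _ _ fun h0 => ha ?_
    exact (mdifferentiable_of_mem_maximalAtlas he).symm.mfderiv_injective (x := y) hy
      (h0.trans (map_zero (mfderiv (𝓡 n) (𝓡 n) e.symm y)).symm)

end Tensors

section Weights

variable {n : ℕ} {M : Type*} [TopologicalSpace M] [ChartedSpace (Coord n) M]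
  [IsManifold (𝓡 n) ∞ M] {e : OpenPartialHomeomorph M (Coord n)} {U : Set M} {φ : M → ℝ}

lemma IsMetricOn.mono {Ω Ω' : Set (Coord n)} {m : Coord n → Matrix (Fin n) (Fin n) ℝ}
    (h : IsMetricOn Ω m) (hΩ' : IsOpen Ω') (hsub : Ω' ⊆ Ω) : IsMetricOn Ω' m where
  isOpen := hΩ'
  smooth i j := (h.smooth i j).mono hsub
  symm x hx := h.symm x (hsub hx)
  pos x hx := h.pos x (hsub hx)

namespace IsLimitingCarlemanWeight

variable {g : SmoothMetric n M}

lemma contDiffOn_comp_symm (h : IsLimitingCarlemanWeight g U φ)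
    (he : e ∈ IsManifold.maximalAtlas (𝓡 n) ∞ M) :
    ContDiffOn ℝ ∞ (fun y => φ (e.symm y)) (e.target ∩ e.symm ⁻¹' U) := by
  rw [← contMDiffOn_iff_contDiffOn]
  exact h.smooth.comp ((contMDiffOn_symm_of_mem_maximalAtlas he).mono Set.inter_subset_left)
    fun x hx => hx.2

lemma fderiv_comp_symm_ne_zero (h : IsLimitingCarlemanWeight g U φ) (hU : IsOpen U)
    (he : e ∈ IsManifold.maximalAtlas (𝓡 n) ∞ M) {x : Coord n}
    (hx : x ∈ e.target ∩ e.symm ⁻¹' U) : fderiv ℝ (fun y => φ (e.symm y)) x ≠ 0 := by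
  intro h0
  apply h.noncritical _ hx.2
  have hd := mdifferentiable_of_mem_maximalAtlas he
  have hφ : MDifferentiableAt (𝓡 n) 𝓘(ℝ, ℝ) φ (e.symm x) :=
    (h.smooth.contMDiffAt (hU.mem_nhds hx.2)).mdifferentiableAt (by simp)
  have hcomp : (mfderiv (𝓡 n) 𝓘(ℝ, ℝ) φ (e.symm x)).comp (mfderiv (𝓡 n) (𝓡 n) e.symm x)
      = 0 := by
    rw [← mfderiv_comp x hφ (hd.mdifferentiableAt_symm hx.1), mfderiv_eq_fderiv]
    exact h0
  refine ContinuousLinearMap.ext fun v => ?_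
  obtain ⟨w, rfl⟩ := hd.symm.mfderiv_surjective (x := x) hx.1 v
  exact DFunLike.congr_fun hcomp w

theorem exists_isCarlemanField (h : IsLimitingCarlemanWeight g U φ) (hU : IsOpen U)
    (he : e ∈ IsManifold.maximalAtlas (𝓡 n) ∞ M) :
    ∃ V A μ, IsCarlemanField (e.target ∩ e.symm ⁻¹' U)
      (fun x => coordBil (metricMatrix g e x)) (coordGamma (metricMatrix g e)) V A μ ∧
      ∀ x ∈ e.target ∩ e.symm ⁻¹' U, V x ≠ 0 := by
  have hg := (isMetricOn_metricMatrix g he).mono (e.symm.isOpen_inter_preimage hU)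
    Set.inter_subset_left
  have hcrit (x) (hx : x ∈ e.target ∩ e.symm ⁻¹' U) := h.fderiv_comp_symm_ne_zero hU he hx
  refine ⟨_, _, _, hg.isCarlemanField_metricGradient (h.contDiffOn_comp_symm he) hcrit ?_,
    fun x hx => hg.metricGradient_ne_zero hx (hcrit x hx)⟩
  rintro x ⟨hx, hxU⟩ ξ h1 h2
  have hbr := h.bracket e he (e.symm x) ⟨hxU, e.map_target hx⟩ ξ
  rw [e.right_inv hx] at hbr
  exact hbr (Complex.ext h1 h2)

end IsLimitingCarlemanWeight

lemma IsMetricOn.hasDegenerateFrame {Ω : Set (Coord n)}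
    {m : Coord n → Matrix (Fin n) (Fin n) ℝ} (h : IsMetricOn Ω m) {x : Coord n} (hx : x ∈ Ω)
    {v : Coord n} (hv : v ≠ 0) {i₀ : Fin n} {f : (Fin n → Coord n) → ℝ}
    (hf : ∀ F, IsOrthoFrame (coordBil (m x)) F → ∀ t : ℝ, F i₀ = t • v → f F = 0) :
    HasDegenerateFrame (coordBil (m x)) f i₀ := by
  obtain ⟨F, hF, t, hFv⟩ := exists_isOrthoFrame_smul_eq
    (coordBil_symm (h.symm x hx)) (h.pos x hx) (finrank_euclideanSpace_fin (𝕜 := ℝ)) i₀ hv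
  refine ⟨F, hF, fun P hP => hf _ (hF.frameMul hP.1) (P i₀ i₀ * t) ?_⟩
  rw [frameMul, Finset.sum_eq_single i₀ (fun j _ hj => by rw [hP.2 j hj, zero_smul]) (by simp),
    hFv, smul_smul]

end Weights

section Jets

variable {E : Type*} [NormedAddCommGroup E] [NormedSpace ℝ E]

lemma iteratedFDeriv_two_apply_of_isOpen {u : E → ℝ} {Ω : Set E} (hΩ : IsOpen Ω)
    (hu : ContDiffOn ℝ ∞ u Ω) {x : E} (hx : x ∈ Ω) (a b : E) :
    iteratedFDeriv ℝ 2 u x ![a, b] = fderiv ℝ (fun z => fderiv ℝ u z b) x a := by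
  rw [iteratedFDeriv_two_apply, fderiv_clm_apply_const
    (differentiableAt_of_contDiffOn (contDiffOn_fderiv hu hΩ) hΩ hx)]
  rfl

lemma iteratedFDeriv_three_apply_of_isOpen {u : E → ℝ} {Ω : Set E} (hΩ : IsOpen Ω)
    (hu : ContDiffOn ℝ ∞ u Ω) {x : E} (hx : x ∈ Ω) (a b c : E) :
    iteratedFDeriv ℝ 3 u x ![a, b, c]
      = fderiv ℝ (fun y => fderiv ℝ (fun z => fderiv ℝ u z c) y b) x a := by
  rw [iteratedFDeriv_succ_apply_left]
  have h2 : DifferentiableAt ℝ (iteratedFDeriv ℝ 2 u) x :=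
    ((hu.contDiffAt (hΩ.mem_nhds hx)).iteratedFDeriv_right (m := 1) (i := 2)
      (by norm_cast)).differentiableAt (by simp)
  change fderiv ℝ (iteratedFDeriv ℝ 2 u) x a ![b, c] = _
  rw [← fderiv_continuousMultilinear_apply_const_apply h2]
  exact DFunLike.congr_fun (fderiv_congr_of_isOpen hΩ hx fun y hy =>
    iteratedFDeriv_two_apply_of_isOpen hΩ hu hy b c) a

variable {F G : Type*} [NormedAddCommGroup F] [NormedSpace ℝ F] [NormedAddCommGroup G]
  [NormedSpace ℝ G] {Ω : Set E} {g : E → F →L[ℝ] G →L[ℝ] ℝ}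

lemma fderiv_apply₂ (hΩ : IsOpen Ω) (hg : ContDiffOn ℝ ∞ g Ω) {x : E} (hx : x ∈ Ω) (c : E)
    (z : F) (t : G) : fderiv ℝ g x c z t = fderiv ℝ (fun y => g y z t) x c := by
  have h := differentiableAt_of_contDiffOn hg hΩ hx
  rw [fderiv_clm_apply_const (h.clm_apply (differentiableAt_const z)), fderiv_clm_apply_const h]

lemma fderiv_fderiv_apply₂ (hΩ : IsOpen Ω) (hg : ContDiffOn ℝ ∞ g Ω) {x : E} (hx : x ∈ Ω)
    (c a : E) (z : F) (t : G) : fderiv ℝ (fderiv ℝ g) x c a z t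
      = fderiv ℝ (fun y => fderiv ℝ (fun w => g w z t) y a) x c := by
  have h := differentiableAt_of_contDiffOn (contDiffOn_fderiv hg hΩ) hΩ hx
  rw [← fderiv_congr_of_isOpen hΩ hx fun y hy => fderiv_apply₂ hΩ hg hy a z t,
    fderiv_clm_apply_const ((h.clm_apply (differentiableAt_const a)).clm_apply
      (differentiableAt_const z)), fderiv_clm_apply_const (h.clm_apply (differentiableAt_const a)),
    fderiv_clm_apply_const h]

lemma fderiv_fderiv_fderiv_apply₂ (hΩ : IsOpen Ω) (hg : ContDiffOn ℝ ∞ g Ω) {x : E} (hx : x ∈ Ω)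
    (y c a : E) (z : F) (t : G) : fderiv ℝ (fderiv ℝ (fderiv ℝ g)) x y c a z t
      = fderiv ℝ (fun w => fderiv ℝ (fun w' => fderiv ℝ (fun w'' => g w'' z t) w' a) w c) x y := by
  have h := differentiableAt_of_contDiffOn (contDiffOn_fderiv (contDiffOn_fderiv hg hΩ) hΩ) hΩ hx
  rw [← fderiv_congr_of_isOpen hΩ hx fun w hw => fderiv_fderiv_apply₂ hΩ hg hw c a z t]
  have h1 := h.clm_apply (differentiableAt_const c)
  have h2 := h1.clm_apply (differentiableAt_const a)
  rw [fderiv_clm_apply_const (h2.clm_apply (differentiableAt_const z)), fderiv_clm_apply_const h2,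
    fderiv_clm_apply_const h1, fderiv_clm_apply_const h]

end Jets

section Continuity

variable {n : ℕ} {M : Type*} [TopologicalSpace M] [ChartedSpace (Coord n) M]
  [IsManifold (𝓡 n) ∞ M] {e : OpenPartialHomeomorph M (Coord n)} {k : ℕ}

/-- The metric `g`, in the coordinates of the chart `e`, as a field of bilinear forms. -/
def metricForm (g : SmoothMetric n M) (e : OpenPartialHomeomorph M (Coord n)) (y : Coord n) :
    Coord n →L[ℝ] Coord n →L[ℝ] ℝ :=
  coordBil (metricMatrix g e y)

lemma contDiffOn_metricForm (he : e ∈ IsManifold.maximalAtlas (𝓡 n) ∞ M) (g : SmoothMetric n M) :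
    ContDiffOn ℝ ∞ (metricForm g e) e.target :=
  (isMetricOn_metricMatrix g he).smooth_coordBil

lemma continuous_iteratedFDeriv_metricMatrix (he : e ∈ IsManifold.maximalAtlas (𝓡 n) ∞ M)
    {y : Coord n} (hy : y ∈ e.target) (i j : Fin n) {m : ℕ} (hm : m ≤ k) :
    Continuous[ckTopology n M k, inferInstance] fun g : SmoothMetric n M =>
      iteratedFDeriv ℝ m (fun z => metricMatrix g e z i j) y := by
  have h1 : Continuous[ckTopology n M k, inferInstance] fun g : SmoothMetric n M =>
      UniformOnFun.ofFun {K : Set (Coord n) | IsCompact K ∧ K ⊆ e.target}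
          (iteratedFDeriv ℝ m fun y => metricMatrix g e y i j) := by
    rw [continuous_iff_le_induced]
    exact (iInf_le _ e).trans ((iInf_le _ he).trans ((iInf_le _ i).trans ((iInf_le _ j).trans
      ((iInf_le _ m).trans (iInf_le _ hm)))))
  let := ckTopology n M k
  have hK : ({y} : Set (Coord n)) ∈ {K : Set (Coord n) | IsCompact K ∧ K ⊆ e.target} :=
    ⟨isCompact_singleton, Set.singleton_subset_iff.2 hy⟩
  exact (UniformOnFun.uniformContinuous_eval_of_mem _ _ (Set.mem_singleton y)
    hK).continuous.comp h1

lemma continuous_iteratedFDeriv_metricForm (he : e ∈ IsManifold.maximalAtlas (𝓡 n) ∞ M)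
    {y : Coord n} (hy : y ∈ e.target) {m : ℕ} (hm : m ≤ k) (a b : Coord n) :
    Continuous[ckTopology n M k, inferInstance] fun g : SmoothMetric n M =>
      iteratedFDeriv ℝ m (fun z => metricForm g e z a b) y := by
  let := ckTopology n M k
  have h1 : ∀ g : SmoothMetric n M, iteratedFDeriv ℝ m (fun z => metricForm g e z a b) y
      = ∑ i, ∑ j, (a i * b j) • iteratedFDeriv ℝ m (fun z => metricMatrix g e z i j) y := by
    intro g
    have hs : ∀ i j, ContDiffAt ℝ m (fun z => metricMatrix g e z i j) y := fun i j =>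
      (((isMetricOn_metricMatrix g he).smooth i j).contDiffAt
        (e.open_target.mem_nhds hy)).of_le (by exact ENat.LEInfty.out)
    have hs' : ∀ i j, ContDiffAt ℝ m (fun z => (a i * b j) • metricMatrix g e z i j) y :=
      fun i j => (hs i j).const_smul _
    have hform : (fun z => metricForm g e z a b)
        = fun z => ∑ i, ∑ j, (a i * b j) • metricMatrix g e z i j := by
      ext z
      rw [metricForm, coordBil_apply]
      refine Finset.sum_congr rfl fun i _ => Finset.sum_congr rfl fun j _ => ?_
      rw [smul_eq_mul, mul_comm]
    rw [hform, iteratedFDeriv_fun_sum_apply fun i _ => ContDiffAt.sum fun j _ => hs' i j]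
    refine Finset.sum_congr rfl fun i _ => ?_
    rw [iteratedFDeriv_fun_sum_apply fun j _ => hs' i j]
    refine Finset.sum_congr rfl fun j _ => ?_
    exact iteratedFDeriv_const_smul_apply' (hs i j)
  simp only [h1]
  exact continuous_finsetSum _ fun i _ => continuous_finsetSum _ fun j _ =>
    (continuous_iteratedFDeriv_metricMatrix he hy i j hm).const_smul (a i * b j)

lemma continuous_metricForm (he : e ∈ IsManifold.maximalAtlas (𝓡 n) ∞ M)
    {y : Coord n} (hy : y ∈ e.target) :
    Continuous[ckTopology n M k, inferInstance] fun g : SmoothMetric n M => metricForm g e y := by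
  let := ckTopology n M k
  refine continuous_clm_apply.2 fun a => continuous_clm_apply.2 fun b => ?_
  exact (ContinuousMultilinearMap.apply ℝ (fun _ : Fin 0 => Coord n) ℝ ![]).continuous.comp
    (continuous_iteratedFDeriv_metricForm he hy (Nat.zero_le k) a b)

lemma continuous_fderiv_metricForm (he : e ∈ IsManifold.maximalAtlas (𝓡 n) ∞ M)
    {y : Coord n} (hy : y ∈ e.target) (hk : 1 ≤ k) :
    Continuous[ckTopology n M k, inferInstance] fun g : SmoothMetric n M =>
      fderiv ℝ (metricForm g e) y := by
  let := ckTopology n M k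
  refine continuous_clm_apply.2 fun c => continuous_clm_apply.2 fun a =>
    continuous_clm_apply.2 fun b => ?_
  have h := (ContinuousMultilinearMap.apply ℝ (fun _ : Fin 1 => Coord n) ℝ ![c]).continuous.comp
    (continuous_iteratedFDeriv_metricForm he hy hk a b)
  refine h.congr fun g => ?_
  rw [fderiv_apply₂ e.open_target (contDiffOn_metricForm he g) hy]
  exact iteratedFDeriv_one_apply _

lemma continuous_fderiv_fderiv_metricForm (he : e ∈ IsManifold.maximalAtlas (𝓡 n) ∞ M)
    {y : Coord n} (hy : y ∈ e.target) (hk : 2 ≤ k) :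
    Continuous[ckTopology n M k, inferInstance] fun g : SmoothMetric n M =>
      fderiv ℝ (fderiv ℝ (metricForm g e)) y := by
  let := ckTopology n M k
  refine continuous_clm_apply.2 fun c => continuous_clm_apply.2 fun d =>
    continuous_clm_apply.2 fun a => continuous_clm_apply.2 fun b => ?_
  have h := (ContinuousMultilinearMap.apply ℝ (fun _ : Fin 2 => Coord n) ℝ
    ![c, d]).continuous.comp (continuous_iteratedFDeriv_metricForm he hy hk a b)
  refine h.congr fun g => ?_
  have hs := contDiffOn_metricForm he g
  rw [fderiv_fderiv_apply₂ e.open_target hs hy]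
  exact iteratedFDeriv_two_apply_of_isOpen e.open_target
    ((hs.clm_apply contDiffOn_const).clm_apply contDiffOn_const) hy c d

lemma continuous_fderiv_fderiv_fderiv_metricForm (he : e ∈ IsManifold.maximalAtlas (𝓡 n) ∞ M)
    {y : Coord n} (hy : y ∈ e.target) (hk : 3 ≤ k) :
    Continuous[ckTopology n M k, inferInstance] fun g : SmoothMetric n M =>
      fderiv ℝ (fderiv ℝ (fderiv ℝ (metricForm g e))) y := by
  let := ckTopology n M k
  refine continuous_clm_apply.2 fun c => continuous_clm_apply.2 fun d =>
    continuous_clm_apply.2 fun d' => continuous_clm_apply.2 fun a =>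
    continuous_clm_apply.2 fun b => ?_
  have h := (ContinuousMultilinearMap.apply ℝ (fun _ : Fin 3 => Coord n) ℝ
    ![c, d, d']).continuous.comp (continuous_iteratedFDeriv_metricForm he hy hk a b)
  refine h.congr fun g => ?_
  have hs := contDiffOn_metricForm he g
  rw [fderiv_fderiv_fderiv_apply₂ e.open_target hs hy]
  exact iteratedFDeriv_three_apply_of_isOpen e.open_target
    ((hs.clm_apply contDiffOn_const).clm_apply contDiffOn_const) hy c d d'

end Continuity

/-! ### Perturbations of a metric -/

section Forms

open Bundle

variable {n : ℕ} {M : Type*} [TopologicalSpace M] [ChartedSpace (Coord n) M]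
  [IsManifold (𝓡 n) ∞ M]

lemma IsSmoothTensor.add {B C : TensorField n M} (hB : IsSmoothTensor B) (hC : IsSmoothTensor C) :
    IsSmoothTensor (fun x => B x + C x) :=
  ContMDiff.add_section hB hC

lemma IsSmoothTensor.smul {f : M → ℝ} (hf : ContMDiff (𝓡 n) 𝓘(ℝ, ℝ) ∞ f) {B : TensorField n M}
    (hB : IsSmoothTensor B) : IsSmoothTensor (fun x => f x • B x) :=
  ContMDiff.smul_section hf hB

lemma IsSmoothTensor.sum {ι : Type*} {s : Finset ι} {B : ι → TensorField n M}
    (hB : ∀ i ∈ s, IsSmoothTensor (B i)) : IsSmoothTensor (fun x => ∑ i ∈ s, B i x) :=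
  ContMDiff.sum_section hB

/-- The differential of a function, as a covector field. -/
def differential (f : M → ℝ) (x : M) : TangentSpace (𝓡 n) x →L[ℝ] ℝ :=
  mfderiv (𝓡 n) 𝓘(ℝ, ℝ) f x

/-- The tensor product of two differentials. -/
def differentialMul (f h : M → ℝ) : TensorField n M := fun x =>
  (differential f x).smulRight (differential h x)

lemma inTangentCoordinates_mfderiv_apply (f : M → ℝ) {x₀ x : M}
    (hx : x ∈ (trivializationAt (Coord n) (TangentSpace (𝓡 n) : M → Type _) x₀).baseSet)
    (v : Coord n) :
    inTangentCoordinates (𝓡 n) 𝓘(ℝ, ℝ) id f (mfderiv (𝓡 n) 𝓘(ℝ, ℝ) f) x₀ x v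
      = differential f x
        ((trivializationAt (Coord n) (TangentSpace (𝓡 n) : M → Type _) x₀).symm x v) := by
  change ContinuousLinearMap.inCoordinates (Coord n) (TangentSpace (𝓡 n) : M → Type _) ℝ
    (TangentSpace 𝓘(ℝ, ℝ) : ℝ → Type _) x₀ x (f x₀) (f x) (mfderiv (𝓡 n) 𝓘(ℝ, ℝ) f x) v = _
  rw [ContinuousLinearMap.inCoordinates_eq hx (show f x ∈ (trivializationAt ℝ
    (TangentSpace 𝓘(ℝ, ℝ) : ℝ → Type _) (f x₀)).baseSet from Set.mem_univ _)]
  simp only [ContinuousLinearMap.comp_apply, ContinuousLinearEquiv.coe_coe,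
    Trivialization.continuousLinearEquivAt_symm_apply, Trivialization.continuousLinearEquivAt_apply,
    trivializationAt_model_space_apply]
  rfl

lemma isSmoothTensor_differentialMul {f h : M → ℝ} (hf : ContMDiff (𝓡 n) 𝓘(ℝ, ℝ) ∞ f)
    (hh : ContMDiff (𝓡 n) 𝓘(ℝ, ℝ) ∞ h) : IsSmoothTensor (differentialMul (n := n) f h) := by
  intro x₀
  rw [contMDiffAt_hom_bundle]
  refine ⟨contMDiffAt_id, ?_⟩
  have hdf := (hf x₀).mfderiv_const (m := ∞) (by simp)
  have hdh := (hh x₀).mfderiv_const (m := ∞) (by simp)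
  have hprod : ContMDiffAt (𝓡 n) 𝓘(ℝ, Coord n →L[ℝ] Coord n →L[ℝ] ℝ) ∞ (fun x =>
      ContinuousLinearMap.smulRightL ℝ (Coord n) (Coord n →L[ℝ] ℝ)
        (inTangentCoordinates (𝓡 n) 𝓘(ℝ, ℝ) id f (mfderiv (𝓡 n) 𝓘(ℝ, ℝ) f) x₀ x)
        (inTangentCoordinates (𝓡 n) 𝓘(ℝ, ℝ) id h (mfderiv (𝓡 n) 𝓘(ℝ, ℝ) h) x₀ x)) x₀ :=
    (contMDiffAt_const.clm_apply hdf).clm_apply hdh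
  refine hprod.congr_of_eventuallyEq ?_
  filter_upwards [(trivializationAt (Coord n) (TangentSpace (𝓡 n) : M → Type _)
    x₀).open_baseSet.mem_nhds (FiberBundle.mem_baseSet_trivializationAt' x₀)] with x hx
  ext v w
  rw [inCoordinates_apply_eq₂ hx hx (Set.mem_univ _)]
  simp [inTangentCoordinates_mfderiv_apply _ hx, differentialMul]

lemma inner_self_nonneg (g : SmoothMetric n M) (x : M) (u : TangentSpace (𝓡 n) x) :
    0 ≤ g.inner x u u := by
  by_cases hu : u = 0
  · rw [hu, map_zero]
  · exact (g.pos x u hu).le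

/-- The metric `g + B`, for a symmetric tensor field `B` small enough to keep it positive. -/
def perturbMetric (g : SmoothMetric n M) {B : TensorField n M} (hB : IsSmoothTensor B)
    (hsymm : ∀ x u v, B x u v = B x v u) (hle : ∀ x u, |B x u u| ≤ 1 / 2 * g.inner x u u) :
    SmoothMetric n M where
  inner x := g.inner x + B x
  symm x u v := by
    rw [add_apply, add_apply, add_apply, add_apply, g.symm, hsymm]
  pos x u hu := by
    have h1 := g.pos x u hu
    have h2 := neg_le_of_abs_le (hle x u)
    rw [add_apply, add_apply]
    linarith
  isVonNBounded x := by
    have h := (g.isVonNBounded x).image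
      ((2 : ℝ) • ContinuousLinearMap.id ℝ (TangentSpace (𝓡 n) x))
    refine h.subset fun u hu => (Set.mem_image _ _ _).2 ⟨(2 : ℝ)⁻¹ • u, ?_, ?_⟩
    · have h1 : g.inner x u u + B x u u < 1 := hu
      have h2 := neg_le_of_abs_le (hle x u)
      have h3 : g.inner x ((2 : ℝ)⁻¹ • u) ((2 : ℝ)⁻¹ • u)
          = (2 : ℝ)⁻¹ * ((2 : ℝ)⁻¹ * g.inner x u u) := by
        rw [map_smul, map_smul, smul_apply, smul_eq_mul, smul_eq_mul]
      change g.inner x _ _ < 1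
      rw [h3]
      linarith
    · change (2 : ℝ) • (2 : ℝ)⁻¹ • u = u
      rw [smul_smul]
      norm_num
  contMDiff := IsSmoothTensor.add (B := g.inner) g.contMDiff hB

end Forms

section Domination

variable {n : ℕ} {M : Type*} [TopologicalSpace M] [ChartedSpace (Coord n) M]
  [IsManifold (𝓡 n) ∞ M]

lemma IsSmoothTensor.contDiffOn_coordBil {B : TensorField n M} (hB : IsSmoothTensor B)
    {e : OpenPartialHomeomorph M (Coord n)} (he : e ∈ IsManifold.maximalAtlas (𝓡 n) ∞ M) :
    ContDiffOn ℝ ∞ (fun y => coordBil (tensorMatrix B e y)) e.target :=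
  ContDiffOn.sum fun i _ => ContDiffOn.sum fun j _ => (hB.contDiffOn he i j).smul contDiffOn_const

lemma IsSmoothTensor.exists_le_nhds (g : SmoothMetric n M) {B : TensorField n M}
    (hB : IsSmoothTensor B) (q : M) :
    ∃ C : ℝ, ∀ᶠ x in 𝓝 q, ∀ u, |B x u u| ≤ C * g.inner x u u := by
  let e := chartAt (Coord n) q
  have he : e ∈ IsManifold.maximalAtlas (𝓡 n) ∞ M := IsManifold.chart_mem_maximalAtlas q
  have hq : q ∈ e.source := mem_chart_source _ q
  have hG := isMetricOn_metricMatrix g he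
  have htarget := e.open_target.mem_nhds (e.map_source hq)
  obtain ⟨C, hC⟩ := exists_eventually_abs_le_mul
    (hG.smooth_coordBil.continuousOn.continuousAt htarget) (hG.pos _ (e.map_source hq))
    ((hB.contDiffOn_coordBil he).continuousOn.continuousAt htarget)
  refine ⟨C, ?_⟩
  filter_upwards [(e.continuousAt hq).eventually hC, e.open_source.mem_nhds hq] with x hx hxs
  suffices h : ∀ u, |B (e.symm (e x)) u u| ≤ C * g.inner (e.symm (e x)) u u by
    rwa [e.left_inv hxs] at h
  intro u
  obtain ⟨a, rfl⟩ := (mdifferentiable_of_mem_maximalAtlas he).symm.mfderiv_surjective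
    (x := e x) (e.map_source hxs) u
  refine le_of_eq_of_le (congrArg abs (coordBil_tensorMatrix B e (e x) a a).symm)
    ((hx a).trans_eq ?_)
  exact congrArg (C * ·) (coordBil_tensorMatrix g.inner e (e x) a a)

lemma IsSmoothTensor.exists_le [CompactSpace M] (g : SmoothMetric n M) {B : TensorField n M}
    (hB : IsSmoothTensor B) : ∃ C : ℝ, ∀ x u, |B x u u| ≤ C * g.inner x u u := by
  suffices ∃ C : ℝ, ∀ x ∈ (Set.univ : Set M), ∀ u, |B x u u| ≤ C * g.inner x u u by
    obtain ⟨C, hC⟩ := this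
    exact ⟨C, fun x => hC x (Set.mem_univ x)⟩
  refine isCompact_univ.induction_on ⟨0, by simp⟩ ?_ ?_ ?_
  · rintro s t hst ⟨C, hC⟩
    exact ⟨C, fun x hx => hC x (hst hx)⟩
  · rintro s t ⟨C, hC⟩ ⟨D, hD⟩
    refine ⟨max C D, fun x hx u => ?_⟩
    rcases hx with hx | hx
    · exact (hC x hx u).trans (mul_le_mul_of_nonneg_right (le_max_left _ _)
      (inner_self_nonneg g x u))
    · exact (hD x hx u).trans (mul_le_mul_of_nonneg_right (le_max_right _ _)
      (inner_self_nonneg g x u))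
  · intro q _
    obtain ⟨C, hC⟩ := hB.exists_le_nhds g q
    exact ⟨_, mem_nhdsWithin_of_mem_nhds hC, C, fun x hx => hx⟩

end Domination

section Perturbation

variable {n : ℕ} {M : Type*} [TopologicalSpace M] [ChartedSpace (Coord n) M]
  [IsManifold (𝓡 n) ∞ M]

lemma IsSmoothTensor.exists_norm_iteratedFDeriv_le {B : TensorField n M} (hB : IsSmoothTensor B)
    {e : OpenPartialHomeomorph M (Coord n)} (he : e ∈ IsManifold.maximalAtlas (𝓡 n) ∞ M)
    {K : Set (Coord n)} (hK : IsCompact K) (hKe : K ⊆ e.target) (i j : Fin n) (m : ℕ) :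
    ∃ C, ∀ y ∈ K, ‖iteratedFDeriv ℝ m (fun y => tensorMatrix B e y i j) y‖ ≤ C := by
  refine hK.exists_bound_of_continuousOn ?_
  have h := (hB.contDiffOn he i j).continuousOn_iteratedFDerivWithin (m := m)
    (by exact ENat.LEInfty.out) e.open_target.uniqueDiffOn
  exact (h.congr fun y hy => (iteratedFDerivWithin_of_isOpen m e.open_target hy).symm).mono hKe

lemma iteratedFDeriv_tensorMatrix_add_sum {ι : Type*} [Fintype ι] {B : TensorField n M}
    (hB : IsSmoothTensor B) {b : ι → TensorField n M} (hb : ∀ I, IsSmoothTensor (b I))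
    {e : OpenPartialHomeomorph M (Coord n)} (he : e ∈ IsManifold.maximalAtlas (𝓡 n) ∞ M)
    (s : ι → ℝ) (i j : Fin n) (m : ℕ) {y : Coord n} (hy : y ∈ e.target) :
    iteratedFDeriv ℝ m (fun y => tensorMatrix (fun x => B x + ∑ I, s I • b I x) e y i j) y
      = iteratedFDeriv ℝ m (fun y => tensorMatrix B e y i j) y
        + ∑ I, s I • iteratedFDeriv ℝ m (fun y => tensorMatrix (b I) e y i j) y := by
  have hcd {C : TensorField n M} (hC : IsSmoothTensor C) :
      ContDiffAt ℝ m (fun y => tensorMatrix C e y i j) y :=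
    ((hC.contDiffOn he i j).contDiffAt (e.open_target.mem_nhds hy)).of_le
      (by exact ENat.LEInfty.out)
  have hsum : (fun y => tensorMatrix (fun x => B x + ∑ I, s I • b I x) e y i j)
      = fun y => tensorMatrix B e y i j + ∑ I, s I • tensorMatrix (b I) e y i j := by
    ext z
    simp only [tensorMatrix, Matrix.of_apply, add_apply, sum_apply, smul_apply]
  rw [hsum, fun_iteratedFDeriv_add_apply (hcd hB)
    (ContDiffAt.sum fun I _ => (hcd (hb I)).const_smul (s I)),
    iteratedFDeriv_fun_sum_apply fun I _ => (hcd (hb I)).const_smul (s I)]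
  congr 1
  exact Finset.sum_congr rfl fun I _ => iteratedFDeriv_const_smul_apply' (hcd (hb I))

lemma eventually_sum_abs_mul_lt {ι : Type*} [Fintype ι] (C : ι → ℝ) {ε : ℝ} (hε : 0 < ε) :
    ∀ᶠ s : ι → ℝ in 𝓝 0, ∑ I, |s I| * C I < ε := by
  have hcont : Continuous fun s : ι → ℝ => ∑ I, |s I| * C I := by fun_prop
  have h := hcont.tendsto 0
  simp only [Pi.zero_apply, abs_zero, zero_mul, Finset.sum_const_zero] at h
  exact h.eventually (gt_mem_nhds hε)

lemma tendsto_nhds_ckTopology_iff {α : Type*} {l : Filter α} {T : α → SmoothMetric n M}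
    {g : SmoothMetric n M} {k : ℕ} : Filter.Tendsto T l (@nhds _ (ckTopology n M k) g) ↔
      ∀ e ∈ IsManifold.maximalAtlas (𝓡 n) ∞ M, ∀ i j, ∀ m ≤ k, ∀ K, IsCompact K → K ⊆ e.target →
        TendstoUniformlyOn (fun a => iteratedFDeriv ℝ m fun y => metricMatrix (T a) e y i j)
          (iteratedFDeriv ℝ m fun y => metricMatrix g e y i j) l K := by
  simp only [nhds_iInf, nhds_induced, Filter.tendsto_iInf, Filter.tendsto_comap_iff,
    UniformOnFun.tendsto_iff_tendstoUniformlyOn, Set.mem_ofPred_eq, and_imp]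
  rfl

lemma tendsto_ckTopology {ι : Type*} [Fintype ι] {g : SmoothMetric n M} {k : ℕ}
    {b : ι → TensorField n M} (hb : ∀ I, IsSmoothTensor (b I)) {T : (ι → ℝ) → SmoothMetric n M}
    (hT : ∀ᶠ s in 𝓝 0, ∀ x, (T s).inner x = g.inner x + ∑ I, s I • b I x) :
    Filter.Tendsto T (𝓝 0) (@nhds _ (ckTopology n M k) g) := by
  rw [tendsto_nhds_ckTopology_iff]
  intro e he i j m _ K hK hKe
  rw [Metric.tendstoUniformlyOn_iff]
  intro ε hε
  choose C hC using fun I => (hb I).exists_norm_iteratedFDeriv_le he hK hKe i j m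
  filter_upwards [hT, eventually_sum_abs_mul_lt C hε] with s hs hsε y hy
  have hinner : (T s).inner = fun x => g.inner x + ∑ I, s I • b I x := funext hs
  change dist (iteratedFDeriv ℝ m (fun y => tensorMatrix g.inner e y i j) y)
    (iteratedFDeriv ℝ m (fun y => tensorMatrix (T s).inner e y i j) y) < ε
  rw [hinner, iteratedFDeriv_tensorMatrix_add_sum g.contMDiff hb he s i j m (hKe hy),
    dist_self_add_right]
  refine lt_of_le_of_lt ((norm_sum_le _ _).trans (Finset.sum_le_sum fun I _ => ?_)) hsε
  rw [norm_smul, Real.norm_eq_abs]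
  exact mul_le_mul_of_nonneg_left (hC I y hy) (abs_nonneg _)

lemma exists_perturbation [CompactSpace M] {ι : Type*} [Fintype ι] (g : SmoothMetric n M)
    {b : ι → TensorField n M} (hb : ∀ I, IsSmoothTensor (b I))
    (hsymm : ∀ I x u v, b I x u v = b I x v u) :
    ∃ T : (ι → ℝ) → SmoothMetric n M,
      ∀ᶠ s in 𝓝 0, ∀ x, (T s).inner x = g.inner x + ∑ I, s I • b I x := by
  classical
  have hsm : ∀ s : ι → ℝ, IsSmoothTensor (fun x => ∑ I, s I • b I x) := fun s =>
    IsSmoothTensor.sum fun I _ => IsSmoothTensor.smul (f := fun _ => s I) contMDiff_const (hb I)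
  have hsy : ∀ (s : ι → ℝ) x u v, (∑ I, s I • b I x) u v = (∑ I, s I • b I x) v u := by
    intro s x u v
    simp only [sum_apply, smul_apply, hsymm _ x u v]
  refine ⟨fun s => if h : ∀ x u, |(∑ I, s I • b I x) u u| ≤ 1 / 2 * g.inner x u u then
    perturbMetric g (hsm s) (hsy s) h else g, ?_⟩
  choose C hC using fun I => (hb I).exists_le g
  filter_upwards [eventually_sum_abs_mul_lt C (show (0 : ℝ) < 1 / 2 by norm_num)] with s hs x
  rw [dif_pos]
  · rfl
  · intro x u
    simp only [sum_apply, smul_apply, smul_eq_mul]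
    calc |∑ I, s I * b I x u u| ≤ ∑ I, |s I * b I x u u| := Finset.abs_sum_le_sum_abs _ _
      _ ≤ ∑ I, |s I| * C I * g.inner x u u := Finset.sum_le_sum fun I _ => by
          rw [abs_mul, mul_assoc]
          exact mul_le_mul_of_nonneg_left (hC I x u) (abs_nonneg _)
      _ = (∑ I, |s I| * C I) * g.inner x u u := by rw [Finset.sum_mul]
      _ ≤ _ := mul_le_mul_of_nonneg_right hs.le (inner_self_nonneg g x u)

end Perturbation

section PolyForm

variable {n d : ℕ}

/-- The symmetric bilinear form with polynomial coefficients `s` in the linear coordinates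
`lam`. -/
def polyForm (lam : Fin n → Coord n →L[ℝ] ℝ) (s : (Fin (d + 2) → Fin n) → ℝ) (w : Coord n) :
    Coord n →L[ℝ] Coord n →L[ℝ] ℝ :=
  ∑ I, s I • (∏ k : Fin d, lam (I (Fin.castAdd 2 k)) w) •
    ((lam (I (Fin.natAdd d 0))).smulRight (lam (I (Fin.natAdd d 1)))
      + (lam (I (Fin.natAdd d 1))).smulRight (lam (I (Fin.natAdd d 0))))

lemma contDiff_polyForm (lam : Fin n → Coord n →L[ℝ] ℝ) (s : (Fin (d + 2) → Fin n) → ℝ)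
    (y₀ : Coord n) : ContDiff ℝ ∞ fun y => polyForm lam s (y - y₀) := by
  refine ContDiff.sum fun I _ => ContDiff.const_smul _ (ContDiff.fun_smul ?_ contDiff_const)
  refine contDiff_prod fun k _ => ?_
  exact (lam _).contDiff.comp (contDiff_id.sub contDiff_const)

lemma hasFDerivAt_sub_const_clm {y₀ : Coord n} (α : Coord n →L[ℝ] ℝ) (y : Coord n) :
    HasFDerivAt (fun z => α (z - y₀)) α y :=
  α.hasFDerivAt.comp y ((hasFDerivAt_id y).sub_const y₀)

section Manifold

variable {M : Type*} [TopologicalSpace M] [ChartedSpace (Coord n) M]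

/-- The symmetric tensor field with the monomial `I` as its coefficient, in terms of functions `f`
on the manifold; where these are linear coordinates it is the summand of index `I` in `polyForm`. -/
def monomialTensor (f : Fin n → M → ℝ) (I : Fin (d + 2) → Fin n) : TensorField n M := fun x =>
  (∏ k : Fin d, f (I (Fin.castAdd 2 k)) x) •
    (differentialMul (f (I (Fin.natAdd d 0))) (f (I (Fin.natAdd d 1))) x
      + differentialMul (f (I (Fin.natAdd d 1))) (f (I (Fin.natAdd d 0))) x)

lemma monomialTensor_symm (f : Fin n → M → ℝ) (I : Fin (d + 2) → Fin n) (x : M)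
    (u v : TangentSpace (𝓡 n) x) : monomialTensor f I x u v = monomialTensor f I x v u := by
  simp only [monomialTensor, differentialMul, smul_apply, add_apply,
    ContinuousLinearMap.smulRight_apply, smul_eq_mul]
  ring

variable [IsManifold (𝓡 n) ∞ M]

lemma exists_contMDiff_eventually_eq [T2Space M] (q : M) (lam : Coord n →L[ℝ] ℝ) :
    ∃ f : M → ℝ, ContMDiff (𝓡 n) 𝓘(ℝ, ℝ) ∞ f ∧ ∀ᶠ y in 𝓝 (chartAt (Coord n) q q),
      f ((chartAt (Coord n) q).symm y) = lam (y - chartAt (Coord n) q q) := by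
  set e := chartAt (Coord n) q
  have he : e ∈ IsManifold.maximalAtlas (𝓡 n) ∞ M := IsManifold.chart_mem_maximalAtlas q
  have hq : q ∈ e.source := mem_chart_source _ q
  obtain ⟨ρ⟩ : Nonempty (SmoothBumpFunction (𝓡 n) q) := inferInstance
  refine ⟨fun x => ρ x • lam (e x - e q), ρ.contMDiff_smul ?_, ?_⟩
  · have h1 : ContMDiff (𝓡 n) 𝓘(ℝ, ℝ) ∞ (fun y : Coord n => lam (y - e q)) :=
      (lam.contDiff.comp (contDiff_id.sub contDiff_const)).contMDiff
    exact h1.comp_contMDiffOn (contMDiffOn_of_mem_maximalAtlas he)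
  · have hcont : Filter.Tendsto e.symm (𝓝 (e q)) (𝓝 q) := by
      have := e.symm.continuousAt (x := e q) (e.map_source hq)
      rwa [ContinuousAt, e.left_inv hq] at this
    filter_upwards [hcont.eventually ρ.eventuallyEq_one,
      e.open_target.mem_nhds (e.map_source hq)] with y hy hyt
    rw [hy, Pi.one_apply, one_smul, e.right_inv hyt]

lemma differential_mfderiv_symm {e : OpenPartialHomeomorph M (Coord n)}
    (he : e ∈ IsManifold.maximalAtlas (𝓡 n) ∞ M) {f : M → ℝ}
    (hf : ContMDiff (𝓡 n) 𝓘(ℝ, ℝ) ∞ f) {y : Coord n} (hy : y ∈ e.target) (a : Coord n) :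
    differential f (e.symm y) (mfderiv (𝓡 n) (𝓡 n) e.symm y a)
      = fderiv ℝ (fun z => f (e.symm z)) y a := by
  have h := mfderiv_comp (I := 𝓡 n) (I' := 𝓡 n) (I'' := 𝓘(ℝ, ℝ)) y
    ((hf (e.symm y)).mdifferentiableAt (by simp))
    ((mdifferentiable_of_mem_maximalAtlas he).mdifferentiableAt_symm hy)
  rw [mfderiv_eq_fderiv] at h
  exact (DFunLike.congr_fun h a).symm

lemma isSmoothTensor_monomialTensor {f : Fin n → M → ℝ}
    (hf : ∀ i, ContMDiff (𝓡 n) 𝓘(ℝ, ℝ) ∞ (f i)) (I : Fin (d + 2) → Fin n) :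
    IsSmoothTensor (monomialTensor f I) :=
  IsSmoothTensor.smul (contMDiff_finsetProd fun _ _ => hf _)
    ((isSmoothTensor_differentialMul (hf _) (hf _)).add
      (isSmoothTensor_differentialMul (hf _) (hf _)))

lemma differential_mfderiv_symm_of_eventually_eq {e : OpenPartialHomeomorph M (Coord n)}
    (he : e ∈ IsManifold.maximalAtlas (𝓡 n) ∞ M) {f : M → ℝ}
    (hf : ContMDiff (𝓡 n) 𝓘(ℝ, ℝ) ∞ f) {α : Coord n →L[ℝ] ℝ} {y₀ y : Coord n}
    (hy : y ∈ e.target) (hfy : ∀ᶠ z in 𝓝 y, f (e.symm z) = α (z - y₀)) (a : Coord n) :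
    differential f (e.symm y) (mfderiv (𝓡 n) (𝓡 n) e.symm y a) = α a := by
  rw [differential_mfderiv_symm he hf hy, Filter.EventuallyEq.fderiv_eq hfy,
    (hasFDerivAt_sub_const_clm α y).fderiv]

theorem exists_perturbation_polyForm [T2Space M] [CompactSpace M] (g : SmoothMetric n M) (q : M)
    (lam : Fin n → Coord n →L[ℝ] ℝ) (k : ℕ) :
    ∃ T : ((Fin (d + 2) → Fin n) → ℝ) → SmoothMetric n M,
      Filter.Tendsto T (𝓝 0) (@nhds _ (ckTopology n M k) g) ∧
      ∀ᶠ s in 𝓝 0, ∀ᶠ y in 𝓝 (chartAt (Coord n) q q),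
        metricForm (T s) (chartAt (Coord n) q) y = metricForm g (chartAt (Coord n) q) y
          + polyForm lam s (y - chartAt (Coord n) q q) := by
  choose f hf hfe using fun i => exists_contMDiff_eventually_eq (M := M) q (lam i)
  set e := chartAt (Coord n) q
  have he : e ∈ IsManifold.maximalAtlas (𝓡 n) ∞ M := IsManifold.chart_mem_maximalAtlas q
  have hb := isSmoothTensor_monomialTensor (d := d) hf
  obtain ⟨T, hT⟩ := exists_perturbation g hb (monomialTensor_symm f)
  refine ⟨T, tendsto_ckTopology hb hT, ?_⟩
  filter_upwards [hT] with s hs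
  filter_upwards [Filter.eventually_all.2 fun i => eventually_eventually_nhds.2 (hfe i),
    e.open_target.mem_nhds (e.map_source (mem_chart_source _ q))] with y hy hyt
  have hd (i : Fin n) (a : Coord n) :
      differential (f i) (e.symm y) (mfderiv (𝓡 n) (𝓡 n) e.symm y a) = lam i a :=
    differential_mfderiv_symm_of_eventually_eq he (hf i) hyt (hy i) a
  ext a c
  rw [add_apply, add_apply]
  change coordBil (tensorMatrix (T s).inner e y) a c
    = coordBil (tensorMatrix g.inner e y) a c + _
  rw [coordBil_tensorMatrix, coordBil_tensorMatrix, hs, add_apply, add_apply]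
  congr 1
  simp only [polyForm, sum_apply, smul_apply, monomialTensor, differentialMul, add_apply,
    ContinuousLinearMap.smulRight_apply, hd, (hy _).self_of_nhds]

end Manifold

section PolyJets

variable {lam : Fin n → Coord n →L[ℝ] ℝ} {y₀ : Coord n}

lemma fderiv_sum_mul {ι : Type*} [Fintype ι] {k : ι → ℝ} {u : ι → Coord n → ℝ} {y : Coord n}
    (hu : ∀ I, DifferentiableAt ℝ (u I) y) (a : Coord n) :
    fderiv ℝ (fun z => ∑ I, k I * u I z) y a = ∑ I, k I * fderiv ℝ (u I) y a := by
  rw [fderiv_fun_sum fun I _ => (hu I).const_mul (k I), sum_apply]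
  refine Finset.sum_congr rfl fun I _ => ?_
  rw [fderiv_const_mul (hu I), smul_apply, smul_eq_mul]

lemma fderiv_mul_clm (α β : Coord n →L[ℝ] ℝ) (y a : Coord n) :
    fderiv ℝ (fun z => α (z - y₀) * β (z - y₀)) y a
      = α a * β (y - y₀) + α (y - y₀) * β a := by
  rw [((hasFDerivAt_sub_const_clm α y).fun_mul (hasFDerivAt_sub_const_clm β y)).fderiv]
  simp only [add_apply, smul_apply, smul_eq_mul]
  ring

lemma fderiv_mul_mul_clm (α β γ : Coord n →L[ℝ] ℝ) (y a : Coord n) :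
    fderiv ℝ (fun z => α (z - y₀) * β (z - y₀) * γ (z - y₀)) y a
      = α a * (β (y - y₀) * γ (y - y₀)) + β a * (α (y - y₀) * γ (y - y₀))
        + γ a * (α (y - y₀) * β (y - y₀)) := by
  rw [(((hasFDerivAt_sub_const_clm α y).fun_mul (hasFDerivAt_sub_const_clm β y)).fun_mul
    (hasFDerivAt_sub_const_clm γ y)).fderiv]
  simp only [add_apply, smul_apply, smul_eq_mul]
  ring

lemma polyForm_two_apply (s : (Fin 4 → Fin n) → ℝ) (w z t : Coord n) :
    polyForm (d := 2) lam s w z t = ∑ I, s I * (lam (I 2) z * lam (I 3) t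
      + lam (I 3) z * lam (I 2) t) * (lam (I 0) w * lam (I 1) w) := by
  simp only [polyForm, sum_apply, smul_apply, Fin.prod_univ_two, add_apply, smul_eq_mul,
    ContinuousLinearMap.smulRight_apply]
  refine Finset.sum_congr rfl fun I _ => ?_
  change s I * (lam (I 0) w * lam (I 1) w * (lam (I 2) z * lam (I 3) t
      + lam (I 3) z * lam (I 2) t)) = _
  ring

lemma polyForm_three_apply (s : (Fin 5 → Fin n) → ℝ) (w z t : Coord n) :
    polyForm (d := 3) lam s w z t = ∑ I, s I * (lam (I 3) z * lam (I 4) t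
      + lam (I 4) z * lam (I 3) t) * (lam (I 0) w * lam (I 1) w * lam (I 2) w) := by
  simp only [polyForm, sum_apply, smul_apply, Fin.prod_univ_three, add_apply, smul_eq_mul,
    ContinuousLinearMap.smulRight_apply]
  refine Finset.sum_congr rfl fun I _ => ?_
  change s I * (lam (I 0) w * lam (I 1) w * lam (I 2) w * (lam (I 3) z * lam (I 4) t
      + lam (I 4) z * lam (I 3) t)) = _
  ring

lemma fderiv_polyForm_two_apply (s : (Fin 4 → Fin n) → ℝ) (y a z t : Coord n) :
    fderiv ℝ (fun w => polyForm (d := 2) lam s (w - y₀) z t) y a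
      = ∑ I, s I * (lam (I 2) z * lam (I 3) t + lam (I 3) z * lam (I 2) t)
        * (lam (I 0) a * lam (I 1) (y - y₀) + lam (I 0) (y - y₀) * lam (I 1) a) := by
  simp only [polyForm_two_apply]
  rw [fderiv_sum_mul fun I => by fun_prop]
  simp only [fderiv_mul_clm]

lemma fderiv_fderiv_polyForm_two_apply (s : (Fin 4 → Fin n) → ℝ) (y c a z t : Coord n) :
    fderiv ℝ (fun w' => fderiv ℝ (fun w => polyForm (d := 2) lam s (w - y₀) z t) w' a) y c
      = ∑ I, s I * (lam (I 2) z * lam (I 3) t + lam (I 3) z * lam (I 2) t)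
        * (lam (I 0) a * lam (I 1) c + lam (I 0) c * lam (I 1) a) := by
  simp only [fderiv_polyForm_two_apply]
  rw [fderiv_sum_mul fun I => by fun_prop]
  refine Finset.sum_congr rfl fun I _ => ?_
  rw [(((hasFDerivAt_sub_const_clm (y₀ := y₀) (lam (I 1)) y).const_mul (lam (I 0) a)).fun_add
    ((hasFDerivAt_sub_const_clm (y₀ := y₀) (lam (I 0)) y).mul_const (lam (I 1) a))).fderiv]
  simp only [add_apply, smul_apply, smul_eq_mul]
  ring

lemma fderiv_polyForm_three_apply (s : (Fin 5 → Fin n) → ℝ) (y a z t : Coord n) :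
    fderiv ℝ (fun w => polyForm (d := 3) lam s (w - y₀) z t) y a
      = ∑ I, s I * (lam (I 3) z * lam (I 4) t + lam (I 4) z * lam (I 3) t)
        * (lam (I 0) a * (lam (I 1) (y - y₀) * lam (I 2) (y - y₀))
          + lam (I 1) a * (lam (I 0) (y - y₀) * lam (I 2) (y - y₀))
          + lam (I 2) a * (lam (I 0) (y - y₀) * lam (I 1) (y - y₀))) := by
  simp only [polyForm_three_apply]
  rw [fderiv_sum_mul fun I => by fun_prop]
  simp only [fderiv_mul_mul_clm]

lemma fderiv_fderiv_polyForm_three_apply (s : (Fin 5 → Fin n) → ℝ) (y c a z t : Coord n) :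
    fderiv ℝ (fun w' => fderiv ℝ (fun w => polyForm (d := 3) lam s (w - y₀) z t) w' a) y c
      = ∑ I, s I * (lam (I 3) z * lam (I 4) t + lam (I 4) z * lam (I 3) t)
        * (lam (I 0) a * (lam (I 1) c * lam (I 2) (y - y₀) + lam (I 1) (y - y₀) * lam (I 2) c)
          + lam (I 1) a * (lam (I 0) c * lam (I 2) (y - y₀) + lam (I 0) (y - y₀) * lam (I 2) c)
          + lam (I 2) a * (lam (I 0) c * lam (I 1) (y - y₀)
            + lam (I 0) (y - y₀) * lam (I 1) c)) := by
  simp only [fderiv_polyForm_three_apply]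
  rw [fderiv_sum_mul fun I => by fun_prop]
  refine Finset.sum_congr rfl fun I _ => ?_
  rw [fderiv_fun_add (by fun_prop) (by fun_prop), fderiv_fun_add (by fun_prop) (by fun_prop),
    fderiv_const_mul (by fun_prop), fderiv_const_mul (by fun_prop), fderiv_const_mul (by fun_prop)]
  simp only [add_apply, smul_apply, smul_eq_mul, fderiv_mul_clm]

lemma fderiv_fderiv_fderiv_polyForm_three_apply (s : (Fin 5 → Fin n) → ℝ)
    (y c' c a z t : Coord n) :
    fderiv ℝ (fun w'' => fderiv ℝ (fun w' =>
        fderiv ℝ (fun w => polyForm (d := 3) lam s (w - y₀) z t) w' a) w'' c) y c'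
      = ∑ I, s I * (lam (I 3) z * lam (I 4) t + lam (I 4) z * lam (I 3) t)
        * (lam (I 0) a * (lam (I 1) c * lam (I 2) c' + lam (I 1) c' * lam (I 2) c)
          + lam (I 1) a * (lam (I 0) c * lam (I 2) c' + lam (I 0) c' * lam (I 2) c)
          + lam (I 2) a * (lam (I 0) c * lam (I 1) c' + lam (I 0) c' * lam (I 1) c)) := by
  simp only [fderiv_fderiv_polyForm_three_apply]
  rw [fderiv_sum_mul fun I => by fun_prop]
  refine Finset.sum_congr rfl fun I _ => ?_
  have h : ∀ (α β : Coord n →L[ℝ] ℝ) (p r : ℝ),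
      HasFDerivAt (fun z => p * β (z - y₀) + α (z - y₀) * r) (p • β + r • α) y := fun α β p r =>
    ((hasFDerivAt_sub_const_clm β y).const_mul p).fun_add
      ((hasFDerivAt_sub_const_clm α y).mul_const r)
  rw [((((h (lam (I 1)) (lam (I 2)) (lam (I 1) c) (lam (I 2) c)).const_mul (lam (I 0) a)).fun_add
    ((h (lam (I 0)) (lam (I 2)) (lam (I 0) c) (lam (I 2) c)).const_mul (lam (I 1) a))).fun_add
    ((h (lam (I 0)) (lam (I 1)) (lam (I 0) c) (lam (I 1) c)).const_mul (lam (I 2) a))).fderiv]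
  simp only [add_apply, smul_apply, smul_eq_mul]
  ring

end PolyJets

end PolyForm

/-! ### Generic metrics -/

section SumJets

variable {E F : Type*} [NormedAddCommGroup E] [NormedSpace ℝ E] [NormedAddCommGroup F]
  [NormedSpace ℝ F]

lemma eventuallyEq_fderiv_add {Ω : Set E} (hΩ : IsOpen Ω) {x : E} (hx : x ∈ Ω) {u v w : E → F}
    (hv : ContDiffOn ℝ ∞ v Ω) (hw : ContDiff ℝ ∞ w) (h : u =ᶠ[𝓝 x] fun y => v y + w y) :
    fderiv ℝ u =ᶠ[𝓝 x] fun y => fderiv ℝ v y + fderiv ℝ w y := by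
  filter_upwards [h.fderiv (𝕜 := ℝ), hΩ.mem_nhds hx] with y hy hyΩ
  rw [hy, fderiv_fun_add (differentiableAt_of_contDiffOn hv hΩ hyΩ)
    (hw.differentiable (by simp) y)]

lemma eventuallyEq_fderiv_fderiv_add {Ω : Set E} (hΩ : IsOpen Ω) {x : E} (hx : x ∈ Ω)
    {u v w : E → F} (hv : ContDiffOn ℝ ∞ v Ω) (hw : ContDiff ℝ ∞ w)
    (h : u =ᶠ[𝓝 x] fun y => v y + w y) :
    fderiv ℝ (fderiv ℝ u) =ᶠ[𝓝 x] fun y => fderiv ℝ (fderiv ℝ v) y + fderiv ℝ (fderiv ℝ w) y :=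
  eventuallyEq_fderiv_add hΩ hx (contDiffOn_fderiv hv hΩ) (hw.fderiv_right (by simp))
    (eventuallyEq_fderiv_add hΩ hx hv hw h)

lemma eventuallyEq_fderiv_fderiv_fderiv_add {Ω : Set E} (hΩ : IsOpen Ω) {x : E} (hx : x ∈ Ω)
    {u v w : E → F} (hv : ContDiffOn ℝ ∞ v Ω) (hw : ContDiff ℝ ∞ w)
    (h : u =ᶠ[𝓝 x] fun y => v y + w y) :
    fderiv ℝ (fderiv ℝ (fderiv ℝ u)) =ᶠ[𝓝 x] fun y =>
      fderiv ℝ (fderiv ℝ (fderiv ℝ v)) y + fderiv ℝ (fderiv ℝ (fderiv ℝ w)) y :=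
  eventuallyEq_fderiv_fderiv_add hΩ hx (contDiffOn_fderiv hv hΩ) (hw.fderiv_right (by simp))
    (eventuallyEq_fderiv_add hΩ hx hv hw h)

end SumJets

section PolyJetsAtOrigin

variable {n : ℕ} (lam : Fin n → Coord n →L[ℝ] ℝ) (y₀ : Coord n)

lemma polyForm_zero {d : ℕ} [NeZero d] (s : (Fin (d + 2) → Fin n) → ℝ) :
    polyForm lam s 0 = 0 := by
  refine Finset.sum_eq_zero fun I _ => ?_
  have h : ∏ k : Fin d, lam (I (Fin.castAdd 2 k)) 0 = 0 :=
    Finset.prod_eq_zero (Finset.mem_univ 0) (map_zero _)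
  rw [h, zero_smul, smul_zero]

lemma fderiv_polyForm_two_self (s : (Fin 4 → Fin n) → ℝ) :
    fderiv ℝ (fun y => polyForm (d := 2) lam s (y - y₀)) y₀ = 0 := by
  ext a z t
  rw [fderiv_apply₂ isOpen_univ (contDiff_polyForm lam s y₀).contDiffOn (Set.mem_univ _),
    fderiv_polyForm_two_apply]
  simp

lemma fderiv_polyForm_three_self (s : (Fin 5 → Fin n) → ℝ) :
    fderiv ℝ (fun y => polyForm (d := 3) lam s (y - y₀)) y₀ = 0 := by
  ext a z t
  rw [fderiv_apply₂ isOpen_univ (contDiff_polyForm lam s y₀).contDiffOn (Set.mem_univ _),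
    fderiv_polyForm_three_apply]
  simp

lemma fderiv_fderiv_polyForm_three_self (s : (Fin 5 → Fin n) → ℝ) :
    fderiv ℝ (fderiv ℝ (fun y => polyForm (d := 3) lam s (y - y₀))) y₀ = 0 := by
  ext c a z t
  rw [fderiv_fderiv_apply₂ isOpen_univ (contDiff_polyForm lam s y₀).contDiffOn (Set.mem_univ _),
    fderiv_fderiv_polyForm_three_apply]
  simp

variable {B : Coord n →L[ℝ] Coord n →L[ℝ] ℝ} {F₀ : Fin n → Coord n}

lemma fderiv_fderiv_polyForm_two_frameMul (hF₀ : IsOrthoFrame B F₀)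
    (Q : Matrix (Fin n) (Fin n) ℝ) (s : (Fin 4 → Fin n) → ℝ) (c a z t : Fin n) :
    fderiv ℝ (fderiv ℝ fun y => polyForm (d := 2) (fun i => B (F₀ i)) s (y - y₀)) y₀
      (frameMul Q F₀ c) (frameMul Q F₀ a) (frameMul Q F₀ z) (frameMul Q F₀ t)
      = secondJet (frameAct Q s) c a z t := by
  rw [fderiv_fderiv_apply₂ isOpen_univ (contDiff_polyForm _ s y₀).contDiffOn (Set.mem_univ _),
    fderiv_fderiv_polyForm_two_apply]
  simp only [hF₀.apply_frameMul, secondJet, frameAct_apply, Fin.prod_univ_four,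
    ← Finset.sum_add_distrib]
  refine Finset.sum_congr rfl fun I _ => ?_
  simp only [Matrix.cons_val_zero, Matrix.cons_val_one, Matrix.cons_val]
  ring

lemma fderiv_fderiv_fderiv_polyForm_three_frameMul (hF₀ : IsOrthoFrame B F₀)
    (Q : Matrix (Fin n) (Fin n) ℝ) (s : (Fin 5 → Fin n) → ℝ) (y c a z t : Fin n) :
    fderiv ℝ (fderiv ℝ (fderiv ℝ fun y => polyForm (d := 3) (fun i => B (F₀ i)) s (y - y₀))) y₀
      (frameMul Q F₀ y) (frameMul Q F₀ c) (frameMul Q F₀ a) (frameMul Q F₀ z) (frameMul Q F₀ t)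
      = thirdJet (frameAct Q s) y c a z t := by
  rw [fderiv_fderiv_fderiv_apply₂ isOpen_univ (contDiff_polyForm _ s y₀).contDiffOn
    (Set.mem_univ _), fderiv_fderiv_fderiv_polyForm_three_apply]
  simp only [hF₀.apply_frameMul, thirdJet, frameAct_apply, Fin.prod_univ_five,
    ← Finset.sum_add_distrib]
  refine Finset.sum_congr rfl fun I _ => ?_
  simp only [Matrix.cons_val_zero, Matrix.cons_val_one, Matrix.cons_val]
  ring

end PolyJetsAtOrigin

section Obstructions

/-- The obstruction in dimension at least four for the metric with coordinate form `h`, at the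
point `y`. -/
def weylAt {m : ℕ} (h : Coord (m + 4) → Coord (m + 4) →L[ℝ] Coord (m + 4) →L[ℝ] ℝ)
    (y : Coord (m + 4)) (F : Fin (m + 4) → Coord (m + 4)) : ℝ :=
  weylObstruction (fderiv ℝ h y) (fderiv ℝ (fderiv ℝ h) y) F

/-- The obstruction in dimension three for the metric with coordinate form `h`, at the point
`y`. -/
def cottonAt (h : Coord 3 → Coord 3 →L[ℝ] Coord 3 →L[ℝ] ℝ) (y : Coord 3) (F : Fin 3 → Coord 3) :
    ℝ :=
  cottonObstruction (fderiv ℝ h y) (fderiv ℝ (fderiv ℝ h) y)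
    (fderiv ℝ (fderiv ℝ (fderiv ℝ h)) y) F

lemma weylAt_add_polyForm {m : ℕ}
    {h h' : Coord (m + 4) → Coord (m + 4) →L[ℝ] Coord (m + 4) →L[ℝ] ℝ} {Ω : Set (Coord (m + 4))}
    (hΩ : IsOpen Ω) {y₀ : Coord (m + 4)} (hy₀ : y₀ ∈ Ω) (hh : ContDiffOn ℝ ∞ h Ω)
    {B : Coord (m + 4) →L[ℝ] Coord (m + 4) →L[ℝ] ℝ} {F₀ : Fin (m + 4) → Coord (m + 4)}
    (hF₀ : IsOrthoFrame B F₀) {s : (Fin 4 → Fin (m + 4)) → ℝ}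
    (hs : ∀ᶠ y in 𝓝 y₀, h' y = h y + polyForm (d := 2) (fun i => B (F₀ i)) s (y - y₀))
    (Q : Matrix (Fin (m + 4)) (Fin (m + 4)) ℝ) :
    weylAt h' y₀ (frameMul Q F₀)
      = weylAt h y₀ (frameMul Q F₀) + weylFunctional m (frameAct Q s) := by
  have hp := contDiff_polyForm (d := 2) (fun i => B (F₀ i)) s y₀
  have h₁ : fderiv ℝ h' y₀ = fderiv ℝ h y₀ := by
    simpa only [fderiv_polyForm_two_self, add_zero]
      using (eventuallyEq_fderiv_add hΩ hy₀ hh hp hs).self_of_nhds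
  rw [weylAt, h₁, (eventuallyEq_fderiv_fderiv_add hΩ hy₀ hh hp hs).self_of_nhds]
  exact weylObstruction_add (fderiv_fderiv_polyForm_two_frameMul y₀ hF₀ Q s)

lemma cottonAt_add_polyForm {h h' : Coord 3 → Coord 3 →L[ℝ] Coord 3 →L[ℝ] ℝ} {Ω : Set (Coord 3)}
    (hΩ : IsOpen Ω) {y₀ : Coord 3} (hy₀ : y₀ ∈ Ω) (hh : ContDiffOn ℝ ∞ h Ω)
    {B : Coord 3 →L[ℝ] Coord 3 →L[ℝ] ℝ} {F₀ : Fin 3 → Coord 3} (hF₀ : IsOrthoFrame B F₀)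
    {s : (Fin 5 → Fin 3) → ℝ}
    (hs : ∀ᶠ y in 𝓝 y₀, h' y = h y + polyForm (d := 3) (fun i => B (F₀ i)) s (y - y₀))
    (Q : Matrix (Fin 3) (Fin 3) ℝ) :
    cottonAt h' y₀ (frameMul Q F₀)
      = cottonAt h y₀ (frameMul Q F₀) + cottonFunctional (frameAct Q s) := by
  have hp := contDiff_polyForm (d := 3) (fun i => B (F₀ i)) s y₀
  have h₁ : fderiv ℝ h' y₀ = fderiv ℝ h y₀ := by
    simpa only [fderiv_polyForm_three_self, add_zero]
      using (eventuallyEq_fderiv_add hΩ hy₀ hh hp hs).self_of_nhds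
  have h₂ : fderiv ℝ (fderiv ℝ h') y₀ = fderiv ℝ (fderiv ℝ h) y₀ := by
    simpa only [fderiv_fderiv_polyForm_three_self, add_zero]
      using (eventuallyEq_fderiv_fderiv_add hΩ hy₀ hh hp hs).self_of_nhds
  rw [cottonAt, h₁, h₂, (eventuallyEq_fderiv_fderiv_fderiv_add hΩ hy₀ hh hp hs).self_of_nhds]
  exact cottonObstruction_add (fderiv_fderiv_fderiv_polyForm_three_frameMul y₀ hF₀ Q s)

end Obstructions

section Generic

variable {n k : ℕ} {M : Type*} [TopologicalSpace M] [ChartedSpace (Coord n) M]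
  [IsManifold (𝓡 n) ∞ M]

theorem dense_not_hasDegenerateFrame [T2Space M] [CompactSpace M] {d : ℕ} [NeZero d] {q : M}
    {e : OpenPartialHomeomorph M (Coord n)} (he : e = chartAt (Coord n) q) (i₀ : Fin n)
    {f : SmoothMetric n M → (Fin n → Coord n) → ℝ} (hf : ∀ g, ContDiff ℝ 1 (f g))
    {ℓ : ((Fin (d + 2) → Fin n) → ℝ) →ₗ[ℝ] ℝ} {P : Fin n → Matrix (Fin n) (Fin n) ℝ}
    (hP : ∀ p, P p ∈ axisStabilizer i₀) (hli : LinearIndependent ℝ fun p => ℓ ∘ₗ frameAct (P p))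
    (hfℓ : ∀ (g g' : SmoothMetric n M) (F₀ : Fin n → Coord n) (s : (Fin (d + 2) → Fin n) → ℝ),
      IsOrthoFrame (metricForm g e (e q)) F₀ →
      (∀ᶠ y in 𝓝 (e q), metricForm g' e y = metricForm g e y
        + polyForm (fun i => metricForm g e (e q) (F₀ i)) s (y - e q)) →
      ∀ Q, f g' (frameMul Q F₀) = f g (frameMul Q F₀) + ℓ (frameAct Q s)) :
    @Dense _ (ckTopology n M k) {g | ¬ HasDegenerateFrame (metricForm g e (e q)) (f g) i₀} := by
  subst he
  set e := chartAt (Coord n) q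
  let := ckTopology n M k
  intro g
  have hq : e q ∈ e.target := e.map_source (mem_chart_source _ q)
  have hm := isMetricOn_metricMatrix g (IsManifold.chart_mem_maximalAtlas q)
  have hn : Module.finrank ℝ (Coord n) = n := finrank_euclideanSpace_fin
  obtain ⟨F₀, hF₀⟩ : ∃ F₀, IsOrthoFrame (metricForm g e (e q)) F₀ :=
    exists_isOrthoFrame (coordBil_symm (hm.symm _ hq)) (hm.pos _ hq) hn
  obtain ⟨T, hTg, hT⟩ :=
    exists_perturbation_polyForm (d := d) g q (fun i => metricForm g e (e q) (F₀ i)) k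
  have hc : ContDiff ℝ 1 fun Q : Fin n → Fin n → ℝ => f g (frameMul (Matrix.of Q) F₀) := by
    refine (hf g).comp (contDiff_pi.2 fun i => ContDiff.sum fun j _ => ?_)
    exact ContDiff.fun_smul ((contDiff_apply ℝ ℝ j).comp (contDiff_apply ℝ (Fin n → ℝ) i))
      contDiff_const
  have hD := dense_setOf_forall_exists_axisStabilizer_ne_zero i₀ hc hP hli
  refine mem_closure_of_frequently_of_tendsto
    ((mem_closure_iff_frequently.1 (hD 0)).and_eventually hT |>.mono ?_) hTg
  rintro s ⟨hs, hTs⟩ ⟨F, hF, hFP⟩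
  have hval : metricForm (T s) e (e q) = metricForm g e (e q) := by
    rw [hTs.self_of_nhds, sub_self, polyForm_zero, add_zero]
  rw [hval] at hF
  obtain ⟨Q, hQ, rfl⟩ := exists_frameMul_eq hF hF₀ hn
  obtain ⟨A, hA, hne⟩ := hs Q hQ
  refine hne ((hfℓ g (T s) F₀ s hF₀ hTs (A * Q)).symm.trans ?_)
  rw [frameMul_mul]
  exact hFP A hA

theorem exists_isOpen_dense_of_dense_not_hasDegenerateFrame
    {e : OpenPartialHomeomorph M (Coord n)} {y₀ : Coord n} {U : Set M} (hU : IsOpen U)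
    (he : e ∈ IsManifold.maximalAtlas (𝓡 n) ∞ M) (hy₀ : y₀ ∈ e.target) (hy₀U : e.symm y₀ ∈ U)
    (i₀ : Fin n) {f : SmoothMetric n M → (Fin n → Coord n) → ℝ}
    (hf : Continuous[@instTopologicalSpaceProd _ _ (ckTopology n M k) _, inferInstance]
      fun p : SmoothMetric n M × (Fin n → Coord n) => f p.1 p.2)
    (hdense : @Dense _ (ckTopology n M k)
      {g | ¬ HasDegenerateFrame (metricForm g e y₀) (f g) i₀})
    (hfV : ∀ g (Ω : Set (Coord n)) V A μ, y₀ ∈ Ω →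
      IsCarlemanField Ω (metricForm g e) (coordGamma (metricMatrix g e)) V A μ →
      ∀ F, IsOrthoFrame (metricForm g e y₀) F → ∀ t : ℝ, F i₀ = t • V y₀ → f g F = 0) :
    ∃ O : Set (SmoothMetric n M), IsOpen[ckTopology n M k] O ∧ @Dense _ (ckTopology n M k) O ∧
      ∀ g ∈ O, ¬ ∃ φ : M → ℝ, IsLimitingCarlemanWeight g U φ := by
  let := ckTopology n M k
  refine ⟨_, isOpen_not_hasDegenerateFrame (continuous_metricForm he hy₀)
    (fun g => (isMetricOn_metricMatrix g he).pos y₀ hy₀) hf i₀, hdense, ?_⟩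
  rintro g hg ⟨φ, hφ⟩
  obtain ⟨V, A, μ, hV, hV0⟩ := hφ.exists_isCarlemanField hU he
  have hmem : y₀ ∈ e.target ∩ e.symm ⁻¹' U := ⟨hy₀, hy₀U⟩
  exact hg ((isMetricOn_metricMatrix g he).hasDegenerateFrame hy₀ (hV0 y₀ hmem)
    (hfV g _ V A μ hmem hV))

end Generic

section Main

variable {M : Type*} [TopologicalSpace M] [T2Space M] [CompactSpace M]

theorem exists_isOpen_dense_of_four_le (m : ℕ) [ChartedSpace (Coord (m + 4)) M]
    [IsManifold (𝓡 (m + 4)) ∞ M] {U : Set M} (hU : IsOpen U) (hne : U.Nonempty) :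
    ∃ O : Set (SmoothMetric (m + 4) M), IsOpen[ckTopology (m + 4) M 2] O ∧
      @Dense _ (ckTopology (m + 4) M 2) O ∧
      ∀ g ∈ O, ¬ ∃ φ : M → ℝ, IsLimitingCarlemanWeight g U φ := by
  obtain ⟨q, hq⟩ := hne
  set e := chartAt (Coord (m + 4)) q with he
  have heM : e ∈ IsManifold.maximalAtlas (𝓡 (m + 4)) ∞ M := IsManifold.chart_mem_maximalAtlas q
  have hqs : q ∈ e.source := mem_chart_source _ q
  have hy₀ : e q ∈ e.target := e.map_source hqs
  have hcont : Continuous[@instTopologicalSpaceProd _ _ (ckTopology (m + 4) M 2) _, inferInstance]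
      fun p : SmoothMetric (m + 4) M × (Fin (m + 4) → Coord (m + 4)) =>
        weylAt (metricForm p.1 e) (e q) p.2 := by
    let := ckTopology (m + 4) M 2
    exact continuous_weylObstruction
      ((continuous_fderiv_metricForm heM hy₀ (by norm_num)).comp continuous_fst)
      ((continuous_fderiv_fderiv_metricForm heM hy₀ le_rfl).comp continuous_fst) continuous_snd
  refine exists_isOpen_dense_of_dense_not_hasDegenerateFrame
    (f := fun g => weylAt (metricForm g e) (e q)) hU heM hy₀ (by rwa [e.left_inv hqs])
    0 hcont (dense_not_hasDegenerateFrame (d := 2) he 0 (fun g => ?_) weylFrame_mem_axisStabilizer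
      linearIndependent_weylFunctional_comp_frameAct fun g g' F₀ s hF₀ hs => ?_) ?_
  · exact contDiff_weylObstruction contDiff_const contDiff_const contDiff_id
  · exact weylAt_add_polyForm e.open_target hy₀ (contDiffOn_metricForm heM g) hF₀ hs
  · intro g Ω V A μ hmem hV F hF t hFt
    exact hV.weylObstruction_eq_zero hmem hF finrank_euclideanSpace_fin hFt

theorem exists_isOpen_dense_of_eq_three [ChartedSpace (Coord 3) M]
    [IsManifold (𝓡 3) ∞ M] {U : Set M} (hU : IsOpen U) (hne : U.Nonempty) :
    ∃ O : Set (SmoothMetric 3 M), IsOpen[ckTopology 3 M 3] O ∧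
      @Dense _ (ckTopology 3 M 3) O ∧
      ∀ g ∈ O, ¬ ∃ φ : M → ℝ, IsLimitingCarlemanWeight g U φ := by
  obtain ⟨q, hq⟩ := hne
  set e := chartAt (Coord 3) q with he
  have heM : e ∈ IsManifold.maximalAtlas (𝓡 3) ∞ M := IsManifold.chart_mem_maximalAtlas q
  have hqs : q ∈ e.source := mem_chart_source _ q
  have hy₀ : e q ∈ e.target := e.map_source hqs
  have hcont : Continuous[@instTopologicalSpaceProd _ _ (ckTopology 3 M 3) _, inferInstance]
      fun p : SmoothMetric 3 M × (Fin 3 → Coord 3) => cottonAt (metricForm p.1 e) (e q) p.2 := by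
    let := ckTopology 3 M 3
    exact continuous_cottonObstruction
      ((continuous_fderiv_metricForm heM hy₀ (by norm_num)).comp continuous_fst)
      ((continuous_fderiv_fderiv_metricForm heM hy₀ (by norm_num)).comp continuous_fst)
      ((continuous_fderiv_fderiv_fderiv_metricForm heM hy₀ le_rfl).comp continuous_fst)
      continuous_snd
  refine exists_isOpen_dense_of_dense_not_hasDegenerateFrame
    (f := fun g => cottonAt (metricForm g e) (e q)) hU heM hy₀ (by rwa [e.left_inv hqs])
    0 hcont (dense_not_hasDegenerateFrame (d := 3) he 0 (fun g => ?_) cottonFrame_mem_axisStabilizer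
      linearIndependent_cottonFunctional_comp_frameAct fun g g' F₀ s hF₀ hs => ?_) ?_
  · exact contDiff_cottonObstruction contDiff_const contDiff_const contDiff_const contDiff_id
  · exact cottonAt_add_polyForm e.open_target hy₀ (contDiffOn_metricForm heM g) hF₀ hs
  · intro g Ω V A μ hmem hV F hF t hFt
    exact hV.cottonObstruction_eq_zero hmem hF finrank_euclideanSpace_fin hFt

end Main

end CarlemanWeights

end

theorem theorem1p8 (n : ℕ) (hn : 3 ≤ n) (M : Type*) [TopologicalSpace M] [T2Space M]
    [CompactSpace M] [ChartedSpace (EuclideanSpace ℝ (Fin n)) M] [IsManifold (𝓡 n) ∞ M]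
    (U : Set M) (hU : IsOpen U) (hne : U.Nonempty) :
    ∃ O : Set (CarlemanWeights.SmoothMetric n M),
      IsOpen[CarlemanWeights.ckTopology n M (if n = 3 then 3 else 2)] O ∧
      @Dense _ (CarlemanWeights.ckTopology n M (if n = 3 then 3 else 2)) O ∧
      ∀ g ∈ O, ¬ ∃ φ : M → ℝ, CarlemanWeights.IsLimitingCarlemanWeight g U φ := by
  by_cases h3 : n = 3
  · subst h3
    exact CarlemanWeights.exists_isOpen_dense_of_eq_three hU hne
  · obtain ⟨m, rfl⟩ : ∃ m, n = m + 4 := ⟨n - 4, by omega⟩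
    rw [if_neg h3]
    exact CarlemanWeights.exists_isOpen_dense_of_four_le m hU hne
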